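/- **Setting.** Let $\mu$ be the Haar measure on $SO(3)$ with $\mu(SO(3))=1$, let $\omega(x)\in[0,\pi]$ be the rotation angle of $x\in SO(3)$ (so $\operatorname{tr}x=1+2\cos\omega(x)$), and let $\mathrm{dist}(x,y)=\omega(y^{-1}x)$. Let $\Delta$ be the nonnegative Laplace–Beltrami operator of the bi-invariant Riemannian metric with this distance, i.e. $\Delta=-(X_1^2+X_2^2+X_3^2)$ with $X_if(x)=\frac{d}{dt}\big|_{t=0}f(xR_i(t))$, where $R_i(t)$ is the rotation by the angle $t$ about the $i$-th coordinate axis. Its eigenvalues are $\ell(\ell+1)$, $\ell\in\mathbb N_0$. Let $\mathcal H_\ell$ be the eigenspace for $\ell(\ell+1)$ and $\Pi_n=\bigoplus_{\ell=0}^n\mathcal H_\ell$. For an integer $m\ge2$ put $$k_m(x,\alpha)=\Bigl(\sin\tfrac{\omega(\alpha^{-1}x)}{2}\Bigr)^{2m-3},\qquad \mathcal L_m=\frac{\pi(-4)^{m-1}}{(2m-2)!}\prod_{j=0}^{m-1}\bigl(\Delta-(j^2-\tfrac14)\bigr).$$ *Norms.* Fix a finite smooth partition of unity $(\psi_j)_{j=1}^N$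 on $SO(3)$ and charts (smooth diffeomorphisms) $h_j:\Omega_j\to\mathcal O_j$, with $\Omega_j\subset SO(3)$ open and containing $\operatorname{supp}\psi_j$, and $\mathcal O_j\subset\mathbb R^3$ open. For $1\le p<\infty$, $W_p^k(SO(3))$ consists of the $f\in L_p(SO(3))$ (complex valued) such that every $(\psi_jf)\circ h_j^{-1}$ has weak derivatives up to order $k$ in $L_p(\mathcal O_j)$, with $$\|f\|_{W_p^k}^p=\sum_{j=1}^N\sum_{|\beta|\le k}\int_{\mathcal O_j}\bigl|D^\beta\bigl((\psi_jf)\circ h_j^{-1}\bigr)\bigr|^p\,dx,$$ and for $f\in C^k(SO(3))$ let $\|f\|_{C^k}=\max_j\max_{|\beta|\le k}\sup_{\mathcal O_j}|D^\beta((\psi_jf)\circ h_j^{-1})|$. *Coefficient kernels.* Let $\Xi\subset SO(3)$ be finite. A map $a:\Xi\times SO(3)\to\mathbb R$, measurable in the second variable, satisfies the coefficient kernel conditions (CKCs) with radius $\rho\in\mathbb R$, precision $L\in\mathbb N$ and stability constant $K\ge1$ if 1. $a(\xi,\alpha)=0$ whenever $\mathrm{dist}(\alpha,\xi)>\rho$;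 2. $\sum_{\xi\in\Xi}a(\xi,\alpha)p(\xi)=p(\alpha)$ for all $p\in\Pi_L$ and $\alpha\in SO(3)$; 3. $\sum_{\xi\in\Xi}|a(\xi,\alpha)|\le K$ for all $\alpha\in SO(3)$. **Theorem 5.1.** Let $m\ge2$, $L\ge2m$ and $K\geq 1$. There is a constant $C>0$, depending only on $m$, $L$, $K$ and the chosen $(\psi_j,h_j)_j$, such that for every finite $\Xi\subset SO(3)$ and every $a$ satisfying the CKCs with some radius $\rho$, precision $L$ and stability constant $K$ the following hold. * For every $1\le p<\infty$ and $f\in W_p^{2m}(SO(3))$, the distribution $\mathcal L_mf$ is a function in $L_p(SO(3))$, and the approximant $$T_\Xi f=\sum_{\xi\in\Xi}A_\xi\,k_m(\cdot,\xi),\qquad A_\xi=\int_{SO(3)}\mathcal L_mf(\alpha)\,a(\xi,\alpha)\,d\mu(\alpha),$$ satisfies $\|f-T_\Xi f\|_p\le C\rho^{2m}\|f\|_{W_p^{2m}}$. * For every $f\in C^{2m}(SO(3))$, the distribution $\mathcal L_mf$ is given by the classical derivative, and $\|f-T_\Xi f\|_\infty\le C\rho^{2m}\|f\|_{C^{2m}}$,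 with $T_\Xi f$ as above. -/

import Mathlib

open MeasureTheory Set
open scoped ENNReal ContDiff Matrix Topology

noncomputable section

namespace RotationGroup

/-! ## The group, its topology and the normalized Haar measure -/

/-- The group of proper rotations of `ℝ³`, as a group of matrices. -/
abbrev SO3 : Type := Matrix.specialOrthogonalGroup (Fin 3) ℝ

theorem mem_SO3_iff {A : Matrix (Fin 3) (Fin 3) ℝ} :
    A ∈ Matrix.specialOrthogonalGroup (Fin 3) ℝ ↔ A * Aᵀ = 1 ∧ A.det = 1 := by
  rw [Matrix.mem_specialOrthogonalGroup_iff, Matrix.mem_orthogonalGroup_iff]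

/-- The nine entries of a rotation: the embedding of `SO(3)` in `ℝ^{3×3}`. -/
def entries (x : SO3) : Fin 3 → Fin 3 → ℝ := fun i j => (x : Matrix (Fin 3) (Fin 3) ℝ) i j

theorem continuous_transpose_SO3 : Continuous (fun x : SO3 => x⁻¹) := by
  refine Continuous.subtype_mk ?_ _
  change Continuous (fun x : SO3 => (x : Matrix (Fin 3) (Fin 3) ℝ)ᵀ)
  exact continuous_subtype_val.matrix_transpose

instance instIsTopologicalGroupSO3 : IsTopologicalGroup SO3 where
  continuous_inv := continuous_transpose_SO3

theorem isCompact_SO3 :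
    IsCompact {A : Matrix (Fin 3) (Fin 3) ℝ | A ∈ Matrix.specialOrthogonalGroup (Fin 3) ℝ} := by
  have hclosed : IsClosed
      {A : Matrix (Fin 3) (Fin 3) ℝ | A ∈ Matrix.specialOrthogonalGroup (Fin 3) ℝ} := by
    have h : {A : Matrix (Fin 3) (Fin 3) ℝ | A ∈ Matrix.specialOrthogonalGroup (Fin 3) ℝ}
        = {A | A * Aᵀ = 1} ∩ {A | A.det = 1} := by
      ext A; exact mem_SO3_iff
    rw [h]
    exact (isClosed_eq (continuous_id.matrix_mul continuous_id.matrix_transpose)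
      continuous_const).inter (isClosed_eq continuous_id.matrix_det continuous_const)
  have hbox : IsCompact (Set.pi univ fun _ : Fin 3 => Set.pi univ fun _ : Fin 3 =>
      Icc (-1 : ℝ) 1) :=
    isCompact_univ_pi fun _ => isCompact_univ_pi fun _ => isCompact_Icc
  refine IsCompact.of_isClosed_subset hbox hclosed ?_
  intro A hA i _ j _
  have h1 : (A * Aᵀ) i i = 1 := by rw [(mem_SO3_iff.mp hA).1]; simp
  rw [Matrix.mul_apply] at h1
  have h2 : A i j * A i j ≤ ∑ k, A i k * Aᵀ k i :=
    Finset.single_le_sum (f := fun k => A i k * Aᵀ k i)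
      (fun k _ => mul_self_nonneg (A i k)) (Finset.mem_univ j)
  constructor <;> nlinarith

instance instCompactSpaceSO3 : CompactSpace SO3 := isCompact_iff_compactSpace.mp isCompact_SO3

instance instMeasurableSpaceSO3 : MeasurableSpace SO3 := borel SO3

instance instBorelSpaceSO3 : BorelSpace SO3 := ⟨rfl⟩

/-- The Haar measure of `SO(3)`, normalized to total mass one. -/
def haar : Measure SO3 := Measure.haarMeasure ⊤

/-- The rotation angle `ω(x) ∈ [0, π]`, given by `tr x = 1 + 2 cos ω(x)`. -/
def angle (x : SO3) : ℝ := Real.arccos (((x : Matrix (Fin 3) (Fin 3) ℝ).trace - 1) / 2)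

/-- The translation invariant metric `dist(x, y) = ω(y⁻¹ x)`. -/
def rotDist (x y : SO3) : ℝ := angle (y⁻¹ * x)

/-! ## Smooth functions and the Laplace–Beltrami operator -/

/-- `C^n` functions on the closed submanifold `SO(3) ⊆ ℝ^{3×3}`: the restrictions of `C^n`
functions on the ambient space. Here `n` is a natural number or `⊤ : ℕ∞`, which stands for `C^∞`. -/
def IsCk {V : Type*} [NormedAddCommGroup V] [NormedSpace ℝ V] (n : ℕ∞) (f : SO3 → V) : Prop :=
  ∃ F : (Fin 3 → Fin 3 → ℝ) → V, ContDiff ℝ n F ∧ ∀ x, f x = F (entries x)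

/-- The matrix of the rotation by the angle `t` about the `i`-th coordinate axis. -/
def axisMatrix : Fin 3 → ℝ → Matrix (Fin 3) (Fin 3) ℝ
  | 0, t => !![1, 0, 0; 0, Real.cos t, -Real.sin t; 0, Real.sin t, Real.cos t]
  | 1, t => !![Real.cos t, 0, Real.sin t; 0, 1, 0; -Real.sin t, 0, Real.cos t]
  | 2, t => !![Real.cos t, -Real.sin t, 0; Real.sin t, Real.cos t, 0; 0, 0, 1]

theorem axisMatrix_mem (i : Fin 3) (t : ℝ) :
    axisMatrix i t ∈ Matrix.specialOrthogonalGroup (Fin 3) ℝ := by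
  have h := Real.sin_sq_add_cos_sq t
  rw [mem_SO3_iff]
  constructor
  · ext a b
    fin_cases i <;> fin_cases a <;> fin_cases b <;>
      simp [axisMatrix, Matrix.mul_apply, Fin.sum_univ_three] <;> nlinarith
  · fin_cases i <;> simp [axisMatrix, Matrix.det_fin_three] <;> nlinarith

/-- The rotation by the angle `t` about the `i`-th coordinate axis. -/
def axisRot (i : Fin 3) (t : ℝ) : SO3 := ⟨axisMatrix i t, axisMatrix_mem i t⟩

/-- The left-invariant unit vector field `X_i`, `(X_i f)(x) = d/dt f(x R_i(t))` at `t = 0`.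
The fields `X_0, X_1, X_2` are an orthonormal frame for the bi-invariant Riemannian metric
whose geodesic distance is `rotDist`. -/
def lieDeriv (i : Fin 3) (f : SO3 → ℂ) : SO3 → ℂ :=
  fun x => deriv (fun t : ℝ => f (x * axisRot i t)) 0

/-- The Laplace–Beltrami operator of this metric, with the sign for which it is nonnegative:
`Δ = -(X_0² + X_1² + X_2²)`, with eigenvalues `ℓ(ℓ+1)`. -/
def laplacian (f : SO3 → ℂ) : SO3 → ℂ :=
  fun x => -∑ i : Fin 3, lieDeriv i (lieDeriv i f) x

/-- `shiftedProd n = ∏_{j < n} (Δ - r_j)` with `r_j = j² - 1/4`. -/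
def shiftedProd : ℕ → (SO3 → ℂ) → SO3 → ℂ
  | 0, f => f
  | n + 1, f => fun x =>
      laplacian (shiftedProd n f) x - (((n : ℝ) ^ 2 - 1 / 4 : ℝ) : ℂ) * shiftedProd n f x

/-- The operator `L_m = π (-4)^{m-1} / (2m-2)! · ∏_{j=0}^{m-1} (Δ - r_j)` on functions of
class `C^{2m}`. -/
def diffOp (m : ℕ) (f : SO3 → ℂ) : SO3 → ℂ :=
  fun x => ((Real.pi * (-4) ^ (m - 1) / (Nat.factorial (2 * m - 2) : ℝ) : ℝ) : ℂ) *
    shiftedProd m f x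

/-- `g = L_m f` in the sense of distributions; `L_m` is formally self-adjoint for `haar`. -/
def IsWeakDiffOp (m : ℕ) (f g : SO3 → ℂ) : Prop :=
  ∀ φ : SO3 → ℂ, IsCk ⊤ φ → ∫ x, f x * diffOp m φ x ∂haar = ∫ x, g x * φ x ∂haar

open Classical in
/-- The integrable function `L_m f` (distributional sense; unique almost everywhere), and `0`
if there is none. -/
def weakDiffOp (m : ℕ) (f : SO3 → ℂ) : SO3 → ℂ :=
  if h : ∃ g, Integrable g haar ∧ IsWeakDiffOp m f g then h.choose else 0

/-- `Π_n = H_0 ⊕ ⋯ ⊕ H_n`, where `H_ℓ` is the eigenspace of the Laplace–Beltrami operator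
on smooth functions for the eigenvalue `ℓ(ℓ+1)`. -/
def polySpace (n : ℕ) : Submodule ℂ (SO3 → ℂ) :=
  Submodule.span ℂ {p | ∃ ℓ : ℕ, ℓ ≤ n ∧ IsCk ⊤ p ∧
    ∀ x, laplacian p x = (ℓ : ℂ) * ((ℓ : ℂ) + 1) * p x}

/-! ## Sobolev and `C^k` norms -/

/-- Three-dimensional Euclidean space. -/
abbrev E3 : Type := EuclideanSpace ℝ (Fin 3)

/-- The `i`-th partial derivative. -/
def pd (i : Fin 3) (u : E3 → ℂ) : E3 → ℂ := fun y => fderiv ℝ u y (EuclideanSpace.single i 1)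

/-- The classical derivative `D^β`. -/
def multiDeriv (β : Fin 3 → ℕ) (u : E3 → ℂ) : E3 → ℂ :=
  (pd 0)^[β 0] ((pd 1)^[β 1] ((pd 2)^[β 2] u))

/-- The multi-indices `β` with `|β| ≤ k`. -/
def multiIndices (k : ℕ) : Finset (Fin 3 → ℕ) :=
  (Fintype.piFinset fun _ => Finset.range (k + 1)).filter fun β => ∑ i, β i ≤ k

/-- `v = D^β u` on the open set `O` in the weak sense. -/
def IsWeakDeriv (O : Set E3) (β : Fin 3 → ℕ) (u v : E3 → ℂ) : Prop :=
  ∀ φ : E3 → ℂ, ContDiff ℝ ∞ φ → HasCompactSupport φ → tsupport φ ⊆ O →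
    ∫ y in O, u y * multiDeriv β φ y = (-1) ^ (∑ i, β i) * ∫ y in O, v y * φ y

open Classical in
/-- The weak derivative `D^β u` on `O` (unique almost everywhere), and `0` if there is none. -/
def weakDeriv (O : Set E3) (β : Fin 3 → ℕ) (u : E3 → ℂ) : E3 → ℂ :=
  if h : ∃ v, LocallyIntegrableOn v O ∧ IsWeakDeriv O β u v then h.choose else 0

/-- `u ∈ W_p^k(O)`. -/
def MemEuclSobolev (O : Set E3) (k : ℕ) (p : ℝ≥0∞) (u : E3 → ℂ) : Prop :=
  MemLp u p (volume.restrict O) ∧ ∀ β ∈ multiIndices k,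
    ∃ v, MemLp v p (volume.restrict O) ∧ IsWeakDeriv O β u v

/-- `‖u‖^p` for the norm of `W_p^k(O)`: the sum over `|β| ≤ k` of `∫_O |D^β u|^p`. -/
def euclSobolevPow (O : Set E3) (k : ℕ) (p : ℝ≥0∞) (u : E3 → ℂ) : ℝ≥0∞ :=
  ∑ β ∈ multiIndices k, eLpNorm (weakDeriv O β u) p (volume.restrict O) ^ p.toReal

/-- A finite smooth partition of unity `ψ_j` on `SO(3)` with charts `h_j : Ω_j → O_j ⊆ ℝ³`
(smooth diffeomorphisms between open sets) such that `Ω_j` contains the closure of the support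
of `ψ_j`. The sets are `Ω_j = (h j).source` and `O_j = (h j).target`. -/
structure ChartedPartition where
  N : ℕ
  ψ : Fin N → SO3 → ℝ
  h : Fin N → OpenPartialHomeomorph SO3 E3
  ψ_smooth : ∀ j, IsCk ⊤ (ψ j)
  ψ_nonneg : ∀ j x, 0 ≤ ψ j x
  ψ_sum : ∀ x, ∑ j, ψ j x = 1
  ψ_supp : ∀ j, tsupport (ψ j) ⊆ (h j).source
  h_smooth : ∀ j, ∃ (U : Set (Fin 3 → Fin 3 → ℝ)) (F : (Fin 3 → Fin 3 → ℝ) → E3),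
    IsOpen U ∧ ContDiffOn ℝ ∞ F U ∧ ∀ x ∈ (h j).source, entries x ∈ U ∧ F (entries x) = h j x
  symm_smooth : ∀ j, ContDiffOn ℝ ∞ (fun y => entries ((h j).symm y)) (h j).target

/-- The localized function `(ψ_j f) ∘ h_j⁻¹` on `O_j`. -/
def ChartedPartition.loc (P : ChartedPartition) (j : Fin P.N) (f : SO3 → ℂ) : E3 → ℂ :=
  fun y => (P.ψ j ((P.h j).symm y) : ℂ) * f ((P.h j).symm y)

/-- `f ∈ W_p^k(SO(3))`. -/
def MemSobolev (P : ChartedPartition) (k : ℕ) (p : ℝ≥0∞) (f : SO3 → ℂ) : Prop :=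
  MemLp f p haar ∧ ∀ j, MemEuclSobolev (P.h j).target k p (P.loc j f)

/-- The norm of `W_p^k(SO(3))`, `1 ≤ p < ∞`. -/
def sobolevNorm (P : ChartedPartition) (k : ℕ) (p : ℝ≥0∞) (f : SO3 → ℂ) : ℝ≥0∞ :=
  (∑ j, euclSobolevPow (P.h j).target k p (P.loc j f)) ^ (1 / p.toReal)

/-- The norm of `C^k(SO(3))`: the largest supremum over `O_j` of a derivative of order at most
`k` of a localized function. -/
def ckNorm (P : ChartedPartition) (k : ℕ) (f : SO3 → ℂ) : ℝ≥0∞ :=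
  ⨆ j, ⨆ β ∈ multiIndices k, ⨆ y ∈ (P.h j).target, ‖multiDeriv β (P.loc j f) y‖ₑ

/-! ## Coefficient kernels and the approximation scheme -/

/-- The surface spline `k_m(x, α) = (sin (ω(α⁻¹ x) / 2))^{2m-3}`, for `m ≥ 2`. -/
def surfaceSpline (m : ℕ) (x α : SO3) : ℝ := Real.sin (rotDist x α / 2) ^ (2 * m - 3)

/-- The coefficient kernel conditions with radius `ρ`, precision `L`, stability constant `K`. -/
structure IsCoeffKernel (Ξ : Finset SO3) (a : Ξ → SO3 → ℝ) (ρ : ℝ) (L : ℕ) (K : ℝ) : Prop where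
  measurable : ∀ ξ, Measurable (a ξ)
  support : ∀ (ξ : Ξ) (α : SO3), ρ < rotDist α ξ → a ξ α = 0
  precision : ∀ p ∈ polySpace L, ∀ α, ∑ ξ : Ξ, (a ξ α : ℂ) * p ξ = p α
  one_le : 1 ≤ K
  stability : ∀ α, ∑ ξ : Ξ, |a ξ α| ≤ K

/-- The approximant `T_Ξ f = ∑_ξ A_ξ k_m(·, ξ)` with `A_ξ = ∫ L_m f(α) a(ξ, α) dμ(α)`. -/
def approximant (m : ℕ) (Ξ : Finset SO3) (a : Ξ → SO3 → ℝ) (f : SO3 → ℂ) : SO3 → ℂ :=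
  fun x => ∑ ξ : Ξ, (∫ α, weakDiffOp m f α * (a ξ α : ℂ) ∂haar) * (surfaceSpline m x ξ : ℂ)

end RotationGroup

end

open RotationGroup

namespace RotationGroup

/-! Write s = sin²(ω/2), so that k_m(x, α) = s(α⁻¹x)^{m-3/2}. Everything rests on the representation
f(x) = ∫ L_m f(α) k_m(x, α) dμ(α): the spline is a fundamental solution of L_m. On functions of s
the operator Δ is an ordinary differential operator, and Δ s^a = a(a+1) s^a - a(a+1/2) s^{a-1}. For
a = j - 1/2 the number a(a+1) is j² - 1/4, so each factor of L_m with j ≥ 1 lowers the exponent by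
one, until (Δ + 1/4) s^{-1/2} = π⁻¹ δ is reached (`laplacian_comp_sinSq`,
`integral_laplacian_sub_mul_rpow`, `integral_laplacian_add_mul_rpow`,
`integral_diffOp_mul_surfaceSpline`). The singular powers are limits of (s + ε)^a as ε → 0.

Hence f - T_Ξ f = ∫ L_m f(α) E(x, α) dμ(α) with E(x, α) = k_m(x, α) - Σ a(ξ, α) k_m(x, ξ), and the
size of E decides (`abs_errorKernel_le`). Let d² = s(α⁻¹x). If d is at most comparable with ρ, every
spline value involved is O(ρ^{2m-3}). If d is large against ρ, k_m(x, ·) is expanded around α in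
powers of s(x⁻¹ ·)/d² - 1; the Taylor polynomial of degree 2m ≤ L is reproduced by the coefficient
kernel, and a remainder of order d^{2m-3} (ρ/d)^{2m+1} is left. In both cases |E| ≤ C ρ^{2m+1}
((ρ/2)² + d²)^{-2}. The integral of this bound is O(ρ^{2m}), because the angle ω = 2t has the
density (4/π) sin² t, and Young's inequality yields an error of C ρ^{2m} ‖L_m f‖ in L_p and in the
supremum norm (`exists_sub_approximant_le`).

It remains to bound L_m f by the norm of f. In a chart L_m is a differential operator of order 2m
with smooth coefficients (`ChartedPartition.exists_chart_diffOp`), and on compact sets the Haar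
measure is dominated by the Lebesgue measure of the chart (`ChartedPartition.exists_map_le`). For
Sobolev functions the localized pieces are mollified, which exhibits L_m f as an L_1 limit of
classical expressions (`IsStrongDiffOp`); in this form both the representation formula and the
identity with the distributional L_m f pass to the limit. -/

/-! ### The half-angle function and the chordal metric -/

/-- `(sin (ω(x) / 2))²`, an affine function of the entries of `x`. -/
noncomputable def sinSq (x : SO3) : ℝ := (3 - (x : Matrix (Fin 3) (Fin 3) ℝ).trace) / 4

theorem entries_apply (x : SO3) (i j : Fin 3) :
    entries x i j = (x : Matrix (Fin 3) (Fin 3) ℝ) i j := rfl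

theorem continuous_entries : Continuous entries := continuous_subtype_val

theorem isEmbedding_entries : Topology.IsEmbedding entries := Topology.IsEmbedding.subtypeVal

theorem injective_entries : Function.Injective entries := Subtype.val_injective

instance : SecondCountableTopology SO3 := isEmbedding_entries.secondCountableTopology

theorem coe_inv_SO3 (x : SO3) :
    ((x⁻¹ : SO3) : Matrix (Fin 3) (Fin 3) ℝ) = (x : Matrix (Fin 3) (Fin 3) ℝ)ᵀ := rfl

theorem continuous_sinSq : Continuous sinSq := by
  unfold sinSq
  exact ((continuous_const.sub (continuous_subtype_val.matrix_trace)).div_const _)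

theorem sinSq_inv (x : SO3) : sinSq x⁻¹ = sinSq x := by
  simp [sinSq, coe_inv_SO3]

theorem sinSq_one : sinSq 1 = 0 := by
  simp [sinSq]

theorem mul_transpose_SO3 (x : SO3) :
    (x : Matrix (Fin 3) (Fin 3) ℝ) * (x : Matrix (Fin 3) (Fin 3) ℝ)ᵀ = 1 :=
  (mem_SO3_iff.mp x.2).1

theorem transpose_mul_SO3 (x : SO3) :
    (x : Matrix (Fin 3) (Fin 3) ℝ)ᵀ * (x : Matrix (Fin 3) (Fin 3) ℝ) = 1 :=
  mul_eq_one_comm.mp (mul_transpose_SO3 x)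

theorem sum_sq_entries (x : SO3) : ∑ i, ∑ j, entries x i j ^ 2 = 3 := by
  have h := congrArg Matrix.trace (mul_transpose_SO3 x)
  simp only [Matrix.trace, Matrix.diag, Matrix.mul_apply, Matrix.transpose_apply] at h
  simp only [entries_apply, sq]
  rw [h]
  simp

/-- The Frobenius norm of a rotation is √3, so |x - y|² = 6 - 2 tr(yᵀx). This makes the sine of the
half angle a Euclidean distance up to a factor. -/
theorem sinSq_inv_mul (x y : SO3) :
    8 * sinSq (y⁻¹ * x) = ∑ i, ∑ j, (entries x i j - entries y i j) ^ 2 := by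
  have hx := sum_sq_entries x
  have hy := sum_sq_entries y
  simp only [sinSq, Submonoid.coe_mul, coe_inv_SO3, Matrix.trace, Matrix.diag, Matrix.mul_apply,
    Matrix.transpose_apply, Fin.sum_univ_three, entries_apply] at *
  linarith

theorem sinSq_nonneg (x : SO3) : 0 ≤ sinSq x := by
  have h := sinSq_inv_mul x 1
  rw [inv_one, one_mul] at h
  have : 0 ≤ ∑ i, ∑ j, (entries x i j - entries 1 i j) ^ 2 := by positivity
  linarith

/-- The squared length of the skew part in terms of the trace. -/
theorem skew_sq (x : SO3) :
    (entries x 2 1 - entries x 1 2) ^ 2 + (entries x 0 2 - entries x 2 0) ^ 2 +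
      (entries x 1 0 - entries x 0 1) ^ 2 = 16 * (sinSq x * (1 - sinSq x)) := by
  have hx := sum_sq_entries x
  -- A rotation is its own cofactor matrix, so the sum of its principal 2×2 minors equals its trace;
  -- this determines the mixed products x_ij x_ji.
  have hadj : (x : Matrix (Fin 3) (Fin 3) ℝ).adjugate = (x : Matrix (Fin 3) (Fin 3) ℝ)ᵀ := by
    have h1 := Matrix.mul_adjugate (x : Matrix (Fin 3) (Fin 3) ℝ)
    rw [(mem_SO3_iff.mp x.2).2, one_smul] at h1
    calc _ = ((x : Matrix (Fin 3) (Fin 3) ℝ)ᵀ * x) * (x : Matrix (Fin 3) (Fin 3) ℝ).adjugate := by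
          rw [transpose_mul_SO3, one_mul]
      _ = _ := by rw [mul_assoc, h1, mul_one]
  have ht := congrArg Matrix.trace hadj
  rw [Matrix.adjugate_fin_three] at ht
  simp [Matrix.trace, Fin.sum_univ_three] at ht
  simp only [sinSq, Matrix.trace, Matrix.diag, Fin.sum_univ_three, entries_apply] at *
  nlinarith

/-- By `skew_sq`, 16 s(1 - s) is a sum of squares, which a value s > 1 would make negative. -/
theorem sinSq_le_one (x : SO3) : sinSq x ≤ 1 := by
  have h := skew_sq x
  have h0 := sinSq_nonneg x
  nlinarith [sq_nonneg (entries x 2 1 - entries x 1 2), sq_nonneg (entries x 0 2 - entries x 2 0),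
    sq_nonneg (entries x 1 0 - entries x 0 1)]

theorem sinSq_eq_zero_iff {x : SO3} : sinSq x = 0 ↔ x = 1 := by
  refine ⟨fun h => ?_, fun h => h ▸ sinSq_one⟩
  have h1 := sinSq_inv_mul x 1
  rw [inv_one, one_mul, h, mul_zero] at h1
  apply injective_entries
  ext i j
  have h2 : ∀ i ∈ Finset.univ, ∑ j, (entries x i j - entries 1 i j) ^ 2 = 0 :=
    (Finset.sum_eq_zero_iff_of_nonneg (fun i _ => by positivity)).mp h1.symm
  have h3 := (Finset.sum_eq_zero_iff_of_nonneg (fun i _ => by positivity)).mp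
    (h2 i (Finset.mem_univ i)) j (Finset.mem_univ j)
  exact sub_eq_zero.mp (pow_eq_zero_iff (two_ne_zero) |>.mp h3)

theorem angle_nonneg (x : SO3) : 0 ≤ angle x := Real.arccos_nonneg _

theorem angle_le_pi (x : SO3) : angle x ≤ Real.pi := Real.arccos_le_pi _

theorem sin_half_angle (x : SO3) : Real.sin (angle x / 2) = √(sinSq x) := by
  have h0 := sinSq_nonneg x
  have h1 := sinSq_le_one x
  have hs : 0 ≤ Real.sin (angle x / 2) :=
    Real.sin_nonneg_of_nonneg_of_le_pi (by linarith [angle_nonneg x])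
      (by linarith [angle_le_pi x, Real.pi_pos])
  rw [eq_comm, Real.sqrt_eq_iff_mul_self_eq h0 hs]
  have hc : Real.cos (angle x) = 1 - 2 * sinSq x := by
    unfold angle
    rw [Real.cos_arccos] <;> · unfold sinSq at *; linarith
  have h2 := Real.cos_sq (angle x / 2)
  have h3 := Real.sin_sq_add_cos_sq (angle x / 2)
  rw [mul_div_cancel₀ _ (two_ne_zero), hc] at h2
  nlinarith

theorem surfaceSpline_eq (m : ℕ) (x α : SO3) :
    surfaceSpline m x α = √(sinSq (α⁻¹ * x)) ^ (2 * m - 3) := by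
  rw [surfaceSpline, rotDist, sin_half_angle]

/-- Half the chordal distance of the rotations, `sin (ω(y⁻¹ x) / 2)`. -/
noncomputable def chord (x y : SO3) : ℝ := √(sinSq (y⁻¹ * x))

theorem chord_sq (x y : SO3) : chord x y ^ 2 = sinSq (y⁻¹ * x) :=
  Real.sq_sqrt (sinSq_nonneg _)

theorem chord_nonneg (x y : SO3) : 0 ≤ chord x y := Real.sqrt_nonneg _

theorem chord_comm (x y : SO3) : chord x y = chord y x := by
  rw [chord, chord, ← sinSq_inv (y⁻¹ * x), mul_inv_rev, inv_inv]

theorem chord_eq_norm (x y : SO3) :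
    chord x y = ‖WithLp.toLp 2 (fun p : Fin 3 × Fin 3 => entries x p.1 p.2) -
      WithLp.toLp 2 (fun p : Fin 3 × Fin 3 => entries y p.1 p.2)‖ / √8 := by
  rw [chord, EuclideanSpace.norm_eq, ← Real.sqrt_div' _ (by norm_num)]
  congr 1
  rw [Fintype.sum_prod_type]
  simp only [PiLp.sub_apply, Real.norm_eq_abs, sq_abs]
  rw [← sinSq_inv_mul]
  ring

/-- Inherited from the Euclidean space of matrices. The kernel estimates use this metric, so no
triangle inequality for the rotation angle is needed. -/
theorem chord_triangle (x y z : SO3) : chord x z ≤ chord x y + chord y z := by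
  simp only [chord_eq_norm, ← add_div]
  gcongr
  exact norm_sub_le_norm_sub_add_norm_sub _ _ _

theorem chord_le_half_rotDist (x y : SO3) : chord x y ≤ rotDist x y / 2 := by
  rw [chord, ← sin_half_angle]
  exact Real.sin_le (by linarith [angle_nonneg (y⁻¹ * x)])

instance : IsProbabilityMeasure haar := by
  refine ⟨?_⟩
  have := Measure.haarMeasure_self (K₀ := (⊤ : TopologicalSpace.PositiveCompacts SO3))
  simpa [haar] using this

instance : haar.IsHaarMeasure := by unfold haar; infer_instance

/-- A compact group is unimodular: a right translate of the Haar measure is again a Haar probability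
measure, hence the same one. -/
instance : haar.IsMulRightInvariant := by
  refine ⟨fun g => ?_⟩
  have : IsProbabilityMeasure (Measure.map (· * g) haar) :=
    Measure.isProbabilityMeasure_map (measurable_mul_const g).aemeasurable
  exact Measure.isHaarMeasure_eq_of_isProbabilityMeasure _ _

/-! ### Local regularity through the ambient matrix space -/

/-- The ambient space `ℝ^{3×3}` with the supremum norm. -/
abbrev Mat9 : Type := Fin 3 → Fin 3 → ℝ

/-- `f` coincides near `x` with the restriction of an ambient function of class `C^n`. -/
def CkAt (n : ℕ) (f : SO3 → ℂ) (x : SO3) : Prop :=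
  ∃ F : Mat9 → ℂ, ContDiffAt ℝ n F (entries x) ∧ ∀ᶠ y in 𝓝 x, f y = F (entries y)

theorem IsCk.ckAt {k : ℕ∞} {n : ℕ} {f : SO3 → ℂ} (h : IsCk k f) (hn : (n : ℕ∞) ≤ k) (x : SO3) :
    CkAt n f x := by
  obtain ⟨F, hF, hf⟩ := h
  exact ⟨F, (hF.of_le (by exact_mod_cast hn)).contDiffAt, Filter.Eventually.of_forall hf⟩

theorem CkAt.mono {n k : ℕ} {f : SO3 → ℂ} {x : SO3} (h : CkAt n f x) (hk : k ≤ n) :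
    CkAt k f x := by
  obtain ⟨F, hF, hf⟩ := h
  exact ⟨F, hF.of_le (by exact_mod_cast hk), hf⟩

theorem CkAt.congr {n : ℕ} {f g : SO3 → ℂ} {x : SO3} (h : CkAt n f x) (hg : g =ᶠ[𝓝 x] f) :
    CkAt n g x := by
  obtain ⟨F, hF, hf⟩ := h
  exact ⟨F, hF, hg.trans hf⟩

theorem CkAt.eventually {n : ℕ} {f : SO3 → ℂ} {x : SO3} (h : CkAt n f x) :
    ∀ᶠ y in 𝓝 x, CkAt n f y := by
  obtain ⟨F, hF, hf⟩ := h
  filter_upwards [continuous_entries.continuousAt.eventually (hF.eventually (by simp)),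
    hf.eventually_nhds] with y h1 h2
  exact ⟨F, h1, h2⟩

theorem CkAt.continuousAt {n : ℕ} {f : SO3 → ℂ} {x : SO3} (h : CkAt n f x) :
    ContinuousAt f x := by
  obtain ⟨F, hF, hf⟩ := h
  exact (ContinuousAt.comp hF.continuousAt continuous_entries.continuousAt).congr
    (hf.mono fun y hy => hy.symm)

theorem continuous_of_ckAt {n : ℕ} {f : SO3 → ℂ} (h : ∀ x, CkAt n f x) : Continuous f :=
  continuous_iff_continuousAt.mpr fun x => (h x).continuousAt

theorem CkAt.add {n : ℕ} {f g : SO3 → ℂ} {x : SO3} (hf : CkAt n f x) (hg : CkAt n g x) :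
    CkAt n (fun y => f y + g y) x := by
  obtain ⟨F, hF, hf⟩ := hf
  obtain ⟨G, hG, hg⟩ := hg
  exact ⟨fun M => F M + G M, hF.add hG, by
    filter_upwards [hf, hg] with y h1 h2; rw [h1, h2]⟩

theorem CkAt.mul {n : ℕ} {f g : SO3 → ℂ} {x : SO3} (hf : CkAt n f x) (hg : CkAt n g x) :
    CkAt n (fun y => f y * g y) x := by
  obtain ⟨F, hF, hf⟩ := hf
  obtain ⟨G, hG, hg⟩ := hg
  exact ⟨fun M => F M * G M, hF.mul hG, by
    filter_upwards [hf, hg] with y h1 h2; rw [h1, h2]⟩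

theorem CkAt.const (n : ℕ) (c : ℂ) (x : SO3) : CkAt n (fun _ => c) x :=
  ⟨fun _ => c, contDiffAt_const, Filter.Eventually.of_forall fun _ => rfl⟩

theorem CkAt.const_mul {n : ℕ} {f : SO3 → ℂ} {x : SO3} (c : ℂ) (hf : CkAt n f x) :
    CkAt n (fun y => c * f y) x := (CkAt.const n c x).mul hf

theorem CkAt.neg {n : ℕ} {f : SO3 → ℂ} {x : SO3} (hf : CkAt n f x) :
    CkAt n (fun y => -f y) x := by
  simpa using hf.const_mul (-1)

theorem CkAt.sub {n : ℕ} {f g : SO3 → ℂ} {x : SO3} (hf : CkAt n f x) (hg : CkAt n g x) :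
    CkAt n (fun y => f y - g y) x := by
  simpa [sub_eq_add_neg] using hf.add hg.neg

theorem CkAt.sum {ι : Type*} {n : ℕ} {f : ι → SO3 → ℂ} {x : SO3} (s : Finset ι)
    (hf : ∀ i ∈ s, CkAt n (f i) x) : CkAt n (fun y => ∑ i ∈ s, f i y) x := by
  classical
  induction s using Finset.induction_on with
  | empty => simpa using CkAt.const n 0 x
  | insert a s ha ih =>
    simp only [Finset.sum_insert ha]
    exact (hf a (Finset.mem_insert_self a s)).add
      (ih fun i hi => hf i (Finset.mem_insert_of_mem hi))

/-- Left multiplication by `z` on the ambient space. -/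
noncomputable def leftMulCLM (z : SO3) : Mat9 →L[ℝ] Mat9 :=
  LinearMap.toContinuousLinearMap
    { toFun := fun M a b => ∑ k, entries z a k * M k b
      map_add' := fun M N => by
        ext a b; simp [mul_add, Finset.sum_add_distrib]
      map_smul' := fun c M => by
        ext a b; simp [Finset.mul_sum, mul_left_comm] }

theorem entries_mul (z x : SO3) : entries (z * x) = leftMulCLM z (entries x) := by
  ext a b
  simp [leftMulCLM, entries_apply, Matrix.mul_apply]

theorem CkAt.comp_mul_left {n : ℕ} {f : SO3 → ℂ} {z x : SO3} (hf : CkAt n f (z * x)) :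
    CkAt n (fun y => f (z * y)) x := by
  obtain ⟨F, hF, hf⟩ := hf
  refine ⟨fun M => F (leftMulCLM z M), ?_, ?_⟩
  · rw [entries_mul] at hF
    exact hF.comp _ (leftMulCLM z).contDiff.contDiffAt
  · filter_upwards [(continuous_const_mul z).continuousAt.eventually hf] with y hy
    rw [hy, entries_mul]

/-! ### Invariant vector fields and the Laplacian -/

/-- The infinitesimal rotation about the `i`-th axis. -/
def gen : Fin 3 → Mat9
  | 0 => ![![0, 0, 0], ![0, 0, -1], ![0, 1, 0]]
  | 1 => ![![0, 0, 1], ![0, 0, 0], ![-1, 0, 0]]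
  | 2 => ![![0, -1, 0], ![1, 0, 0], ![0, 0, 0]]

/-- Right multiplication by the infinitesimal rotation about the `i`-th axis, the linear vector
field on the ambient space that restricts to `X_i`. -/
noncomputable def fieldCLM (i : Fin 3) : Mat9 →L[ℝ] Mat9 :=
  LinearMap.toContinuousLinearMap
    { toFun := fun M a b => ∑ k, M a k * gen i k b
      map_add' := fun M N => by
        ext a b; simp [add_mul, Finset.sum_add_distrib]
      map_smul' := fun c M => by
        ext a b; simp [Finset.mul_sum, mul_assoc] }

theorem fieldCLM_apply (i : Fin 3) (M : Mat9) (a b : Fin 3) :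
    fieldCLM i M a b = ∑ k, M a k * gen i k b := rfl

theorem axisRot_zero (i : Fin 3) : axisRot i 0 = 1 := by
  apply Subtype.ext
  ext a b
  fin_cases i <;> fin_cases a <;> fin_cases b <;> simp [axisRot, axisMatrix]

theorem axisRot_add (i : Fin 3) (s t : ℝ) : axisRot i (s + t) = axisRot i s * axisRot i t := by
  apply Subtype.ext
  ext a b
  fin_cases i <;> fin_cases a <;> fin_cases b <;>
    simp [axisRot, axisMatrix, Real.sin_add, Real.cos_add] <;> ring

theorem hasDerivAt_axisMatrix (i : Fin 3) (a b : Fin 3) :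
    HasDerivAt (fun t => axisMatrix i t a b) (gen i a b) 0 := by
  have hs : HasDerivAt Real.sin 1 0 := by simpa using Real.hasDerivAt_sin 0
  have hc : HasDerivAt Real.cos 0 0 := by simpa using Real.hasDerivAt_cos 0
  have hn : HasDerivAt (fun t => -Real.sin t) (-1) 0 := hs.neg
  fin_cases i <;> fin_cases a <;> fin_cases b <;>
    simp [axisMatrix, gen] <;> first | exact hasDerivAt_const _ _ | assumption

theorem hasDerivAt_entries_zero (x : SO3) (i : Fin 3) :
    HasDerivAt (fun t => entries (x * axisRot i t)) (fieldCLM i (entries x)) 0 := by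
  rw [hasDerivAt_pi]
  intro a
  rw [hasDerivAt_pi]
  intro b
  have : (fun t => entries (x * axisRot i t) a b) =
      fun t => ∑ k, entries x a k * axisMatrix i t k b := by
    ext t
    simp [entries_apply, Matrix.mul_apply, axisRot]
  rw [this, fieldCLM_apply]
  exact HasDerivAt.fun_sum fun k _ => (hasDerivAt_axisMatrix i k b).const_mul _

theorem continuous_axisRot (i : Fin 3) : Continuous (axisRot i) := by
  refine Continuous.subtype_mk ?_ _
  refine continuous_matrix fun a b => ?_
  fin_cases i <;> fin_cases a <;> fin_cases b <;> simp [axisMatrix] <;> fun_prop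

theorem tendsto_mul_axisRot (x : SO3) (i : Fin 3) :
    Filter.Tendsto (fun t => x * axisRot i t) (𝓝 0) (𝓝 x) := by
  have h : Continuous fun t => x * axisRot i t := continuous_const.mul (continuous_axisRot i)
  simpa [axisRot_zero] using h.tendsto 0

theorem lieDeriv_congr {f g : SO3 → ℂ} {x : SO3} (i : Fin 3) (h : f =ᶠ[𝓝 x] g) :
    lieDeriv i f x = lieDeriv i g x := by
  refine Filter.EventuallyEq.deriv_eq ?_
  have hc := tendsto_mul_axisRot x i
  exact hc.eventually h

theorem lieDeriv_eventuallyEq {f g : SO3 → ℂ} {x : SO3} (i : Fin 3) (h : f =ᶠ[𝓝 x] g) :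
    lieDeriv i f =ᶠ[𝓝 x] lieDeriv i g := by
  filter_upwards [h.eventually_nhds] with y hy using lieDeriv_congr i hy

theorem hasDerivAt_comp_entries {F : Mat9 → ℂ} {x : SO3} (i : Fin 3)
    (h : DifferentiableAt ℝ F (entries x)) :
    HasDerivAt (fun t => F (entries (x * axisRot i t)))
      (fderiv ℝ F (entries x) (fieldCLM i (entries x))) 0 := by
  have h0 : entries x = entries (x * axisRot i 0) := by rw [axisRot_zero, mul_one]
  have h1 : HasFDerivAt F (fderiv ℝ F (entries x)) (entries (x * axisRot i 0)) := by
    rw [← h0]; exact h.hasFDerivAt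
  exact h1.comp_hasDerivAt (0 : ℝ) (hasDerivAt_entries_zero x i)

theorem lieDeriv_comp_entries {F : Mat9 → ℂ} {x : SO3} (i : Fin 3)
    (h : DifferentiableAt ℝ F (entries x)) :
    lieDeriv i (fun y => F (entries y)) x = fderiv ℝ F (entries x) (fieldCLM i (entries x)) :=
  (hasDerivAt_comp_entries i h).deriv

theorem CkAt.hasDerivAt_zero {f : SO3 → ℂ} {x : SO3} (h : CkAt 1 f x) (i : Fin 3) :
    HasDerivAt (fun t => f (x * axisRot i t)) (lieDeriv i f x) 0 := by
  obtain ⟨F, hF, hf⟩ := h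
  have hd := hasDerivAt_comp_entries i (hF.differentiableAt (by simp))
  have hc := tendsto_mul_axisRot x i
  have h2 := hd.congr_of_eventuallyEq (hc.eventually hf)
  rw [lieDeriv, h2.deriv]
  exact h2

theorem CkAt.hasDerivAt {f : SO3 → ℂ} {x : SO3} {i : Fin 3} {t : ℝ}
    (h : CkAt 1 f (x * axisRot i t)) :
    HasDerivAt (fun t => f (x * axisRot i t)) (lieDeriv i f (x * axisRot i t)) t := by
  have h1 := h.hasDerivAt_zero i
  have h2 : HasDerivAt (fun r : ℝ => r - t) 1 t := (hasDerivAt_id t).sub_const t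
  have h3 := HasDerivAt.scomp t (g₁ := fun r => f (x * axisRot i t * axisRot i r))
    (h := fun r : ℝ => r - t) (by simpa using h1) h2
  simpa [Function.comp_def, mul_assoc, ← axisRot_add] using h3

/-- `X_i` is the restriction of a linear field M ↦ M E_i on the ambient space, so an extension of
`X_i f` is DF(M)(M E_i), which costs one derivative of F. -/
theorem CkAt.lieDeriv {n : ℕ} {f : SO3 → ℂ} {x : SO3} (h : CkAt (n + 1) f x) (i : Fin 3) :
    CkAt n (lieDeriv i f) x := by
  obtain ⟨F, hF, hf⟩ := h
  refine ⟨fun M => fderiv ℝ F M (fieldCLM i M), ?_, ?_⟩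
  · exact ContDiffAt.clm_apply (hF.fderiv_right (m := n) (by norm_cast))
      (fieldCLM i).contDiff.contDiffAt
  · filter_upwards [lieDeriv_eventuallyEq i hf,
      continuous_entries.continuousAt.eventually (hF.eventually (by simp))] with y h1 h2
    rw [h1, lieDeriv_comp_entries i (h2.differentiableAt (by simp))]

theorem lieDeriv_add {f g : SO3 → ℂ} {x : SO3} (i : Fin 3) (hf : CkAt 1 f x) (hg : CkAt 1 g x) :
    lieDeriv i (fun y => f y + g y) x = lieDeriv i f x + lieDeriv i g x :=
  ((hf.hasDerivAt_zero i).add (hg.hasDerivAt_zero i)).deriv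

theorem lieDeriv_mul {f g : SO3 → ℂ} {x : SO3} (i : Fin 3) (hf : CkAt 1 f x) (hg : CkAt 1 g x) :
    lieDeriv i (fun y => f y * g y) x = lieDeriv i f x * g x + f x * lieDeriv i g x := by
  have h := ((hf.hasDerivAt_zero i).mul (hg.hasDerivAt_zero i)).deriv
  rw [axisRot_zero, mul_one] at h
  exact h

theorem lieDeriv_const (i : Fin 3) (c : ℂ) (x : SO3) : lieDeriv i (fun _ => c) x = 0 := by
  simp [lieDeriv]

theorem lieDeriv_const_mul {f : SO3 → ℂ} {x : SO3} (i : Fin 3) (c : ℂ) :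
    lieDeriv i (fun y => c * f y) x = c * lieDeriv i f x := by
  simp [lieDeriv]

theorem lieDeriv_comp_mul_left (i : Fin 3) (f : SO3 → ℂ) (z x : SO3) :
    lieDeriv i (fun y => f (z * y)) x = lieDeriv i f (z * x) := by
  simp [lieDeriv, mul_assoc]

theorem laplacian_congr {f g : SO3 → ℂ} {x : SO3} (h : f =ᶠ[𝓝 x] g) :
    laplacian f x = laplacian g x := by
  simp only [laplacian]
  congr 1
  exact Finset.sum_congr rfl fun i _ => lieDeriv_congr i (lieDeriv_eventuallyEq i h)

theorem laplacian_eventuallyEq {f g : SO3 → ℂ} {x : SO3} (h : f =ᶠ[𝓝 x] g) :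
    laplacian f =ᶠ[𝓝 x] laplacian g := by
  filter_upwards [h.eventually_nhds] with y hy using laplacian_congr hy

theorem CkAt.laplacian {n : ℕ} {f : SO3 → ℂ} {x : SO3} (h : CkAt (n + 2) f x) :
    CkAt n (laplacian f) x :=
  (CkAt.sum _ fun i _ => (CkAt.lieDeriv h i).lieDeriv i).neg

theorem laplacian_add {f g : SO3 → ℂ} {x : SO3} (hf : CkAt 2 f x) (hg : CkAt 2 g x) :
    laplacian (fun y => f y + g y) x = laplacian f x + laplacian g x := by
  simp only [laplacian, ← neg_add, ← Finset.sum_add_distrib]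
  congr 1
  refine Finset.sum_congr rfl fun i _ => ?_
  rw [← lieDeriv_add i (CkAt.lieDeriv hf i) (CkAt.lieDeriv hg i)]
  refine lieDeriv_congr i ?_
  filter_upwards [hf.eventually, hg.eventually] with y h1 h2
  exact lieDeriv_add i (h1.mono one_le_two) (h2.mono one_le_two)

theorem laplacian_const_mul (f : SO3 → ℂ) (x : SO3) (c : ℂ) :
    laplacian (fun y => c * f y) x = c * laplacian f x := by
  have : ∀ i, lieDeriv i (fun y => c * f y) = fun y => c * lieDeriv i f y :=
    fun i => funext fun y => lieDeriv_const_mul i c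
  simp only [laplacian, this, lieDeriv_const_mul, ← Finset.mul_sum, mul_neg]

theorem laplacian_sum {ι : Type*} {f : ι → SO3 → ℂ} {x : SO3} (s : Finset ι)
    (hf : ∀ i ∈ s, CkAt 2 (f i) x) :
    laplacian (fun y => ∑ i ∈ s, f i y) x = ∑ i ∈ s, laplacian (f i) x := by
  classical
  induction s using Finset.induction_on with
  | empty => simpa using laplacian_const_mul (fun _ => 0) x 0
  | insert a s ha ih =>
    simp only [Finset.sum_insert ha]
    rw [laplacian_add (hf a (Finset.mem_insert_self a s))
      (CkAt.sum s fun i hi => hf i (Finset.mem_insert_of_mem hi)),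
      ih fun i hi => hf i (Finset.mem_insert_of_mem hi)]

theorem laplacian_comp_mul_left (f : SO3 → ℂ) (z x : SO3) :
    laplacian (fun y => f (z * y)) x = laplacian f (z * x) := by
  have : ∀ i, lieDeriv i (fun y => f (z * y)) = fun y => lieDeriv i f (z * y) :=
    fun i => funext fun y => lieDeriv_comp_mul_left i f z y
  simp only [laplacian, this, lieDeriv_comp_mul_left]

/-! ### The operator `∏ (Δ - r_j)` -/

theorem CkAt.shiftedProd {k : ℕ} {f : SO3 → ℂ} {x : SO3} (n : ℕ) (h : CkAt (k + 2 * n) f x) :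
    CkAt k (shiftedProd n f) x := by
  induction n generalizing k with
  | zero => exact h
  | succ n ih =>
    have h1 : CkAt (k + 2) (RotationGroup.shiftedProd n f) x := ih (h.mono (by omega))
    exact h1.laplacian.sub ((h1.mono (Nat.le_add_right k 2)).const_mul _)

theorem shiftedProd_eventuallyEq {f g : SO3 → ℂ} {x : SO3} (n : ℕ) (h : f =ᶠ[𝓝 x] g) :
    shiftedProd n f =ᶠ[𝓝 x] shiftedProd n g := by
  induction n with
  | zero => exact h
  | succ n ih =>
    filter_upwards [ih, laplacian_eventuallyEq ih] with y h1 h2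
    simp only [shiftedProd, h1, h2]

theorem shiftedProd_add {f g : SO3 → ℂ} {x : SO3} (n : ℕ) (hf : CkAt (2 * n) f x)
    (hg : CkAt (2 * n) g x) :
    shiftedProd n (fun y => f y + g y) x = shiftedProd n f x + shiftedProd n g x := by
  induction n generalizing x with
  | zero => rfl
  | succ n ih =>
    have hf' : CkAt 2 (shiftedProd n f) x := CkAt.shiftedProd n (hf.mono (by omega))
    have hg' : CkAt 2 (shiftedProd n g) x := CkAt.shiftedProd n (hg.mono (by omega))
    simp only [shiftedProd]
    rw [laplacian_congr (g := fun y => shiftedProd n f y + shiftedProd n g y),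
      laplacian_add hf' hg', ih (hf.mono (by omega)) (hg.mono (by omega))]
    · ring
    · filter_upwards [hf.eventually, hg.eventually] with y h1 h2
      exact ih (h1.mono (by omega)) (h2.mono (by omega))

theorem shiftedProd_const_mul (n : ℕ) (f : SO3 → ℂ) (x : SO3) (c : ℂ) :
    shiftedProd n (fun y => c * f y) x = c * shiftedProd n f x := by
  induction n generalizing x with
  | zero => rfl
  | succ n ih =>
    have : shiftedProd n (fun y => c * f y) = fun y => c * shiftedProd n f y := funext ih
    simp only [shiftedProd, this, laplacian_const_mul]
    ring

theorem shiftedProd_sum {ι : Type*} {f : ι → SO3 → ℂ} {x : SO3} (n : ℕ) (s : Finset ι)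
    (hf : ∀ i ∈ s, CkAt (2 * n) (f i) x) :
    shiftedProd n (fun y => ∑ i ∈ s, f i y) x = ∑ i ∈ s, shiftedProd n (f i) x := by
  classical
  induction s using Finset.induction_on with
  | empty => simpa using shiftedProd_const_mul n (fun _ => 0) x 0
  | insert a s ha ih =>
    simp only [Finset.sum_insert ha]
    rw [shiftedProd_add n (hf a (Finset.mem_insert_self a s))
      (CkAt.sum s fun i hi => hf i (Finset.mem_insert_of_mem hi)),
      ih fun i hi => hf i (Finset.mem_insert_of_mem hi)]

theorem shiftedProd_comp_mul_left (n : ℕ) (f : SO3 → ℂ) (z x : SO3) :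
    shiftedProd n (fun y => f (z * y)) x = shiftedProd n f (z * x) := by
  induction n generalizing x with
  | zero => rfl
  | succ n ih =>
    have : shiftedProd n (fun y => f (z * y)) = fun y => shiftedProd n f (z * y) := funext ih
    simp only [shiftedProd, this, laplacian_comp_mul_left]

/-- The factors of `∏ (Δ - r_j)` commute. -/
theorem shiftedProd_laplacian_sub {f : SO3 → ℂ} {x : SO3} (n : ℕ) (c : ℂ)
    (hf : CkAt (2 * n + 2) f x) :
    shiftedProd n (fun y => laplacian f y - c * f y) x =
      laplacian (shiftedProd n f) x - c * shiftedProd n f x := by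
  induction n generalizing x with
  | zero => rfl
  | succ n ih =>
    have h4 : CkAt 4 (shiftedProd n f) x := CkAt.shiftedProd n (hf.mono (by omega))
    have hd : CkAt 2 (laplacian (shiftedProd n f)) x := h4.laplacian
    have hs : CkAt 2 (shiftedProd n f) x := h4.mono (by omega)
    have hlin : ∀ {u v : SO3 → ℂ} (b : ℂ), CkAt 2 u x → CkAt 2 v x →
        laplacian (fun y => u y - b * v y) x = laplacian u x - b * laplacian v x := by
      intro u v b hu hv
      have h1 := laplacian_add hu (hv.const_mul (-b))
      rw [laplacian_const_mul] at h1
      calc _ = laplacian (fun y => u y + -b * v y) x := by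
            congr 1; ext y; ring
        _ = _ := by rw [h1]; ring
    simp only [shiftedProd]
    rw [laplacian_congr
      (g := fun y => laplacian (shiftedProd n f) y - c * shiftedProd n f y),
      hlin c hd hs, ih (hf.mono (by omega)),
      hlin _ hd hs]
    · ring
    · filter_upwards [hf.eventually] with y hy using ih (hy.mono (by omega))

/-! ### Integration by parts on the group -/

theorem integrable_of_continuous {E : Type*} [NormedAddCommGroup E] {f : SO3 → E}
    (hf : Continuous f) : Integrable f haar :=
  hf.integrable_of_hasCompactSupport (HasCompactSupport.of_compactSpace f)

/-- By right invariance, averaging X_i f along the flow x ↦ x R_i(t), 0 ≤ t ≤ 1, does not change its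
integral. The average along the flow is f(x R_i(1)) - f(x), whose integral is zero by invariance
again. -/
theorem integral_lieDeriv {f : SO3 → ℂ} (hf : ∀ x, CkAt 1 f x) (i : Fin 3) :
    ∫ x, lieDeriv i f x ∂haar = 0 := by
  have hc : Continuous (lieDeriv i f) := continuous_of_ckAt fun x => CkAt.lieDeriv (hf x) i
  have hcf : Continuous f := continuous_of_ckAt hf
  have hjoint : Continuous (fun p : SO3 × ℝ => lieDeriv i f (p.1 * axisRot i p.2)) :=
    hc.comp (continuous_fst.mul ((continuous_axisRot i).comp continuous_snd))
  have h1 : ∀ x, ∫ t in (0 : ℝ)..1, lieDeriv i f (x * axisRot i t) =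
      f (x * axisRot i 1) - f (x * axisRot i 0) := fun x =>
    intervalIntegral.integral_eq_sub_of_hasDerivAt (fun t _ => (hf _).hasDerivAt)
      ((hjoint.comp (Continuous.prodMk_right x)).intervalIntegrable 0 1)
  have hr : ∀ (g : SO3 → ℂ) (t : ℝ), ∫ x, g (x * axisRot i t) ∂haar = ∫ x, g x ∂haar :=
    fun g t => integral_mul_right_eq_self g (axisRot i t)
  have h2 : ∫ x, (∫ t in (0 : ℝ)..1, lieDeriv i f (x * axisRot i t)) ∂haar = 0 := by
    simp only [h1]
    rw [integral_sub, hr, hr, sub_self] <;>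
      exact integrable_of_continuous (hcf.comp (continuous_mul_const _))
  have hint : Integrable (Function.uncurry fun (x : SO3) (t : ℝ) => lieDeriv i f (x * axisRot i t))
      (haar.prod (volume.restrict (Ioc 0 1))) := by
    obtain ⟨C, hC⟩ := isCompact_univ.exists_bound_of_continuousOn hc.continuousOn
    have : IsFiniteMeasure (volume.restrict (Ioc (0 : ℝ) 1)) := ⟨by simp⟩
    exact Integrable.of_bound hjoint.aestronglyMeasurable C
      (Filter.Eventually.of_forall fun p => hC _ (mem_univ _))
  simp only [intervalIntegral.integral_of_le zero_le_one] at h2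
  rw [integral_integral_swap hint] at h2
  simpa [hr] using h2

theorem integral_lieDeriv_mul {f g : SO3 → ℂ} (hf : ∀ x, CkAt 1 f x) (hg : ∀ x, CkAt 1 g x)
    (i : Fin 3) :
    ∫ x, lieDeriv i f x * g x ∂haar = -∫ x, f x * lieDeriv i g x ∂haar := by
  have h := integral_lieDeriv (fun x => (hf x).mul (hg x)) i
  simp only [fun x => lieDeriv_mul i (hf x) (hg x)] at h
  rw [integral_add] at h
  · exact eq_neg_of_add_eq_zero_left h
  · exact integrable_of_continuous (continuous_of_ckAt fun x =>
      (CkAt.lieDeriv (n := 0) (hf x) i).mul ((hg x).mono zero_le_one))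
  · exact integrable_of_continuous (continuous_of_ckAt fun x =>
      ((hf x).mono zero_le_one).mul (CkAt.lieDeriv (n := 0) (hg x) i))

theorem integral_laplacian_mul {f g : SO3 → ℂ} (hf : ∀ x, CkAt 2 f x) (hg : ∀ x, CkAt 2 g x) :
    ∫ x, laplacian f x * g x ∂haar = ∫ x, f x * laplacian g x ∂haar := by
  have hf1 : ∀ x, CkAt 1 f x := fun x => (hf x).mono one_le_two
  have hg1 : ∀ x, CkAt 1 g x := fun x => (hg x).mono one_le_two
  have hl : ∀ i x, CkAt 1 (lieDeriv i f) x := fun i x => CkAt.lieDeriv (hf x) i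
  have hl' : ∀ i x, CkAt 1 (lieDeriv i g) x := fun i x => CkAt.lieDeriv (hg x) i
  simp only [laplacian, neg_mul, mul_neg, Finset.sum_mul, Finset.mul_sum, integral_neg]
  rw [integral_finsetSum, integral_finsetSum]
  · congr 1
    refine Finset.sum_congr rfl fun i _ => ?_
    rw [integral_lieDeriv_mul (hl i) hg1, integral_lieDeriv_mul hf1 (hl' i), neg_neg]
  · exact fun i _ => integrable_of_continuous (continuous_of_ckAt fun x =>
      ((hf x).mono zero_le_two).mul (CkAt.lieDeriv (n := 0) (hl' i x) i))
  · exact fun i _ => integrable_of_continuous (continuous_of_ckAt fun x =>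
      (CkAt.lieDeriv (n := 0) (hl i x) i).mul ((hg x).mono zero_le_two))

theorem integral_laplacian_sub_mul {f g : SO3 → ℂ} (hf : ∀ x, CkAt 2 f x) (hg : ∀ x, CkAt 2 g x)
    (c : ℂ) :
    ∫ x, (laplacian f x - c * f x) * g x ∂haar = ∫ x, f x * (laplacian g x - c * g x) ∂haar := by
  have h0 : ∀ x, CkAt 0 f x := fun x => (hf x).mono zero_le_two
  have h0' : ∀ x, CkAt 0 g x := fun x => (hg x).mono zero_le_two
  simp only [sub_mul, mul_sub]
  rw [integral_sub, integral_sub, integral_laplacian_mul hf hg]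
  · congr 1
    exact integral_congr_ae (Filter.Eventually.of_forall fun x => by ring)
  · exact integrable_of_continuous (continuous_of_ckAt fun x =>
      (h0 x).mul (CkAt.laplacian (n := 0) (hg x)))
  · exact integrable_of_continuous (continuous_of_ckAt fun x => (h0 x).mul ((h0' x).const_mul c))
  · exact integrable_of_continuous (continuous_of_ckAt fun x =>
      (CkAt.laplacian (n := 0) (hf x)).mul (h0' x))
  · exact integrable_of_continuous (continuous_of_ckAt fun x => ((h0 x).const_mul c).mul (h0' x))

/-- The outermost factor is the first to be moved to g and ends up innermost there;
`shiftedProd_laplacian_sub` restores the order. -/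
theorem integral_shiftedProd_mul (n : ℕ) {f g : SO3 → ℂ} (hf : ∀ x, CkAt (2 * n) f x)
    (hg : ∀ x, CkAt (2 * n) g x) :
    ∫ x, shiftedProd n f x * g x ∂haar = ∫ x, f x * shiftedProd n g x ∂haar := by
  induction n generalizing g with
  | zero => rfl
  | succ n ih =>
    have h2 : ∀ x, CkAt 2 (shiftedProd n f) x := fun x =>
      CkAt.shiftedProd n ((hf x).mono (by omega))
    have hgl : ∀ x, CkAt (2 * n) (fun y => laplacian g y -
        (((n : ℝ) ^ 2 - 1 / 4 : ℝ) : ℂ) * g y) x := fun x =>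
      (CkAt.laplacian ((hg x).mono (by omega))).sub (((hg x).mono (by omega)).const_mul _)
    simp only [shiftedProd]
    rw [integral_laplacian_sub_mul h2 (fun x => (hg x).mono (by omega)),
      ih (fun x => (hf x).mono (by omega)) hgl]
    refine integral_congr_ae (Filter.Eventually.of_forall fun x => ?_)
    simp only
    rw [shiftedProd_laplacian_sub n _ ((hg x).mono (by omega))]

/-! ### Functions of the rotation angle -/

/-- The derivative of `sinSq` along `X_i`. -/
noncomputable def sinSqDeriv (i : Fin 3) (x : SO3) : ℝ :=
  -(∑ a, fieldCLM i (entries x) a a) / 4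

theorem sinSq_eq_entries (x : SO3) : sinSq x = (3 - ∑ a, entries x a a) / 4 := rfl

theorem hasDerivAt_sinSq (x : SO3) (i : Fin 3) :
    HasDerivAt (fun t => sinSq (x * axisRot i t)) (sinSqDeriv i x) 0 := by
  have h := hasDerivAt_entries_zero x i
  have h1 : ∀ a, HasDerivAt (fun t => entries (x * axisRot i t) a a)
      (fieldCLM i (entries x) a a) 0 := fun a => hasDerivAt_pi.mp (hasDerivAt_pi.mp h a) a
  have h2 := ((HasDerivAt.fun_sum (u := Finset.univ) fun a _ => h1 a).const_sub 3).div_const 4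
  exact h2

theorem hasDerivAt_sinSqDeriv (x : SO3) (i : Fin 3) :
    HasDerivAt (fun t => sinSqDeriv i (x * axisRot i t))
      (-(∑ a, fieldCLM i (fieldCLM i (entries x)) a a) / 4) 0 := by
  have h := (fieldCLM i).hasFDerivAt.comp_hasDerivAt (0 : ℝ) (hasDerivAt_entries_zero x i)
  have h1 := fun a => hasDerivAt_pi.mp (hasDerivAt_pi.mp h a) a
  exact (HasDerivAt.fun_sum (u := Finset.univ) fun a _ => h1 a).neg.div_const 4

/-- This is |∇s|². The derivatives X_i s are the components of the skew part of x divided by 4, so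
`skew_sq` applies. -/
theorem sum_sinSqDeriv_sq (x : SO3) :
    ∑ i, sinSqDeriv i x ^ 2 = sinSq x * (1 - sinSq x) := by
  have h := skew_sq x
  simp only [sinSqDeriv, fieldCLM_apply, gen, Fin.sum_univ_three]
  simp
  linarith

/-- This is Σ X_i² s. The squares of the three infinitesimal rotations add up to -2 times the
identity, so the sum is tr(x)/2. -/
theorem sum_sinSqDeriv_deriv (x : SO3) :
    ∑ i, -(∑ a, fieldCLM i (fieldCLM i (entries x)) a a) / 4 = 3 / 2 - 2 * sinSq x := by
  simp only [fieldCLM_apply, gen, Fin.sum_univ_three, sinSq_eq_entries]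
  simp
  ring

theorem lieDeriv_comp_sinSq {G G' : ℝ → ℝ} {x : SO3} (i : Fin 3)
    (h : HasDerivAt G (G' (sinSq x)) (sinSq x)) :
    lieDeriv i (fun y => (G (sinSq y) : ℂ)) x = ((G' (sinSq x) * sinSqDeriv i x : ℝ) : ℂ) := by
  have h1 := HasDerivAt.comp (0 : ℝ) (h₂ := G) (h := fun t => sinSq (x * axisRot i t))
    (by simpa [axisRot_zero] using h) (hasDerivAt_sinSq x i)
  exact h1.ofReal_comp.deriv

/-- The chain rule with |∇s|² = s(1 - s) and Σ X_i² s = 3/2 - 2s: on functions of the angle, Δ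
becomes a hypergeometric operator in the variable s. -/
theorem laplacian_comp_sinSq {G G' G'' : ℝ → ℝ} {x : SO3}
    (h : ∀ᶠ u in 𝓝 (sinSq x), HasDerivAt G (G' u) u)
    (h' : HasDerivAt G' (G'' (sinSq x)) (sinSq x)) :
    laplacian (fun y => (G (sinSq y) : ℂ)) x =
      ((-(sinSq x * (1 - sinSq x) * G'' (sinSq x) + (3 / 2 - 2 * sinSq x) * G' (sinSq x)) : ℝ)
        : ℂ) := by
  have hl : ∀ i, lieDeriv i (lieDeriv i (fun y => (G (sinSq y) : ℂ))) x =
      ((G'' (sinSq x) * sinSqDeriv i x ^ 2 + G' (sinSq x) *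
        (-(∑ a, fieldCLM i (fieldCLM i (entries x)) a a) / 4) : ℝ) : ℂ) := by
    intro i
    rw [lieDeriv_congr i (g := fun y => ((G' (sinSq y) * sinSqDeriv i y : ℝ) : ℂ))]
    · have h1 := HasDerivAt.comp (0 : ℝ) (h₂ := G') (h := fun t => sinSq (x * axisRot i t))
        (by simpa [axisRot_zero] using h') (hasDerivAt_sinSq x i)
      have h2 := (h1.mul (hasDerivAt_sinSqDeriv x i)).ofReal_comp.deriv
      refine h2.trans ?_
      simp only [axisRot_zero, mul_one, Function.comp]
      congr 1
      ring
    · filter_upwards [continuous_sinSq.continuousAt.eventually h] with y hy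
      exact lieDeriv_comp_sinSq i hy
  simp only [laplacian, hl]
  rw [← Complex.ofReal_sum, ← Complex.ofReal_neg]
  congr 1
  rw [Finset.sum_add_distrib, ← Finset.mul_sum, ← Finset.mul_sum, sum_sinSqDeriv_sq,
    sum_sinSqDeriv_deriv]
  ring

theorem CkAt.comp_sinSq {n : ℕ} {G : ℝ → ℝ} {x : SO3} (h : ContDiffAt ℝ n G (sinSq x)) :
    CkAt n (fun y => (G (sinSq y) : ℂ)) x := by
  refine ⟨fun M => ((G ((3 - ∑ a, M a a) / 4) : ℝ) : ℂ), ?_,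
    Filter.Eventually.of_forall fun y => rfl⟩
  refine Complex.ofRealCLM.contDiff.contDiffAt.comp (entries x)
    (f := fun M : Mat9 => G ((3 - ∑ a, M a a) / 4)) ?_
  refine ContDiffAt.comp (entries x) (f := fun M : Mat9 => (3 - ∑ a, M a a) / 4) h ?_
  fun_prop

theorem laplacian_const (c : ℂ) (x : SO3) : laplacian (fun _ => c) x = 0 := by
  have : ∀ i, lieDeriv i (fun _ => c) = fun _ => 0 := fun i => funext (lieDeriv_const i c)
  simp [laplacian, this, lieDeriv_const]

/-! ### The distribution of the rotation angle -/

/-- Green's formula against the constant 1 shows that Δ(s^{n+1}) has integral zero, which ties two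
consecutive moments of s together. -/
theorem integral_sinSq_pow_succ (n : ℕ) :
    ((n : ℝ) + 2) * ∫ x, sinSq x ^ (n + 1) ∂haar = (n + 3 / 2) * ∫ x, sinSq x ^ n ∂haar := by
  have hint : ∀ k : ℕ, Integrable (fun x => sinSq x ^ k) haar := fun k =>
    integrable_of_continuous (continuous_sinSq.pow k)
  have hck : ∀ x, CkAt 2 (fun y => ((sinSq y ^ (n + 1) : ℝ) : ℂ)) x := fun x =>
    CkAt.comp_sinSq (G := fun u => u ^ (n + 1)) (by fun_prop)
  have h1 := integral_laplacian_mul hck (fun x => CkAt.const 2 1 x)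
  have hderiv : ∀ x, laplacian (fun y => ((sinSq y ^ (n + 1) : ℝ) : ℂ)) x =
      ((((n : ℝ) + 1) * (((n : ℝ) + 2) * sinSq x ^ (n + 1) - (n + 3 / 2) * sinSq x ^ n) : ℝ)
        : ℂ) := by
    intro x
    rw [laplacian_comp_sinSq (G := fun u => u ^ (n + 1))
      (G' := fun u => ((n : ℝ) + 1) * u ^ n) (G'' := fun u => ((n : ℝ) + 1) * (n * u ^ (n - 1)))]
    · congr 1
      rcases n with _ | k
      · simp
      · simp only [Nat.add_sub_cancel]; push_cast; ring
    · exact Filter.Eventually.of_forall fun u => by simpa using hasDerivAt_pow (n + 1) u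
    · exact (hasDerivAt_pow n _).const_mul _
  simp only [laplacian_const, hderiv, mul_zero, integral_zero, mul_one] at h1
  rw [integral_complex_ofReal, Complex.ofReal_eq_zero, integral_const_mul,
    integral_sub ((hint _).const_mul _) ((hint _).const_mul _), integral_const_mul,
    integral_const_mul] at h1
  have hn : ((n : ℝ) + 1) ≠ 0 := by positivity
  have := (mul_eq_zero.mp h1).resolve_left hn
  linarith

/-- The moments of s obey the same recursion as the Wallis integrals of sin^{2n+2}, and both sides
are 1 for n = 0. This takes the place of the Weyl integration formula. -/
theorem integral_sinSq_pow (n : ℕ) :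
    ∫ x, sinSq x ^ n ∂haar =
      4 / Real.pi * ∫ t in (0 : ℝ)..(Real.pi / 2), (Real.sin t ^ 2) ^ n * Real.sin t ^ 2 := by
  induction n with
  | zero =>
    simp [integral_sin_sq]
    field_simp
    norm_num
  | succ n ih =>
    have h1 := integral_sinSq_pow_succ n
    have h2 := integral_sin_pow (a := 0) (b := Real.pi / 2) (2 * n + 2)
    simp only [Real.cos_pi_div_two, Real.sin_zero] at h2
    have e1 : ∀ t : ℝ, (Real.sin t ^ 2) ^ (n + 1) * Real.sin t ^ 2 = Real.sin t ^ (2 * n + 2 + 2) :=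
      fun t => by ring
    have e2 : ∀ t : ℝ, (Real.sin t ^ 2) ^ n * Real.sin t ^ 2 = Real.sin t ^ (2 * n + 2) :=
      fun t => by ring
    simp only [e1, e2] at ih ⊢
    rw [h2]
    have hn : ((n : ℝ) + 2) ≠ 0 := by positivity
    have h3 : ∫ x, sinSq x ^ (n + 1) ∂haar =
        (n + 3 / 2) / (n + 2) * ∫ x, sinSq x ^ n ∂haar := by
      field_simp; linarith
    rw [h3, ih]
    push_cast
    simp
    field_simp
    ring

theorem integral_comp_sinSq_polynomial (p : Polynomial ℝ) :
    ∫ x, p.eval (sinSq x) ∂haar =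
      4 / Real.pi * ∫ t in (0 : ℝ)..(Real.pi / 2), p.eval (Real.sin t ^ 2) * Real.sin t ^ 2 := by
  simp only [Polynomial.eval_eq_sum_range, Finset.sum_mul]
  rw [integral_finsetSum, intervalIntegral.integral_finsetSum, Finset.mul_sum]
  · refine Finset.sum_congr rfl fun n _ => ?_
    simp only [mul_assoc]
    rw [integral_const_mul, intervalIntegral.integral_const_mul, integral_sinSq_pow]
    ring
  · exact fun n _ => Continuous.intervalIntegrable (by fun_prop) _ _
  · exact fun n _ => integrable_of_continuous (continuous_const.mul (continuous_sinSq.pow n))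

/-- The distribution of the rotation angle `ω = 2t` under the Haar measure. -/
theorem integral_comp_sinSq {G : ℝ → ℝ} (hG : ContinuousOn G (Icc 0 1)) :
    ∫ x, G (sinSq x) ∂haar =
      4 / Real.pi * ∫ t in (0 : ℝ)..(Real.pi / 2), G (Real.sin t ^ 2) * Real.sin t ^ 2 := by
  have hs : ∀ x, sinSq x ∈ Icc (0 : ℝ) 1 := fun x => ⟨sinSq_nonneg x, sinSq_le_one x⟩
  have hs' : ∀ t : ℝ, Real.sin t ^ 2 ∈ Icc (0 : ℝ) 1 := fun t =>
    ⟨sq_nonneg _, Real.sin_sq_le_one t⟩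
  have hint : Integrable (fun x => G (sinSq x)) haar :=
    integrable_of_continuous (hG.comp_continuous continuous_sinSq hs)
  have hint' : IntervalIntegrable (fun t => G (Real.sin t ^ 2) * Real.sin t ^ 2) volume 0
      (Real.pi / 2) :=
    ((hG.comp_continuous (by fun_prop) hs').mul (by fun_prop)).intervalIntegrable _ _
  refine eq_of_forall_dist_le fun ε hε => ?_
  rw [Real.dist_eq]
  -- Weierstrass approximation reduces to moments. The replacement costs at most ε/4 on the group
  -- and (4/π)(ε/4)(π/2) = ε/2 on the interval, together less than ε.
  obtain ⟨p, hp⟩ := exists_polynomial_near_of_continuousOn 0 1 G hG (ε / 4) (by positivity)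
  have h1 : |∫ x, G (sinSq x) ∂haar - ∫ x, p.eval (sinSq x) ∂haar| ≤ ε / 4 := by
    have hp' : Integrable (fun x => p.eval (sinSq x)) haar :=
      integrable_of_continuous (p.continuous.comp continuous_sinSq)
    rw [← integral_sub hint hp']
    have := norm_integral_le_of_norm_le_const (μ := haar)
      (f := fun x => G (sinSq x) - p.eval (sinSq x)) (C := ε / 4)
      (Filter.Eventually.of_forall fun x => by
        rw [Real.norm_eq_abs, abs_sub_comm]; exact (hp _ (hs x)).le)
    simpa using this
  have h2 : |(∫ t in (0 : ℝ)..(Real.pi / 2), G (Real.sin t ^ 2) * Real.sin t ^ 2) -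
      ∫ t in (0 : ℝ)..(Real.pi / 2), p.eval (Real.sin t ^ 2) * Real.sin t ^ 2| ≤
      ε / 4 * (Real.pi / 2) := by
    have hp' : IntervalIntegrable (fun t => p.eval (Real.sin t ^ 2) * Real.sin t ^ 2) volume 0
        (Real.pi / 2) := Continuous.intervalIntegrable (by fun_prop) _ _
    rw [← intervalIntegral.integral_sub hint' hp']
    have := intervalIntegral.norm_integral_le_of_norm_le_const (a := 0) (b := Real.pi / 2)
      (f := fun t => G (Real.sin t ^ 2) * Real.sin t ^ 2 - p.eval (Real.sin t ^ 2) * Real.sin t ^ 2)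
      (C := ε / 4) (fun t _ => by
        rw [← sub_mul, Real.norm_eq_abs, abs_mul, abs_sub_comm, abs_of_nonneg (hs' t).1]
        exact (mul_le_mul (hp _ (hs' t)).le (hs' t).2 (hs' t).1 (by positivity)).trans
          (mul_one _).le)
    rwa [sub_zero, abs_of_pos (by positivity), Real.norm_eq_abs] at this
  have h3 := integral_comp_sinSq_polynomial p
  have h4 : 4 / Real.pi * (ε / 4 * (Real.pi / 2)) = ε / 2 := by
    field_simp
  have h5 := mul_le_mul_of_nonneg_left h2 (show 0 ≤ 4 / Real.pi by positivity)
  have h6 : |4 / Real.pi| = 4 / Real.pi := abs_of_pos (by positivity)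
  rw [h4, ← h6, ← abs_mul, mul_sub, ← h3] at h5
  rw [abs_le] at *
  constructor <;> linarith [h1.1, h1.2, h5.1, h5.2]

theorem two_div_pi_mul_le_sin {t : ℝ} (h0 : 0 ≤ t) (h1 : t ≤ Real.pi / 2) :
    2 / Real.pi * t ≤ Real.sin t := Real.mul_le_sin h0 h1

/-- By (r² + s)⁻² s ≤ (r² + s)⁻¹ and sin t ≥ 2t/π, the integrand is at most (r² + (2t/π)²)⁻¹, whose
primitive is an arctangent. The growth 1/r later turns ρ^{2m+1} into ρ^{2m}. -/
theorem integral_inv_sq_add_sinSq_le {r : ℝ} (hr : 0 < r) :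
    ∫ x, ((r ^ 2 + sinSq x) ^ 2)⁻¹ ∂haar ≤ Real.pi / r := by
  have hc : ContinuousOn (fun u : ℝ => ((r ^ 2 + u) ^ 2)⁻¹) (Icc 0 1) := by
    refine ContinuousOn.inv₀ (by fun_prop) fun u hu => ?_
    have := hu.1
    positivity
  rw [integral_comp_sinSq hc]
  have hpi := Real.pi_pos
  have hder : ∀ t : ℝ, HasDerivAt
      (fun t => Real.pi / (2 * r) * Real.arctan (2 / (Real.pi * r) * t))
      ((r ^ 2 + (2 / Real.pi * t) ^ 2)⁻¹) t := by
    intro t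
    have h1 : HasDerivAt (fun t : ℝ => 2 / (Real.pi * r) * t) (2 / (Real.pi * r)) t := by
      simpa using (hasDerivAt_id t).const_mul (2 / (Real.pi * r))
    have h2 := (h1.arctan).const_mul (Real.pi / (2 * r))
    refine h2.congr_deriv ?_
    have : (0 : ℝ) < r ^ 2 + (2 / Real.pi * t) ^ 2 := by positivity
    have : (0 : ℝ) < 1 + (2 / (Real.pi * r) * t) ^ 2 := by positivity
    field_simp
  have hcont : Continuous fun t : ℝ => (r ^ 2 + (2 / Real.pi * t) ^ 2)⁻¹ :=
    Continuous.inv₀ (by fun_prop) fun t => by positivity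
  have h1 : ∫ t in (0 : ℝ)..(Real.pi / 2), (r ^ 2 + (2 / Real.pi * t) ^ 2)⁻¹ ≤
      Real.pi / (2 * r) * (Real.pi / 2) := by
    rw [intervalIntegral.integral_eq_sub_of_hasDerivAt (fun t _ => hder t)
      (hcont.intervalIntegrable _ _)]
    simp only [mul_zero, Real.arctan_zero, sub_zero]
    gcongr
    exact (Real.arctan_lt_pi_div_two _).le
  have h2 : ∫ t in (0 : ℝ)..(Real.pi / 2), ((r ^ 2 + Real.sin t ^ 2) ^ 2)⁻¹ * Real.sin t ^ 2 ≤
      ∫ t in (0 : ℝ)..(Real.pi / 2), (r ^ 2 + (2 / Real.pi * t) ^ 2)⁻¹ := by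
    refine intervalIntegral.integral_mono_on (by positivity) ?_ (hcont.intervalIntegrable _ _) ?_
    · refine Continuous.intervalIntegrable ?_ _ _
      exact (Continuous.inv₀ (by fun_prop) fun t => by positivity).mul (by fun_prop)
    · intro t ht
      have hs := two_div_pi_mul_le_sin ht.1 ht.2
      have h0 : 0 ≤ 2 / Real.pi * t := mul_nonneg (by positivity) ht.1
      have h3 : (2 / Real.pi * t) ^ 2 ≤ Real.sin t ^ 2 := by gcongr
      calc ((r ^ 2 + Real.sin t ^ 2) ^ 2)⁻¹ * Real.sin t ^ 2
          ≤ ((r ^ 2 + Real.sin t ^ 2) ^ 2)⁻¹ * (r ^ 2 + Real.sin t ^ 2) := by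
            gcongr; linarith [sq_nonneg r]
        _ = (r ^ 2 + Real.sin t ^ 2)⁻¹ := by
            have : r ^ 2 + Real.sin t ^ 2 ≠ 0 := by positivity
            field_simp
        _ ≤ _ := by gcongr
  calc _ ≤ 4 / Real.pi * (Real.pi / (2 * r) * (Real.pi / 2)) := by
        gcongr; exact h2.trans h1
    _ = Real.pi / r := by field_simp; norm_num

/-- Chebyshev's inequality: on the ball the integrand of `integral_inv_sq_add_sinSq_le` is at least
(2r²)⁻², so the measure is at most 4r⁴ · π/r. -/
theorem haar_sinSq_le_pow {r : ℝ} (hr : 0 < r) :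
    haar {x | sinSq x ≤ r ^ 2} ≤ ENNReal.ofReal (4 * Real.pi * r ^ 3) := by
  have hcont : Continuous fun x : SO3 => ((r ^ 2 + sinSq x) ^ 2)⁻¹ := by
    refine Continuous.inv₀ ((continuous_const.add continuous_sinSq).pow 2) fun x => ?_
    have := sinSq_nonneg x
    positivity
  have hint := integrable_of_continuous hcont
  have h0 : ∀ x : SO3, 0 ≤ ((r ^ 2 + sinSq x) ^ 2)⁻¹ := fun x => by positivity
  have h1 := mul_meas_ge_le_integral_of_nonneg (Filter.Eventually.of_forall h0) hint
    (((2 * r ^ 2) ^ 2)⁻¹)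
  have hsub : haar.real {x | sinSq x ≤ r ^ 2} ≤
      haar.real {x | ((2 * r ^ 2) ^ 2)⁻¹ ≤ ((r ^ 2 + sinSq x) ^ 2)⁻¹} := by
    refine measureReal_mono (fun x hx => ?_)
    have := sinSq_nonneg x
    simp only [mem_ofPred_eq] at hx ⊢
    gcongr
    linarith
  rw [← ofReal_measureReal]
  refine ENNReal.ofReal_le_ofReal (hsub.trans ?_)
  have h2 := h1.trans (integral_inv_sq_add_sinSq_le hr)
  rw [inv_mul_le_iff₀ (by positivity)] at h2
  calc _ ≤ _ := h2
    _ = 4 * Real.pi * r ^ 3 := by field_simp; ring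

/-- The set lies in balls of measure O(r³) with r → 0. Thus the identity, where negative powers of s
are singular, is negligible. -/
theorem haar_sinSq_le_zero : haar {x | sinSq x ≤ 0} = 0 := by
  refine le_antisymm ?_ bot_le
  have ht : Filter.Tendsto (fun r : ℝ => ENNReal.ofReal (4 * Real.pi * r ^ 3)) (𝓝[>] 0) (𝓝 0) := by
    have : Continuous fun r : ℝ => ENNReal.ofReal (4 * Real.pi * r ^ 3) :=
      ENNReal.continuous_ofReal.comp (by fun_prop)
    simpa using (this.tendsto 0).mono_left nhdsWithin_le_nhds
  refine ge_of_tendsto ht ?_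
  filter_upwards [self_mem_nhdsWithin] with r hr
  refine (measure_mono fun x hx => ?_).trans (haar_sinSq_le_pow hr)
  exact le_trans (by exact hx) (sq_nonneg r)

theorem ae_sinSq_pos : ∀ᵐ x ∂haar, 0 < sinSq x := by
  rw [ae_iff]
  simpa using haar_sinSq_le_zero

/-! ### Regularized powers and the fundamental solution -/

open Filter

theorem tendsto_add_rpow {s : ℝ} (hs : 0 < s) (b : ℝ) :
    Tendsto (fun ε : ℝ => (s + ε) ^ b) (𝓝[>] 0) (𝓝 (s ^ b)) := by
  have h : ContinuousAt (fun ε : ℝ => (s + ε) ^ b) 0 :=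
    ContinuousAt.rpow_const (by fun_prop) (Or.inl (by simpa using hs.ne'))
  simpa using h.tendsto.mono_left nhdsWithin_le_nhds

/-- A majorant independent of ε ≤ 1. One function s^{-1/2} serves for all powers, since -1/2 is the
lowest exponent that survives the limit ε → 0. -/
theorem add_rpow_le {s ε b : ℝ} (hs : 0 < s) (hs1 : s ≤ 1) (hε : 0 < ε) (hε1 : ε ≤ 1)
    (hb : -(1 / 2) ≤ b) : (s + ε) ^ b ≤ 2 ^ (b + 1 / 2) * s ^ (-(1 / 2) : ℝ) := by
  have h1 : (s + ε) ^ b = (s + ε) ^ (b + 1 / 2) * (s + ε) ^ (-(1 / 2) : ℝ) := by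
    rw [← Real.rpow_add (by positivity)]
    congr 1
    ring
  rw [h1]
  refine mul_le_mul ?_ ?_ (by positivity) (by positivity)
  · exact Real.rpow_le_rpow (by positivity) (by linarith) (by linarith)
  · exact Real.rpow_le_rpow_of_nonpos hs (by linarith) (by norm_num)

theorem mul_add_rpow_sub_one_le {s ε b : ℝ} (hs : 0 < s) (hε : 0 < ε) :
    ε * (s + ε) ^ (b - 1) ≤ (s + ε) ^ b := by
  have hq : 0 < s + ε := by positivity
  calc ε * (s + ε) ^ (b - 1) ≤ (s + ε) * (s + ε) ^ (b - 1) := by gcongr; linarith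
    _ = (s + ε) ^ b := by
      rw [Real.rpow_sub_one hq.ne']
      field_simp

theorem continuous_sinSq_add_rpow {ε : ℝ} (hε : 0 < ε) (b : ℝ) :
    Continuous fun x => (sinSq x + ε) ^ b :=
  (continuous_sinSq.add continuous_const).rpow_const fun x =>
    Or.inl (add_pos_of_nonneg_of_pos (sinSq_nonneg x) hε).ne'

theorem eventually_pos_le_one : ∀ᶠ ε : ℝ in 𝓝[>] 0, 0 < ε ∧ ε ≤ 1 := by
  filter_upwards [Ioc_mem_nhdsGT (zero_lt_one' ℝ)] with ε hε using hε

theorem sq_mul_sq_add_rpow_le {u ε : ℝ} (hu : 0 ≤ u) (hu1 : u ≤ 1) (hε : 0 < ε) (hε1 : ε ≤ 1) :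
    (u + ε) ^ (-(1 / 2) : ℝ) * u ≤ 2 := by
  have hq : 0 < u + ε := by positivity
  calc (u + ε) ^ (-(1 / 2) : ℝ) * u ≤ (u + ε) ^ (-(1 / 2) : ℝ) * (u + ε) := by gcongr; linarith
    _ = (u + ε) ^ (1 / 2 : ℝ) := by
      rw [← Real.rpow_add_one hq.ne']; norm_num
    _ ≤ 2 ^ (1 / 2 : ℝ) := Real.rpow_le_rpow hq.le (by linarith) (by norm_num)
    _ ≤ 2 ^ (1 : ℝ) := Real.rpow_le_rpow_of_exponent_le (by norm_num) (by norm_num)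
    _ = 2 := Real.rpow_one 2

theorem integral_sinSq_add_rpow {ε : ℝ} (hε : 0 < ε) (b : ℝ) :
    ∫ x, (sinSq x + ε) ^ b ∂haar = 4 / Real.pi *
      ∫ t in (0 : ℝ)..(Real.pi / 2), (Real.sin t ^ 2 + ε) ^ b * Real.sin t ^ 2 := by
  refine integral_comp_sinSq (G := fun u => (u + ε) ^ b) ?_
  exact ContinuousOn.rpow_const (by fun_prop) fun u hu =>
    Or.inl (add_pos_of_nonneg_of_pos hu.1 hε).ne'

/-- Fatou's lemma along ε = 1/(n+1): the regularized integrals are at most 4, since the weight sin²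
t absorbs the singularity. `integral_comp_sinSq` does not apply directly, as it asks for continuity
on [0, 1]. -/
theorem integrable_sinSq_rpow_neg_half :
    Integrable (fun x => sinSq x ^ (-(1 / 2) : ℝ)) haar := by
  have hm : Measurable fun x => sinSq x ^ (-(1 / 2) : ℝ) :=
    continuous_sinSq.measurable.pow_const _
  refine ⟨hm.aestronglyMeasurable, ?_⟩
  set e : ℕ → ℝ := fun n => 1 / ((n : ℝ) + 1) with he
  have he0 : ∀ n, 0 < e n := fun n => by positivity
  have he1 : ∀ n, e n ≤ 1 := fun n => by
    rw [he]; simp only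
    rw [div_le_one (by positivity)]; linarith [Nat.cast_nonneg (α := ℝ) n]
  have het : Tendsto e atTop (𝓝[>] 0) :=
    tendsto_nhdsWithin_iff.mpr ⟨tendsto_one_div_add_atTop_nhds_zero_nat,
      Eventually.of_forall he0⟩
  have h1 : ∫⁻ x, ‖sinSq x ^ (-(1 / 2) : ℝ)‖ₑ ∂haar ≤
      liminf (fun n => ∫⁻ x, ‖(sinSq x + e n) ^ (-(1 / 2) : ℝ)‖ₑ ∂haar) atTop := by
    refine le_trans (lintegral_mono_ae ?_) (lintegral_liminf_le fun n =>
      (continuous_sinSq_add_rpow (he0 n) _).measurable.enorm)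
    filter_upwards [ae_sinSq_pos] with x hx
    exact (((tendsto_add_rpow hx _).comp het).enorm.liminf_eq).ge
  have h2 : ∀ n, ∫⁻ x, ‖(sinSq x + e n) ^ (-(1 / 2) : ℝ)‖ₑ ∂haar ≤ ENNReal.ofReal 4 := by
    intro n
    have hnn : ∀ x, 0 ≤ (sinSq x + e n) ^ (-(1 / 2) : ℝ) := fun x =>
      Real.rpow_nonneg (add_nonneg (sinSq_nonneg x) (he0 n).le) _
    simp only [Real.enorm_eq_ofReal (hnn _)]
    rw [← ofReal_integral_eq_lintegral_ofReal
      (integrable_of_continuous (continuous_sinSq_add_rpow (he0 n) _))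
      (Eventually.of_forall hnn)]
    refine ENNReal.ofReal_le_ofReal ?_
    rw [integral_sinSq_add_rpow (he0 n)]
    have h3 := intervalIntegral.norm_integral_le_of_norm_le_const (a := 0) (b := Real.pi / 2)
      (f := fun t => (Real.sin t ^ 2 + e n) ^ (-(1 / 2) : ℝ) * Real.sin t ^ 2) (C := 2)
      (fun t _ => by
        have := he0 n
        rw [Real.norm_of_nonneg (by positivity)]
        exact sq_mul_sq_add_rpow_le (sq_nonneg _) (Real.sin_sq_le_one t) (he0 n) (he1 n))
    have hpi := Real.pi_pos
    rw [sub_zero, abs_of_pos (by positivity)] at h3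
    calc _ ≤ 4 / Real.pi * (2 * (Real.pi / 2)) := by
          gcongr; exact (le_abs_self _).trans h3
      _ = 4 := by field_simp
  have h4 : liminf (fun n => ∫⁻ x, ‖(sinSq x + e n) ^ (-(1 / 2) : ℝ)‖ₑ ∂haar) atTop ≤
      ENNReal.ofReal 4 :=
    liminf_le_of_frequently_le' (Frequently.of_forall h2)
  exact lt_of_le_of_lt (h1.trans h4) ENNReal.ofReal_lt_top

theorem tendsto_integral_mul_add_rpow {F : SO3 → ℂ} (hF : Continuous F) {b : ℝ}
    (hb : -(1 / 2) ≤ b) :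
    Tendsto (fun ε : ℝ => ∫ x, F x * (((sinSq x + ε) ^ b : ℝ) : ℂ) ∂haar) (𝓝[>] 0)
      (𝓝 (∫ x, F x * ((sinSq x ^ b : ℝ) : ℂ) ∂haar)) := by
  obtain ⟨C, hC⟩ := isCompact_univ.exists_bound_of_continuousOn hF.continuousOn
  refine tendsto_integral_filter_of_dominated_convergence
    (fun x => C * (2 ^ (b + 1 / 2) * sinSq x ^ (-(1 / 2) : ℝ))) ?_ ?_
    ((integrable_sinSq_rpow_neg_half.const_mul _).const_mul _) ?_
  · filter_upwards [self_mem_nhdsWithin] with ε hε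
    exact (hF.mul (Complex.continuous_ofReal.comp
      (continuous_sinSq_add_rpow hε b))).aestronglyMeasurable
  · filter_upwards [eventually_pos_le_one] with ε hε
    filter_upwards [ae_sinSq_pos] with x hx
    rw [norm_mul, Complex.norm_real, Real.norm_of_nonneg (Real.rpow_nonneg (by linarith) _)]
    have hC0 : 0 ≤ C := (norm_nonneg _).trans (hC x (mem_univ x))
    exact mul_le_mul (hC x (mem_univ x)) (add_rpow_le hx (sinSq_le_one x) hε.1 hε.2 hb)
      (Real.rpow_nonneg (by linarith) _) hC0
  · filter_upwards [ae_sinSq_pos] with x hx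
    exact tendsto_const_nhds.mul
      ((Complex.continuous_ofReal.tendsto _).comp (tendsto_add_rpow hx b))

/-- Off the identity the factor ε sends the integrand to zero, and ε(s + ε)^{b-1} ≤ (s + ε)^b gives
the same majorant as before. -/
theorem tendsto_integral_mul_mul_add_rpow {F : SO3 → ℂ} (hF : Continuous F) {b : ℝ}
    (hb : -(1 / 2) ≤ b) :
    Tendsto (fun ε : ℝ => ∫ x, F x * ((ε * (sinSq x + ε) ^ (b - 1) : ℝ) : ℂ) ∂haar) (𝓝[>] 0)
      (𝓝 0) := by
  obtain ⟨C, hC⟩ := isCompact_univ.exists_bound_of_continuousOn hF.continuousOn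
  have h0 : (0 : ℂ) = ∫ x, (0 : ℂ) ∂haar := by simp
  rw [h0]
  refine tendsto_integral_filter_of_dominated_convergence
    (fun x => C * (2 ^ (b + 1 / 2) * sinSq x ^ (-(1 / 2) : ℝ))) ?_ ?_
    ((integrable_sinSq_rpow_neg_half.const_mul _).const_mul _) ?_
  · filter_upwards [self_mem_nhdsWithin] with ε hε
    exact (hF.mul (Complex.continuous_ofReal.comp
      (continuous_const.mul (continuous_sinSq_add_rpow hε _)))).aestronglyMeasurable
  · filter_upwards [eventually_pos_le_one] with ε hε
    filter_upwards [ae_sinSq_pos] with x hx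
    have hq : 0 ≤ ε * (sinSq x + ε) ^ (b - 1) :=
      mul_nonneg hε.1.le (Real.rpow_nonneg (by linarith) _)
    rw [norm_mul, Complex.norm_real, Real.norm_of_nonneg hq]
    have hC0 : 0 ≤ C := (norm_nonneg _).trans (hC x (mem_univ x))
    exact mul_le_mul (hC x (mem_univ x)) ((mul_add_rpow_sub_one_le hx hε.1).trans
      (add_rpow_le hx (sinSq_le_one x) hε.1 hε.2 hb)) hq hC0
  · filter_upwards [ae_sinSq_pos] with x hx
    have h1 : Tendsto (fun ε : ℝ => ε * (sinSq x + ε) ^ (b - 1)) (𝓝[>] 0) (𝓝 0) := by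
      have h2 : Tendsto (fun ε : ℝ => ε) (𝓝[>] 0) (𝓝 0) := nhdsWithin_le_nhds
      simpa using h2.mul (tendsto_add_rpow hx (b - 1))
    simpa using (tendsto_const_nhds (x := F x)).mul ((Complex.continuous_ofReal.tendsto _).comp h1)

/-- In the limit the weight cancels the singularity and leaves (4/π) ∫ sin t dt. The value fixes the
mass of the delta function below. -/
theorem integral_sinSq_rpow_neg_half :
    ∫ x, sinSq x ^ (-(1 / 2) : ℝ) ∂haar = 4 / Real.pi := by
  have h1 := tendsto_integral_mul_add_rpow (F := fun _ => 1) continuous_const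
    (b := -(1 / 2)) le_rfl
  simp only [one_mul, integral_complex_ofReal] at h1
  have h1' : Tendsto (fun ε : ℝ => ∫ x, (sinSq x + ε) ^ (-(1 / 2) : ℝ) ∂haar) (𝓝[>] 0)
      (𝓝 (∫ x, sinSq x ^ (-(1 / 2) : ℝ) ∂haar)) := by
    have := (Complex.continuous_re.tendsto _).comp h1
    simpa [Function.comp_def] using this
  have h2 : Tendsto (fun ε : ℝ => ∫ t in (0 : ℝ)..(Real.pi / 2),
      (Real.sin t ^ 2 + ε) ^ (-(1 / 2) : ℝ) * Real.sin t ^ 2) (𝓝[>] 0)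
      (𝓝 (∫ t in (0 : ℝ)..(Real.pi / 2), Real.sin t)) := by
    refine intervalIntegral.tendsto_integral_filter_of_dominated_convergence (fun _ => 2) ?_ ?_
      (by simp) ?_
    · filter_upwards [self_mem_nhdsWithin] with ε hε
      have hε' : 0 < ε := hε
      refine Continuous.aestronglyMeasurable (Continuous.mul ?_ (by fun_prop))
      exact Continuous.rpow_const (by fun_prop) fun t => Or.inl (by positivity)
    · filter_upwards [eventually_pos_le_one] with ε hε
      refine Eventually.of_forall fun t _ => ?_
      have := hε.1
      rw [Real.norm_of_nonneg (by positivity)]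
      exact sq_mul_sq_add_rpow_le (sq_nonneg _) (Real.sin_sq_le_one t) hε.1 hε.2
    · refine Eventually.of_forall fun t ht => ?_
      rw [uIoc_of_le (by positivity)] at ht
      have hs : 0 < Real.sin t :=
        Real.sin_pos_of_pos_of_lt_pi ht.1 (by linarith [ht.2, Real.pi_pos])
      have h3 := (tendsto_add_rpow (pow_pos hs 2) (-(1 / 2))).mul_const (Real.sin t ^ 2)
      have h4 : (Real.sin t ^ 2) ^ (-(1 / 2) : ℝ) * Real.sin t ^ 2 = Real.sin t := by
        rw [Real.rpow_neg (by positivity), ← Real.sqrt_eq_rpow, Real.sqrt_sq hs.le]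
        field_simp
      rwa [h4] at h3
  have h3 : ∫ t in (0 : ℝ)..(Real.pi / 2), Real.sin t = 1 := by simp
  rw [h3] at h2
  refine tendsto_nhds_unique h1' ?_
  have h4 := h2.const_mul (4 / Real.pi)
  rw [mul_one] at h4
  refine h4.congr' ?_
  filter_upwards [self_mem_nhdsWithin] with ε hε
  exact (integral_sinSq_add_rpow hε _).symm

theorem ckAt_sinSq_add_rpow (n : ℕ) {ε : ℝ} (hε : 0 < ε) (a : ℝ) (x : SO3) :
    CkAt n (fun y => (((sinSq y + ε) ^ a : ℝ) : ℂ)) x := by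
  refine CkAt.comp_sinSq (G := fun u => (u + ε) ^ a) ?_
  exact ContDiffAt.rpow_const_of_ne (by fun_prop)
    (add_pos_of_nonneg_of_pos (sinSq_nonneg x) hε).ne'

/-- The right side is sorted by its behaviour as ε → 0. The first term is the recursion term, and
the other two carry a factor ε. For a ≥ 1/2 these two vanish in the limit; for a = -1/2 the first
coefficient is zero and the last term concentrates at the identity. -/
theorem laplacian_sinSq_add_rpow {ε : ℝ} (hε : 0 < ε) (a : ℝ) (x : SO3) :
    laplacian (fun y => (((sinSq y + ε) ^ a : ℝ) : ℂ)) x -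
        ((a * (a + 1) : ℝ) : ℂ) * (((sinSq x + ε) ^ a : ℝ) : ℂ) =
      ((-(a * (a + 1 / 2)) * (sinSq x + ε) ^ (a - 1)
        - 2 * a ^ 2 * ε * (sinSq x + ε) ^ (a - 1)
        + a * (a - 1) * (1 + ε) * (ε * (sinSq x + ε) ^ (a - 1 - 1)) : ℝ) : ℂ) := by
  have hq : 0 < sinSq x + ε := add_pos_of_nonneg_of_pos (sinSq_nonneg x) hε
  have hd : ∀ (b u : ℝ), 0 < u + ε →
      HasDerivAt (fun u : ℝ => (u + ε) ^ b) (b * (u + ε) ^ (b - 1)) u := fun b u hu => by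
    simpa using ((hasDerivAt_id u).add_const ε).rpow_const (p := b) (Or.inl hu.ne')
  rw [laplacian_comp_sinSq (G := fun u => (u + ε) ^ a) (G' := fun u => a * (u + ε) ^ (a - 1))
    (G'' := fun u => a * ((a - 1) * (u + ε) ^ (a - 1 - 1)))]
  · rw [← Complex.ofReal_mul, ← Complex.ofReal_sub]
    congr 1
    have e1 : (sinSq x + ε) ^ (a - 1) = (sinSq x + ε) * (sinSq x + ε) ^ (a - 1 - 1) := by
      rw [Real.rpow_sub_one hq.ne' (a - 1)]; field_simp
    have e0 : (sinSq x + ε) ^ a = (sinSq x + ε) * (sinSq x + ε) ^ (a - 1) := by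
      rw [Real.rpow_sub_one hq.ne' a]; field_simp
    rw [e0, e1]
    ring
  · have : ∀ᶠ u in 𝓝 (sinSq x), 0 < u + ε :=
      (continuous_add_const ε).continuousAt.eventually (lt_mem_nhds hq)
    filter_upwards [this] with u hu using hd a u hu
  · exact (hd (a - 1) _ hq).const_mul a

/-- Green's formula against the regularized power of `sinSq`. -/
theorem integral_laplacian_sub_mul_add_rpow {F : SO3 → ℂ} (hF : ∀ x, CkAt 2 F x) {ε : ℝ}
    (hε : 0 < ε) (a : ℝ) :
    ∫ x, (laplacian F x - ((a * (a + 1) : ℝ) : ℂ) * F x) * (((sinSq x + ε) ^ a : ℝ) : ℂ) ∂haar =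
      ((-(a * (a + 1 / 2)) : ℝ) : ℂ) * (∫ x, F x * (((sinSq x + ε) ^ (a - 1) : ℝ) : ℂ) ∂haar)
      - ((2 * a ^ 2 * ε : ℝ) : ℂ) * (∫ x, F x * (((sinSq x + ε) ^ (a - 1) : ℝ) : ℂ) ∂haar)
      + ((a * (a - 1) * (1 + ε) : ℝ) : ℂ) *
        ∫ x, F x * ((ε * (sinSq x + ε) ^ (a - 1 - 1) : ℝ) : ℂ) ∂haar := by
  have hFc := continuous_of_ckAt hF
  rw [integral_laplacian_sub_mul hF (ckAt_sinSq_add_rpow 2 hε a)]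
  simp only [laplacian_sinSq_add_rpow hε]
  have hi : ∀ b : ℝ, Integrable (fun x => F x * (((sinSq x + ε) ^ b : ℝ) : ℂ)) haar := fun b =>
    integrable_of_continuous (hFc.mul (Complex.continuous_ofReal.comp
      (continuous_sinSq_add_rpow hε b)))
  have hi' : Integrable (fun x => F x * ((ε * (sinSq x + ε) ^ (a - 1 - 1) : ℝ) : ℂ)) haar :=
    integrable_of_continuous (hFc.mul (Complex.continuous_ofReal.comp
      (continuous_const.mul (continuous_sinSq_add_rpow hε _))))
  rw [← integral_const_mul, ← integral_const_mul, ← integral_const_mul,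
    ← integral_sub ((hi _).const_mul _) ((hi _).const_mul _),
    ← integral_add (by exact ((hi (a - 1)).const_mul _).sub ((hi (a - 1)).const_mul _))
      (hi'.const_mul _)]
  refine integral_congr_ae (Eventually.of_forall fun x => ?_)
  push_cast
  ring

/-- The recursion between consecutive powers of `sinSq` in the sense of distributions. -/
theorem integral_laplacian_sub_mul_rpow {F : SO3 → ℂ} (hF : ∀ x, CkAt 2 F x) {a : ℝ}
    (ha : 1 / 2 ≤ a) :
    ∫ x, (laplacian F x - ((a * (a + 1) : ℝ) : ℂ) * F x) * ((sinSq x ^ a : ℝ) : ℂ) ∂haar =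
      ((-(a * (a + 1 / 2)) : ℝ) : ℂ) * ∫ x, F x * ((sinSq x ^ (a - 1) : ℝ) : ℂ) ∂haar := by
  have hFc := continuous_of_ckAt hF
  have hlc : Continuous fun x => laplacian F x - ((a * (a + 1) : ℝ) : ℂ) * F x :=
    continuous_of_ckAt (n := 0) fun x =>
      (CkAt.laplacian (hF x)).sub (((hF x).mono zero_le_two).const_mul _)
  have h1 := tendsto_integral_mul_add_rpow hlc (b := a) (by linarith)
  have h2 := tendsto_integral_mul_add_rpow hFc (b := a - 1) (by linarith)
  have h3 := tendsto_integral_mul_mul_add_rpow hFc (b := a - 1) (by linarith)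
  have hε : Tendsto (fun ε : ℝ => ε) (𝓝[>] 0) (𝓝 0) := nhdsWithin_le_nhds
  have hc1 : Tendsto (fun ε : ℝ => ((2 * a ^ 2 * ε : ℝ) : ℂ)) (𝓝[>] 0) (𝓝 0) := by
    have := (Complex.continuous_ofReal.tendsto _).comp (hε.const_mul (2 * a ^ 2))
    rwa [mul_zero, Complex.ofReal_zero] at this
  have hc2 : Tendsto (fun ε : ℝ => ((a * (a - 1) * (1 + ε) : ℝ) : ℂ)) (𝓝[>] 0)
      (𝓝 ((a * (a - 1) * (1 + 0) : ℝ) : ℂ)) :=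
    (Complex.continuous_ofReal.tendsto _).comp ((hε.const_add 1).const_mul _)
  have h4 := ((h2.const_mul ((-(a * (a + 1 / 2)) : ℝ) : ℂ)).sub (hc1.mul h2)).add (hc2.mul h3)
  simp only [zero_mul, mul_zero, sub_zero, add_zero] at h4
  refine tendsto_nhds_unique h1 (h4.congr' ?_)
  filter_upwards [self_mem_nhdsWithin] with ε hε
  exact (integral_laplacian_sub_mul_add_rpow hF hε a).symm

/-- The case a = -1/2 of Green's formula: the recursion term has coefficient zero and the term with
ε(s + ε)^{-3/2} tends to zero, so ε(s + ε)^{-5/2} carries the whole limit. -/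
theorem tendsto_integral_mul_peak {F : SO3 → ℂ} (hF : ∀ x, CkAt 2 F x) :
    Tendsto (fun ε : ℝ => ((3 / 4 * (1 + ε) : ℝ) : ℂ) *
        ∫ x, F x * ((ε * (sinSq x + ε) ^ (-(5 / 2) : ℝ) : ℝ) : ℂ) ∂haar) (𝓝[>] 0)
      (𝓝 (∫ x, (laplacian F x + 1 / 4 * F x) * ((sinSq x ^ (-(1 / 2) : ℝ) : ℝ) : ℂ) ∂haar)) := by
  have hFc := continuous_of_ckAt hF
  have hlc : Continuous fun x => laplacian F x + 1 / 4 * F x :=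
    continuous_of_ckAt (n := 0) fun x =>
      (CkAt.laplacian (hF x)).add (((hF x).mono zero_le_two).const_mul _)
  have h1 := tendsto_integral_mul_add_rpow hlc (b := -(1 / 2)) le_rfl
  have h2 := tendsto_integral_mul_mul_add_rpow hFc (b := -(1 / 2)) le_rfl
  have h3 := h1.add (h2.const_mul (1 / 2))
  rw [mul_zero, add_zero] at h3
  refine h3.congr' ?_
  filter_upwards [self_mem_nhdsWithin] with ε hε
  have h := integral_laplacian_sub_mul_add_rpow hF hε (-(1 / 2))
  have e1 : ∀ x, (laplacian F x - ((-(1 / 2) * (-(1 / 2) + 1) : ℝ) : ℂ) * F x) =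
      laplacian F x + 1 / 4 * F x := fun x => by push_cast; ring
  have e2 : (-(1 / 2) - 1 : ℝ) = -(3 / 2) := by norm_num
  have e3 : (-(3 / 2) - 1 : ℝ) = -(5 / 2) := by norm_num
  simp only [e1, e2, e3] at h ⊢
  rw [h]
  have e4 : ∫ x, F x * ((ε * (sinSq x + ε) ^ (-(3 / 2) : ℝ) : ℝ) : ℂ) ∂haar =
      (ε : ℂ) * ∫ x, F x * (((sinSq x + ε) ^ (-(3 / 2) : ℝ) : ℝ) : ℂ) ∂haar := by
    rw [← integral_const_mul]
    refine integral_congr_ae (Eventually.of_forall fun x => ?_)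
    push_cast
    ring
  rw [e4]
  push_cast
  ring

/-- `1 / sin (ω / 2)` is `π⁻¹` times the fundamental solution of `Δ + 1/4`. -/
theorem integral_laplacian_add_mul_rpow {F : SO3 → ℂ} (hF : ∀ x, CkAt 2 F x) :
    ∫ x, (laplacian F x + 1 / 4 * F x) * ((sinSq x ^ (-(1 / 2) : ℝ) : ℝ) : ℂ) ∂haar =
      (Real.pi : ℂ)⁻¹ * F 1 := by
  have hFc := continuous_of_ckAt hF
  set φ : ℝ → SO3 → ℝ := fun ε x =>
    Real.pi * (3 / 4 * (1 + ε)) * (ε * (sinSq x + ε) ^ (-(5 / 2) : ℝ)) with hφ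
  -- Testing with F = 1 gives the mass of the peak without computing its integral: π · (1/4) · ∫
  -- s^{-1/2} = π · (1/4) · (4/π) = 1.
  have hone := tendsto_integral_mul_peak (F := fun _ => 1) fun x => CkAt.const 2 1 x
  simp only [laplacian_const, zero_add, mul_one, one_mul, integral_complex_ofReal,
    integral_const_mul, integral_sinSq_rpow_neg_half] at hone
  have hmass : Tendsto (fun ε => ∫ x in univ, φ ε x ∂haar) (𝓝[>] 0) (𝓝 1) := by
    have h := ((Complex.continuous_re.tendsto _).comp hone).const_mul Real.pi
    have e : Real.pi * (1 / 4 * ((4 / Real.pi : ℝ) : ℂ)).re = 1 := by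
      have : (1 / 4 * ((4 / Real.pi : ℝ) : ℂ)) = ((1 / 4 * (4 / Real.pi) : ℝ) : ℂ) := by push_cast; ring
      rw [this, Complex.ofReal_re]
      field_simp
    rw [e] at h
    refine h.congr fun ε => ?_
    simp only [hφ, Measure.restrict_univ, Function.comp, integral_const_mul]
    rw [← Complex.ofReal_mul, Complex.ofReal_re]
    ring
  have hpeak := tendsto_integral_peak_smul_of_integrable_of_tendsto (μ := haar) (g := F)
    (l := 𝓝[>] (0 : ℝ)) (x₀ := (1 : SO3)) (t := univ) (φ := φ) (a := F 1) MeasurableSet.univ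
    univ_mem (measure_ne_top _ _) ?_ ?_ hmass ?_ (integrable_of_continuous hFc) (hFc.tendsto 1)
  · have h1 := tendsto_integral_mul_peak hF
    have h2 := hpeak.const_mul (Real.pi : ℂ)⁻¹
    refine tendsto_nhds_unique h1 (h2.congr fun ε => ?_)
    rw [← integral_const_mul, ← integral_const_mul]
    refine integral_congr_ae (Eventually.of_forall fun x => ?_)
    have hpi : (Real.pi : ℂ) ≠ 0 := by exact_mod_cast Real.pi_ne_zero
    simp only [hφ, Complex.real_smul]
    push_cast
    field_simp
  · filter_upwards [self_mem_nhdsWithin] with ε hε x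
    have hε' : 0 < ε := hε
    have := sinSq_nonneg x
    have := Real.pi_pos
    positivity
  · intro u hu h1u
    have hcpt : IsCompact uᶜ := hu.isClosed_compl.isCompact
    -- Off a neighbourhood of the identity s is bounded below by compactness, hence the peak is O(ε)
    -- there.
    obtain ⟨δ, hδ, hδu⟩ : ∃ δ > 0, ∀ x ∈ uᶜ, δ ≤ sinSq x := by
      rcases (uᶜ).eq_empty_or_nonempty with he | hne
      · exact ⟨1, one_pos, by simp [he]⟩
      · obtain ⟨x0, hx0, hmin⟩ := hcpt.exists_isMinOn hne continuous_sinSq.continuousOn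
        refine ⟨sinSq x0, ?_, fun x hx => hmin hx⟩
        refine lt_of_le_of_ne (sinSq_nonneg _) fun h => hx0 ?_
        rw [sinSq_eq_zero_iff.mp h.symm]
        exact h1u
    rw [Metric.tendstoUniformlyOn_iff]
    intro η hη
    have ht : Tendsto (fun ε : ℝ => Real.pi * (3 / 4 * (1 + ε)) * (ε * δ ^ (-(5 / 2) : ℝ)))
        (𝓝[>] 0) (𝓝 0) := by
      have : Continuous fun ε : ℝ => Real.pi * (3 / 4 * (1 + ε)) * (ε * δ ^ (-(5 / 2) : ℝ)) := by
        fun_prop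
      simpa using (this.tendsto 0).mono_left nhdsWithin_le_nhds
    filter_upwards [ht.eventually (gt_mem_nhds hη), self_mem_nhdsWithin] with ε h1 hε x hx
    have hε' : 0 < ε := hε
    have hx0 := sinSq_nonneg x
    have := Real.pi_pos
    rw [Pi.zero_apply, dist_zero_left, Real.norm_of_nonneg (by positivity)]
    refine lt_of_le_of_lt ?_ h1
    have : (sinSq x + ε) ^ (-(5 / 2) : ℝ) ≤ δ ^ (-(5 / 2) : ℝ) :=
      Real.rpow_le_rpow_of_nonpos hδ (by linarith [hδu x hx]) (by norm_num)
    simp only [hφ]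
    gcongr
  · filter_upwards [self_mem_nhdsWithin] with ε hε
    exact ((continuous_const.mul (continuous_const.mul
      (continuous_sinSq_add_rpow hε _)))).aestronglyMeasurable

/-- For n ≥ 1 the outermost factor Δ - (n² - 1/4) meets the exponent a = n - 1/2, for which a(a + 1)
= n² - 1/4. It lowers the exponent by one with the factor -a(a + 1/2) = -(2n)(2n - 1)/4, and these
factors multiply to (2n)!/(-4)^n. -/
theorem integral_shiftedProd_mul_rpow {φ : SO3 → ℂ} (n : ℕ) (hφ : ∀ x, CkAt (2 * (n + 1)) φ x) :
    ∫ x, shiftedProd (n + 1) φ x * ((sinSq x ^ ((n : ℝ) - 1 / 2) : ℝ) : ℂ) ∂haar =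
      (((Nat.factorial (2 * n) : ℝ) / (Real.pi * (-4) ^ n) : ℝ) : ℂ) * φ 1 := by
  induction n with
  | zero =>
    have h := integral_laplacian_add_mul_rpow (F := φ) (by simpa using hφ)
    simp only [shiftedProd, Nat.cast_zero, zero_sub]
    rw [show (((Nat.factorial (2 * 0) : ℝ) / (Real.pi * (-4) ^ 0) : ℝ) : ℂ) = (Real.pi : ℂ)⁻¹ by
      simp, ← h]
    refine integral_congr_ae (Eventually.of_forall fun x => ?_)
    push_cast
    ring
  | succ n ih =>
    have h2 : ∀ x, CkAt 2 (shiftedProd (n + 1) φ) x := fun x =>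
      CkAt.shiftedProd (n + 1) ((hφ x).mono (by omega))
    have h := integral_laplacian_sub_mul_rpow h2 (a := (n : ℝ) + 1 / 2)
      (by linarith [Nat.cast_nonneg (α := ℝ) n])
    have e1 : ((n + 1 : ℕ) : ℝ) - 1 / 2 = (n : ℝ) + 1 / 2 := by push_cast; ring
    have e2 : (n : ℝ) + 1 / 2 - 1 = (n : ℝ) - 1 / 2 := by ring
    have e3 : ((n : ℝ) + 1 / 2) * ((n : ℝ) + 1 / 2 + 1) = (((n + 1 : ℕ) : ℝ)) ^ 2 - 1 / 4 := by
      push_cast; ring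
    rw [e2, e3, ih fun x => (hφ x).mono (by omega)] at h
    rw [shiftedProd, e1]
    simp only
    rw [h, ← mul_assoc, ← Complex.ofReal_mul]
    congr 2
    have e4 : 2 * (n + 1) = 2 * n + 1 + 1 := by ring
    rw [e4, Nat.factorial_succ, Nat.factorial_succ]
    have := Real.pi_ne_zero
    have : ((-4 : ℝ)) ^ n ≠ 0 := pow_ne_zero _ (by norm_num)
    rw [pow_succ]
    push_cast
    field_simp
    ring

/-- The surface spline is the fundamental solution of `diffOp m`. -/
theorem integral_diffOp_mul_surfaceSpline {m : ℕ} (hm : 2 ≤ m) {φ : SO3 → ℂ}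
    (hφ : ∀ x, CkAt (2 * m) φ x) (x : SO3) :
    ∫ α, diffOp m φ α * (surfaceSpline m x α : ℂ) ∂haar = φ x := by
  obtain ⟨n, rfl⟩ : ∃ n, m = n + 1 := ⟨m - 1, by omega⟩
  -- Left translation commutes with the operator and moves the point x to the identity.
  have h := integral_shiftedProd_mul_rpow n (φ := fun y => φ (x * y)) fun y =>
    (hφ (x * y)).comp_mul_left
  simp only [shiftedProd_comp_mul_left, mul_one] at h
  rw [← integral_mul_left_eq_self _ x]
  have e : ∀ α, (surfaceSpline (n + 1) x (x * α)) = sinSq α ^ ((n : ℝ) - 1 / 2) := by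
    intro α
    rw [surfaceSpline_eq, mul_inv_rev, mul_assoc, inv_mul_cancel, mul_one, sinSq_inv,
      Real.sqrt_eq_rpow, ← Real.rpow_natCast, ← Real.rpow_mul (sinSq_nonneg _)]
    congr 1
    rw [Nat.cast_sub (by omega)]
    push_cast
    ring
  simp only [diffOp, e, mul_assoc]
  rw [integral_const_mul, h, ← mul_assoc, ← Complex.ofReal_mul]
  have : Real.pi * (-4) ^ (n + 1 - 1) / (Nat.factorial (2 * (n + 1) - 2) : ℝ) *
      ((Nat.factorial (2 * n) : ℝ) / (Real.pi * (-4) ^ n)) = 1 := by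
    have := Real.pi_ne_zero
    have : ((-4 : ℝ)) ^ n ≠ 0 := pow_ne_zero _ (by norm_num)
    have : (Nat.factorial (2 * n) : ℝ) ≠ 0 := by positivity
    simp only [Nat.add_sub_cancel, show 2 * (n + 1) - 2 = 2 * n by omega]
    field_simp
  rw [this]
  simp

/-! ### Zonal polynomials -/

theorem IsCk.add {k : ℕ∞} {f g : SO3 → ℂ} (hf : IsCk k f) (hg : IsCk k g) :
    IsCk k (fun y => f y + g y) := by
  obtain ⟨F, hF, hf⟩ := hf
  obtain ⟨G, hG, hg⟩ := hg
  exact ⟨fun M => F M + G M, hF.add hG, fun x => by simp only [hf, hg]⟩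

theorem IsCk.const_mul {k : ℕ∞} {f : SO3 → ℂ} (c : ℂ) (hf : IsCk k f) :
    IsCk k (fun y => c * f y) := by
  obtain ⟨F, hF, hf⟩ := hf
  exact ⟨fun M => c * F M, contDiff_const.mul hF, fun x => by simp only [hf]⟩

theorem IsCk.sum {ι : Type*} {k : ℕ∞} {f : ι → SO3 → ℂ} (s : Finset ι)
    (hf : ∀ i ∈ s, IsCk k (f i)) : IsCk k (fun y => ∑ i ∈ s, f i y) := by
  classical
  induction s using Finset.induction_on with
  | empty => exact ⟨fun _ => 0, contDiff_const, fun _ => by simp⟩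
  | insert a s ha ih =>
    simp only [Finset.sum_insert ha]
    exact (hf a (Finset.mem_insert_self a s)).add
      (ih fun i hi => hf i (Finset.mem_insert_of_mem hi))

theorem IsCk.sub {k : ℕ∞} {f g : SO3 → ℂ} (hf : IsCk k f) (hg : IsCk k g) :
    IsCk k (fun y => f y - g y) := by
  simpa [sub_eq_add_neg] using hf.add (hg.const_mul (-1))

theorem isCk_sinSq_pow (y : SO3) (n : ℕ) :
    IsCk ⊤ (fun ξ => ((sinSq (y * ξ) ^ n : ℝ) : ℂ)) := by
  refine ⟨fun M => ((((3 - ∑ a, leftMulCLM y M a a) / 4) ^ n : ℝ) : ℂ), ?_, fun x => ?_⟩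
  · refine Complex.ofRealCLM.contDiff.comp (f := fun M : Mat9 =>
      ((3 - ∑ a, leftMulCLM y M a a) / 4) ^ n) ?_
    have h : ContDiff ℝ (⊤ : ℕ∞) fun M : Mat9 => leftMulCLM y M := (leftMulCLM y).contDiff
    have h1 : ∀ a, ContDiff ℝ (⊤ : ℕ∞) fun M : Mat9 => leftMulCLM y M a a := fun a =>
      contDiff_pi.mp (contDiff_pi.mp h a) a
    exact ((contDiff_const.sub (ContDiff.sum fun a _ => h1 a)).div_const _).pow n
  · simp only [sinSq_eq_entries, entries_mul]

theorem laplacian_sinSq_pow (y : SO3) (n : ℕ) (x : SO3) :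
    laplacian (fun ξ => ((sinSq (y * ξ) ^ (n + 1) : ℝ) : ℂ)) x =
      ((n : ℂ) + 1) * ((n : ℂ) + 2) * ((sinSq (y * x) ^ (n + 1) : ℝ) : ℂ) -
        ((n : ℂ) + 1) * ((n : ℂ) + 3 / 2) * ((sinSq (y * x) ^ n : ℝ) : ℂ) := by
  rw [laplacian_comp_mul_left (fun ξ => ((sinSq ξ ^ (n + 1) : ℝ) : ℂ)),
    laplacian_comp_sinSq (G := fun u => u ^ (n + 1))
      (G' := fun u => ((n : ℝ) + 1) * u ^ n) (G'' := fun u => ((n : ℝ) + 1) * (n * u ^ (n - 1)))]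
  · rcases n with _ | k
    · simp
    · simp only [Nat.add_sub_cancel]; push_cast; ring
  · exact Filter.Eventually.of_forall fun u => by simpa using hasDerivAt_pow (n + 1) u
  · exact (hasDerivAt_pow n _).const_mul _

/-- Δ is triangular on the powers of s, with the distinct diagonal entries ℓ(ℓ + 1), hence
diagonalizable there. The decomposition is needed because `polySpace` is spanned by eigenfunctions.
-/
theorem sinSq_pow_eq_sum_eigenfunctions (y : SO3) (n : ℕ) :
    ∃ e : ℕ → SO3 → ℂ, (∀ ℓ, IsCk ⊤ (e ℓ) ∧
      ∀ x, laplacian (e ℓ) x = (ℓ : ℂ) * ((ℓ : ℂ) + 1) * e ℓ x) ∧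
      ∀ x, ((sinSq (y * x) ^ n : ℝ) : ℂ) = ∑ ℓ ∈ Finset.range (n + 1), e ℓ x := by
  induction n with
  | zero =>
    refine ⟨fun ℓ _ => if ℓ = 0 then 1 else 0, fun ℓ => ⟨⟨fun _ => if ℓ = 0 then 1 else 0,
      contDiff_const, fun _ => rfl⟩, fun x => ?_⟩, fun x => by simp⟩
    rw [laplacian_const]
    by_cases h : ℓ = 0 <;> simp [h]
  | succ n ih =>
    obtain ⟨e, he, hsum⟩ := ih
    -- Chosen so that s^{n+1} - Σ b_ℓ e_ℓ has the eigenvalue (n+1)(n+2): the coefficient of e_ℓ in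
    -- (Δ - (n+1)(n+2)) s^{n+1}, divided by the difference of the eigenvalues.
    set b : ℕ → ℂ := fun ℓ => -(((n : ℂ) + 1) * ((n : ℂ) + 3 / 2)) /
      ((ℓ : ℂ) * ((ℓ : ℂ) + 1) - ((n : ℂ) + 1) * ((n : ℂ) + 2)) with hb
    have hsm : IsCk ⊤ (fun x => ∑ ℓ ∈ Finset.range (n + 1), b ℓ * e ℓ x) :=
      IsCk.sum _ fun ℓ _ => (he ℓ).1.const_mul _
    have htop : IsCk ⊤ (fun x => ((sinSq (y * x) ^ (n + 1) : ℝ) : ℂ) -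
        ∑ ℓ ∈ Finset.range (n + 1), b ℓ * e ℓ x) := (isCk_sinSq_pow y (n + 1)).sub hsm
    have htopeig : ∀ x, laplacian (fun x => ((sinSq (y * x) ^ (n + 1) : ℝ) : ℂ) -
        ∑ ℓ ∈ Finset.range (n + 1), b ℓ * e ℓ x) x =
        ((n : ℂ) + 1) * ((n : ℂ) + 2) * (((sinSq (y * x) ^ (n + 1) : ℝ) : ℂ) -
        ∑ ℓ ∈ Finset.range (n + 1), b ℓ * e ℓ x) := by
      intro x
      have h2 : ∀ {f : SO3 → ℂ}, IsCk ⊤ f → CkAt 2 f x := fun h => h.ckAt le_top x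
      have h3 := laplacian_add (h2 (isCk_sinSq_pow y (n + 1))) (h2 (hsm.const_mul (-1)))
      rw [laplacian_const_mul, laplacian_sum _ fun ℓ _ => h2 ((he ℓ).1.const_mul _)] at h3
      simp only [laplacian_const_mul, (he _).2] at h3
      have h4 : ∀ z, ((sinSq (y * z) ^ (n + 1) : ℝ) : ℂ) - ∑ ℓ ∈ Finset.range (n + 1), b ℓ * e ℓ z =
          ((sinSq (y * z) ^ (n + 1) : ℝ) : ℂ) + -1 * ∑ ℓ ∈ Finset.range (n + 1), b ℓ * e ℓ z :=
        fun z => by ring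
      simp only [h4]
      rw [h3, laplacian_sinSq_pow, hsum x]
      suffices h5 : ((n : ℂ) + 1) * ((n : ℂ) + 3 / 2) * ∑ ℓ ∈ Finset.range (n + 1), e ℓ x +
          ∑ ℓ ∈ Finset.range (n + 1), b ℓ * ((ℓ : ℂ) * ((ℓ : ℂ) + 1) * e ℓ x) =
          ((n : ℂ) + 1) * ((n : ℂ) + 2) * ∑ ℓ ∈ Finset.range (n + 1), b ℓ * e ℓ x by
        linear_combination -h5
      rw [Finset.mul_sum, Finset.mul_sum, ← Finset.sum_add_distrib]
      refine Finset.sum_congr rfl fun ℓ hℓ => ?_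
      have hne : (ℓ : ℂ) * ((ℓ : ℂ) + 1) - ((n : ℂ) + 1) * ((n : ℂ) + 2) ≠ 0 := by
        rw [sub_ne_zero]
        have hlt : ℓ * (ℓ + 1) < (n + 1) * (n + 2) := by
          have := Finset.mem_range.mp hℓ
          exact Nat.mul_lt_mul'' this (by omega)
        exact_mod_cast hlt.ne
      rw [hb]
      field_simp
      ring
    refine ⟨fun ℓ => if ℓ = n + 1 then fun x => ((sinSq (y * x) ^ (n + 1) : ℝ) : ℂ) -
        ∑ ℓ ∈ Finset.range (n + 1), b ℓ * e ℓ x else fun x => b ℓ * e ℓ x, fun ℓ => ?_,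
        fun x => ?_⟩
    · beta_reduce
      split_ifs with h
      · refine ⟨htop, fun x => ?_⟩
        rw [htopeig x, h]
        push_cast
        ring
      · refine ⟨(he ℓ).1.const_mul _, fun x => ?_⟩
        rw [laplacian_const_mul, (he ℓ).2]
        ring
    · beta_reduce
      rw [Finset.sum_range_succ, if_pos rfl,
        Finset.sum_congr rfl (g := fun ℓ => b ℓ * e ℓ x) fun ℓ hℓ => by
          rw [if_neg (Finset.mem_range.mp hℓ).ne]]
      ring

theorem sinSq_pow_mem_polySpace (y : SO3) {n L : ℕ} (hn : n ≤ L) :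
    (fun x => ((sinSq (y * x) ^ n : ℝ) : ℂ)) ∈ polySpace L := by
  obtain ⟨e, he, hsum⟩ := sinSq_pow_eq_sum_eigenfunctions y n
  have : (fun x => ((sinSq (y * x) ^ n : ℝ) : ℂ)) = ∑ ℓ ∈ Finset.range (n + 1), e ℓ := by
    ext x; rw [hsum x, Finset.sum_apply]
  rw [this]
  refine Submodule.sum_mem _ fun ℓ hℓ => Submodule.subset_span ⟨ℓ, ?_, (he ℓ).1, (he ℓ).2⟩
  have := Finset.mem_range.mp hℓ
  omega

theorem eval_sinSq_mem_polySpace (y : SO3) (p : Polynomial ℝ) {L : ℕ} (hp : p.natDegree ≤ L) :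
    (fun x => ((p.eval (sinSq (y * x)) : ℝ) : ℂ)) ∈ polySpace L := by
  have : (fun x => ((p.eval (sinSq (y * x)) : ℝ) : ℂ)) =
      ∑ n ∈ Finset.range (p.natDegree + 1),
        (p.coeff n : ℂ) • fun x => ((sinSq (y * x) ^ n : ℝ) : ℂ) := by
    ext x
    rw [Finset.sum_apply, Polynomial.eval_eq_sum_range]
    push_cast
    simp [smul_eq_mul]
  rw [this]
  refine Submodule.sum_mem _ fun n hn => Submodule.smul_mem _ _ (sinSq_pow_mem_polySpace y ?_)
  have := Finset.mem_range.mp hn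
  omega

/-! ### The error kernel -/

/-- Taylor approximation at `1` of the odd power `z ↦ √z ^ n`. -/
theorem exists_taylor_sqrt_pow (n N : ℕ) :
    ∃ (p : Polynomial ℝ) (δ C : ℝ), p.natDegree ≤ N ∧ 0 < δ ∧ δ ≤ 1 ∧ 0 < C ∧
      ∀ z, |z - 1| ≤ δ → |√z ^ n - p.eval z| ≤ C * |z - 1| ^ (N + 1) := by
  have han : AnalyticAt ℝ (fun z : ℝ => √z ^ n) 1 := by
    exact (Real.contDiffAt_sqrt one_ne_zero).analyticAt.pow n
  obtain ⟨s, hs⟩ := han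
  obtain ⟨C, hC, hO⟩ := (hs.isBigO_sub_partialSum_pow (N + 1)).exists_pos
  rw [Asymptotics.IsBigOWith, Metric.eventually_nhds_iff] at hO
  obtain ⟨δ, hδ, h⟩ := hO
  -- Halving δ turns the open ball of convergence into a closed condition; the cap at 1 gives M ≥ 1
  -- in `abs_errorKernel_le`.
  refine ⟨∑ k ∈ Finset.range (N + 1), Polynomial.C (s.coeff k) * (Polynomial.X - 1) ^ k,
    min (δ / 2) 1, C, ?_, by positivity, min_le_right _ _, hC, fun z hz => ?_⟩
  · refine Polynomial.natDegree_sum_le_of_forall_le _ _ fun k hk => ?_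
    refine (Polynomial.natDegree_C_mul_le _ _).trans ?_
    refine (Polynomial.natDegree_pow_le).trans ?_
    have h1 : (Polynomial.X - 1 : Polynomial ℝ).natDegree = 1 := by
      rw [← Polynomial.C_1]; exact Polynomial.natDegree_X_sub_C 1
    rw [h1, mul_one]
    have := Finset.mem_range.mp hk
    omega
  · have hd : dist (z - 1) 0 < δ := by
      rw [dist_zero_right, Real.norm_eq_abs]
      exact lt_of_le_of_lt (hz.trans (min_le_left _ _)) (by linarith)
    have h1 := h hd
    rw [add_sub_cancel, norm_pow, norm_norm, Real.norm_eq_abs, Real.norm_eq_abs] at h1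
    convert h1 using 3
    simp only [FormalMultilinearSeries.partialSum,
      FormalMultilinearSeries.apply_eq_pow_smul_coeff, Polynomial.eval_finsetSum,
      Polynomial.eval_mul, Polynomial.eval_pow, Polynomial.eval_sub, Polynomial.eval_X,
      Polynomial.eval_one, Polynomial.eval_C, smul_eq_mul]
    exact Finset.sum_congr rfl fun k _ => mul_comm _ _

theorem surfaceSpline_eq_chord (m : ℕ) (x α : SO3) :
    surfaceSpline m x α = chord x α ^ (2 * m - 3) := surfaceSpline_eq m x α

theorem surfaceSpline_nonneg (m : ℕ) (x α : SO3) : 0 ≤ surfaceSpline m x α := by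
  rw [surfaceSpline_eq_chord]
  exact pow_nonneg (chord_nonneg _ _) _

/-- The error of the replacement of `k_m(x, α)` by the combination of the `k_m(x, ξ)`. -/
noncomputable def errorKernel (m : ℕ) (Ξ : Finset SO3) (a : Ξ → SO3 → ℝ) (x α : SO3) : ℝ :=
  surfaceSpline m x α - ∑ ξ : Ξ, a ξ α * surfaceSpline m x ξ

/-- Points are null by translation invariance, so a finite, hence discrete, group would have total
mass zero. -/
theorem infinite_SO3 : Infinite SO3 := by
  by_contra h
  rw [not_infinite_iff_finite] at h
  have h1 : haar {x : SO3 | sinSq x ≤ 0} = 0 := haar_sinSq_le_zero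
  have h2 : ∀ x : SO3, haar {x} = 0 := by
    have h0 : haar {(1 : SO3)} = 0 := measure_mono_null (fun x hx => by
      rw [mem_singleton_iff.mp hx]; exact sinSq_one.le) h1
    intro x
    have := measure_preimage_mul haar x⁻¹ {1}
    rw [h0] at this
    refine measure_mono_null (fun y hy => ?_) this
    simp [mem_singleton_iff.mp hy]
  have h3 : haar (univ : Set SO3) = 0 :=
    measure_null_of_locally_null _ fun x _ => ⟨{x}, by
      have : DiscreteTopology SO3 := Finite.instDiscreteTopology
      simp, h2 x⟩
  simp at h3

theorem IsCoeffKernel.sum_eq_one {Ξ : Finset SO3} {a : Ξ → SO3 → ℝ} {ρ : ℝ} {L : ℕ} {K : ℝ}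
    (h : IsCoeffKernel Ξ a ρ L K) (α : SO3) : ∑ ξ, a ξ α = 1 := by
  have h1 := h.precision _ (eval_sinSq_mem_polySpace 1 1 (by simp)) α
  simp only [Polynomial.eval_one, Complex.ofReal_one, mul_one] at h1
  exact_mod_cast h1

/-- At a point α outside the finite set Ξ the coefficients still sum to 1, so some ξ ≠ α carries
weight, and its distance from α is positive and at most ρ. -/
theorem IsCoeffKernel.radius_pos {Ξ : Finset SO3} {a : Ξ → SO3 → ℝ} {ρ : ℝ} {L : ℕ} {K : ℝ}
    (h : IsCoeffKernel Ξ a ρ L K) : 0 < ρ := by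
  have := infinite_SO3
  obtain ⟨α, hα⟩ := Infinite.exists_notMem_finset Ξ
  obtain ⟨ξ, -, hξ⟩ := Finset.exists_ne_zero_of_sum_ne_zero
    (s := Finset.univ) (f := fun ξ => a ξ α) (by rw [h.sum_eq_one α]; exact one_ne_zero)
  have h1 : rotDist α ξ ≤ ρ := not_lt.mp fun hlt => hξ (h.support ξ α hlt)
  have h2 := chord_le_half_rotDist α ξ
  have h3 : 0 < chord α ξ := by
    refine lt_of_le_of_ne (chord_nonneg _ _) fun h0 => hα ?_
    have h4 := chord_sq α ξ
    rw [← h0, zero_pow two_ne_zero, eq_comm, sinSq_eq_zero_iff, inv_mul_eq_one] at h4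
    rw [← h4]
    exact ξ.2
  linarith

/-- The denominator fits both regimes: near the diagonal ρ^{2m-3} = ρ^{2m+1} ρ^{-4}, and away from
it d^{2m-3} (ρ/d)^{2m+1} = ρ^{2m+1} d^{-4}. The bound depends on α⁻¹x alone, which makes it a
convolution kernel. -/
theorem abs_errorKernel_le {m L : ℕ} (hm : 2 ≤ m) (hL : 2 * m ≤ L) (K : ℝ) :
    ∃ C : ℝ, 0 < C ∧ ∀ (Ξ : Finset SO3) (a : Ξ → SO3 → ℝ) (ρ : ℝ), IsCoeffKernel Ξ a ρ L K →
      ∀ x α, |errorKernel m Ξ a x α| ≤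
        C * ρ ^ (2 * m + 1) * (((ρ / 2) ^ 2 + sinSq (α⁻¹ * x)) ^ 2)⁻¹ := by
  obtain ⟨p, δ, C, hp, hδ, hδ1, hC, htaylor⟩ := exists_taylor_sqrt_pow (2 * m - 3) (2 * m)
  -- With this M, d ≥ M r forces 3r/d ≤ δ, the range of the Taylor estimate.
  set M := 3 / δ with hM
  have hM1 : 1 ≤ M := by rw [hM, le_div_iff₀ hδ]; linarith
  -- The sum of the constants of the far and the near regime. The absolute value keeps it positive
  -- at a stage where K ≥ 1 is not yet known.
  refine ⟨|K| * C * 3 ^ (2 * m + 1) * 4 + (1 + |K|) * (M + 1) ^ (2 * m - 3) * (1 + M ^ 2) ^ 2,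
    by positivity, fun Ξ a ρ h x α => ?_⟩
  have hρ := h.radius_pos
  have hK : |K| = K := abs_of_pos (lt_of_lt_of_le one_pos h.one_le)
  have hK0 : 0 ≤ K := zero_le_one.trans h.one_le
  rw [hK]
  -- The chord is at most half the angle, so ξ with nonzero weight lie within chordal distance r of
  -- α.
  set r := ρ / 2 with hr
  have hr0 : 0 < r := by positivity
  set d := chord x α with hd
  have hd0 : 0 ≤ d := chord_nonneg _ _
  rw [← chord_sq, ← hd]
  have hrρ : r ^ (2 * m + 1) ≤ ρ ^ (2 * m + 1) := by
    gcongr; linarith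
  have hclose : ∀ ξ : Ξ, a ξ α ≠ 0 → chord α ξ ≤ r := fun ξ hξ => by
    have h1 : rotDist α ξ ≤ ρ := not_lt.mp fun hlt => hξ (h.support ξ α hlt)
    have h2 := chord_le_half_rotDist α ξ
    linarith
  have hden : 0 < (r ^ 2 + d ^ 2) ^ 2 := by positivity
  rcases lt_or_ge d (M * r) with hnear | hfar
  · have h1 : |errorKernel m Ξ a x α| ≤ (1 + K) * ((M + 1) * r) ^ (2 * m - 3) := by
      have hA : |surfaceSpline m x α| ≤ ((M + 1) * r) ^ (2 * m - 3) := by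
        rw [abs_of_nonneg (surfaceSpline_nonneg _ _ _), surfaceSpline_eq_chord]
        gcongr
        nlinarith
      have hB : |∑ ξ : Ξ, a ξ α * surfaceSpline m x ξ| ≤ K * ((M + 1) * r) ^ (2 * m - 3) := by
        refine (Finset.abs_sum_le_sum_abs _ _).trans ?_
        refine le_trans ?_ (mul_le_mul_of_nonneg_right (h.stability α) (by positivity))
        rw [Finset.sum_mul]
        refine Finset.sum_le_sum fun ξ _ => ?_
        rw [abs_mul]
        by_cases hξ : a ξ α = 0
        · simp [hξ]
        · refine mul_le_mul_of_nonneg_left ?_ (abs_nonneg _)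
          rw [abs_of_nonneg (surfaceSpline_nonneg _ _ _), surfaceSpline_eq_chord]
          refine pow_le_pow_left₀ (chord_nonneg _ _) ?_ _
          have := chord_triangle x α ξ
          have := hclose ξ hξ
          nlinarith
      calc _ ≤ |surfaceSpline m x α| + |∑ ξ : Ξ, a ξ α * surfaceSpline m x ξ| := abs_sub _ _
        _ ≤ _ := by linarith
    have h2 : (r ^ 2 + d ^ 2) ^ 2 ≤ (1 + M ^ 2) ^ 2 * r ^ 4 := by
      have : d ^ 2 ≤ (M * r) ^ 2 := by gcongr
      calc (r ^ 2 + d ^ 2) ^ 2 ≤ (r ^ 2 + (M * r) ^ 2) ^ 2 := by gcongr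
        _ = _ := by ring
    rw [← div_eq_mul_inv, le_div_iff₀ hden]
    calc _ ≤ ((1 + K) * ((M + 1) * r) ^ (2 * m - 3)) * ((1 + M ^ 2) ^ 2 * r ^ 4) := by gcongr
      _ = (1 + K) * (M + 1) ^ (2 * m - 3) * (1 + M ^ 2) ^ 2 * r ^ (2 * m - 3 + 4) := by
        rw [mul_pow, pow_add]; ring
      _ = (1 + K) * (M + 1) ^ (2 * m - 3) * (1 + M ^ 2) ^ 2 * r ^ (2 * m + 1) := by
        congr 2; omega
      _ ≤ _ := by
        gcongr
        have : 0 ≤ K * C * 3 ^ (2 * m + 1) * 4 := by positivity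
        linarith
  · have hdpos : 0 < d := lt_of_lt_of_le (by positivity) hfar
    have hrd : r ≤ d := by nlinarith
    -- Normalized to be 1 at α, so that one Taylor expansion at 1 serves for all x and α.
    set z : SO3 → ℝ := fun y => sinSq (x⁻¹ * y) / d ^ 2 with hz
    have hzc : ∀ y, surfaceSpline m x y = d ^ (2 * m - 3) * √(z y) ^ (2 * m - 3) := by
      intro y
      rw [surfaceSpline_eq_chord, ← mul_pow, hz]
      simp only
      rw [Real.sqrt_div' _ (sq_nonneg d), Real.sqrt_sq hdpos.le, mul_div_cancel₀ _ hdpos.ne',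
        chord_comm]
      rfl
    have hzα : z α = 1 := by
      rw [hz]; simp only
      rw [← chord_sq α x, chord_comm, ← hd, div_self (by positivity)]
    -- p(z) is a polynomial of degree at most 2m ≤ L in the zonal function s(x⁻¹ ·) and is therefore
    -- reproduced; p(1) = 1 because the Taylor error vanishes at 1.
    have hpoly : ∑ ξ : Ξ, a ξ α * p.eval (z ξ) = 1 := by
      have hp1 : p.eval 1 = 1 := by
        have := htaylor 1 (by simpa using hδ.le)
        simp at this
        linarith
      have h1 := h.precision _ (eval_sinSq_mem_polySpace x⁻¹
        (p.comp (Polynomial.C (d ^ 2)⁻¹ * Polynomial.X)) (L := L) ?_) α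
      · simp only [Polynomial.eval_comp, Polynomial.eval_mul, Polynomial.eval_C,
          Polynomial.eval_X] at h1
        have e : ∀ y, (d ^ 2)⁻¹ * sinSq (x⁻¹ * y) = z y := fun y => by
          rw [hz]; simp only; rw [div_eq_inv_mul]
        simp only [e, hzα, hp1] at h1
        exact_mod_cast h1
      · refine (Polynomial.natDegree_comp_le).trans ?_
        have := Polynomial.natDegree_C_mul_le (d ^ 2)⁻¹ (Polynomial.X : Polynomial ℝ)
        rw [Polynomial.natDegree_X] at this
        calc _ ≤ p.natDegree * 1 := Nat.mul_le_mul_left _ this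
          _ ≤ L := by omega
    have hE : errorKernel m Ξ a x α =
        d ^ (2 * m - 3) * ∑ ξ : Ξ, a ξ α * (p.eval (z ξ) - √(z ξ) ^ (2 * m - 3)) := by
      simp only [mul_sub, Finset.sum_sub_distrib, hpoly]
      rw [errorKernel, hzc α, hzα, Real.sqrt_one, one_pow, mul_one, Finset.mul_sum]
      congr 1
      exact Finset.sum_congr rfl fun ξ _ => by rw [hzc ξ]; ring
    have hterm : ∀ ξ : Ξ, |a ξ α * (p.eval (z ξ) - √(z ξ) ^ (2 * m - 3))| ≤
        |a ξ α| * (C * (3 * r / d) ^ (2 * m + 1)) := by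
      intro ξ
      rw [abs_mul]
      by_cases hξ : a ξ α = 0
      · simp [hξ]
      refine mul_le_mul_of_nonneg_left ?_ (abs_nonneg _)
      have hc := hclose ξ hξ
      have h1 := chord_triangle x α ξ
      have h2 := chord_triangle x ξ α
      rw [chord_comm ξ α] at h2
      have h0 := chord_nonneg x ξ
      have hzv : z ξ - 1 = (chord x ξ - d) * (chord x ξ + d) / d ^ 2 := by
        rw [hz]; simp only
        rw [← chord_sq ξ x, chord_comm]
        field_simp
        ring
      -- With c the chord from x to ξ, |c - d| ≤ r and c ≤ d + r ≤ 2d, so the product |c - d|(c + d)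
      -- is at most 3rd.
      have hzb : |z ξ - 1| ≤ 3 * r / d := by
        rw [hzv, abs_div, abs_mul, abs_of_pos (by positivity : 0 < d ^ 2),
          abs_of_nonneg (by positivity : 0 ≤ chord x ξ + d), div_le_div_iff₀ (by positivity) hdpos]
        have h3 : |chord x ξ - d| ≤ r := by rw [abs_le]; constructor <;> linarith
        have h4 : chord x ξ + d ≤ 3 * d := by linarith
        calc _ ≤ r * (3 * d) * d := by gcongr
          _ = _ := by ring
      have hδz : |z ξ - 1| ≤ δ := by
        refine hzb.trans ?_
        rw [div_le_iff₀ hdpos]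
        rw [hM] at hfar
        have := mul_le_mul_of_nonneg_left hfar hδ.le
        calc 3 * r = δ * (3 / δ * r) := by field_simp
          _ ≤ δ * d := this
      rw [abs_sub_comm]
      refine (htaylor _ hδz).trans ?_
      gcongr
    have h1 : |errorKernel m Ξ a x α| ≤ d ^ (2 * m - 3) * (K * (C * (3 * r / d) ^ (2 * m + 1))) := by
      rw [hE, abs_mul, abs_of_pos (by positivity : 0 < d ^ (2 * m - 3))]
      refine mul_le_mul_of_nonneg_left ?_ (by positivity)
      refine (Finset.abs_sum_le_sum_abs _ _).trans ((Finset.sum_le_sum fun ξ _ => hterm ξ).trans ?_)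
      rw [← Finset.sum_mul]
      exact mul_le_mul_of_nonneg_right (h.stability α) (by positivity)
    have h2 : (r ^ 2 + d ^ 2) ^ 2 ≤ 4 * d ^ 4 := by
      have : r ^ 2 ≤ d ^ 2 := by gcongr
      calc (r ^ 2 + d ^ 2) ^ 2 ≤ (d ^ 2 + d ^ 2) ^ 2 := by gcongr
        _ = _ := by ring
    rw [← div_eq_mul_inv, le_div_iff₀ hden]
    calc _ ≤ d ^ (2 * m - 3) * (K * (C * (3 * r / d) ^ (2 * m + 1))) * (4 * d ^ 4) := by gcongr
      _ = K * C * 3 ^ (2 * m + 1) * 4 * r ^ (2 * m + 1) *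
          (d ^ (2 * m - 3 + 4) / d ^ (2 * m + 1)) := by
        rw [div_pow, mul_pow, pow_add]; ring
      _ = K * C * 3 ^ (2 * m + 1) * 4 * r ^ (2 * m + 1) := by
        rw [show 2 * m - 3 + 4 = 2 * m + 1 by omega, div_self (by positivity), mul_one]
      _ ≤ _ := by
        gcongr
        have : 0 ≤ (1 + K) * (M + 1) ^ (2 * m - 3) * (1 + M ^ 2) ^ 2 := by positivity
        linarith

/-! ### Young's inequality on the group -/

theorem lintegral_comp_inv_mul {h : SO3 → ℝ≥0∞} (hinv : ∀ x, h x⁻¹ = h x) (x : SO3) :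
    ∫⁻ α, h (α⁻¹ * x) ∂haar = ∫⁻ α, h α ∂haar := by
  rw [← lintegral_mul_left_eq_self h x⁻¹]
  refine lintegral_congr fun α => ?_
  rw [← hinv (x⁻¹ * α), mul_inv_rev, inv_inv]

/-- Young's inequality for the convolution with a symmetric kernel. -/
theorem eLpNorm_le_of_le_convolution {F g : SO3 → ℂ} {h : SO3 → ℝ≥0∞} {p : ℝ≥0∞} (hp1 : 1 ≤ p)
    (hp : p ≠ ⊤) (hg : AEStronglyMeasurable g haar) (hh : Measurable h)
    (hinv : ∀ x, h x⁻¹ = h x)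
    (hF : ∀ᵐ x ∂haar, ‖F x‖ₑ ≤ ∫⁻ α, ‖g α‖ₑ * h (α⁻¹ * x) ∂haar) :
    eLpNorm F p haar ≤ (∫⁻ x, h x ∂haar) * eLpNorm g p haar := by
  set B := ∫⁻ x, h x ∂haar with hB
  have hp0 : p ≠ 0 := (zero_lt_one.trans_le hp1).ne'
  set q := p.toReal with hq
  have hq1 : 1 ≤ q := by
    rw [hq, ← ENNReal.toReal_one]
    exact (ENNReal.toReal_le_toReal ENNReal.one_ne_top hp).mpr hp1
  have hq0 : 0 < q := zero_lt_one.trans_le hq1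
  have hhx : ∀ x, Measurable fun α : SO3 => h (α⁻¹ * x) := fun x =>
    hh.comp (measurable_inv.mul_const x)
  -- Hölder's inequality for the measure ν with density h(α⁻¹x), whose mass B does not depend on x.
  have hpt : ∀ x, (∫⁻ α, ‖g α‖ₑ * h (α⁻¹ * x) ∂haar) ^ q ≤
      (∫⁻ α, h (α⁻¹ * x) * ‖g α‖ₑ ^ q ∂haar) * B ^ (q - 1) := by
    intro x
    set ν := haar.withDensity fun α => h (α⁻¹ * x) with hν
    have hν1 : ν univ = B := by
      rw [hν, withDensity_apply _ MeasurableSet.univ, Measure.restrict_univ,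
        lintegral_comp_inv_mul hinv]
    have h1 := eLpNorm_le_eLpNorm_mul_rpow_measure_univ hp1
      (hg.mono_ac (withDensity_absolutelyContinuous haar fun α => h (α⁻¹ * x)))
    rw [eLpNorm_one_eq_lintegral_enorm, eLpNorm_eq_lintegral_rpow_enorm_toReal hp0 hp, ← hν, hν1,
      ENNReal.toReal_one, ← hq] at h1
    have e1 : ∫⁻ α, ‖g α‖ₑ ∂ν = ∫⁻ α, ‖g α‖ₑ * h (α⁻¹ * x) ∂haar := by
      rw [hν, lintegral_withDensity_eq_lintegral_mul₀ (hhx x).aemeasurable hg.enorm]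
      simp only [Pi.mul_apply, mul_comm]
    have e2 : ∫⁻ α, ‖g α‖ₑ ^ q ∂ν = ∫⁻ α, h (α⁻¹ * x) * ‖g α‖ₑ ^ q ∂haar := by
      rw [hν, lintegral_withDensity_eq_lintegral_mul₀ (hhx x).aemeasurable (hg.enorm.pow_const q)]
      rfl
    rw [e1, e2] at h1
    calc _ ≤ _ := ENNReal.rpow_le_rpow h1 hq0.le
      _ = _ := by
        rw [ENNReal.mul_rpow_of_nonneg _ _ hq0.le, ← ENNReal.rpow_mul, ← ENNReal.rpow_mul]
        congr 2
        · rw [one_div, inv_mul_cancel₀ hq0.ne', ENNReal.rpow_one]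
        · field_simp
  rw [eLpNorm_eq_lintegral_rpow_enorm_toReal hp0 hp, eLpNorm_eq_lintegral_rpow_enorm_toReal hp0 hp,
    ← hq]
  have hswap : ∫⁻ x, ∫⁻ α, h (α⁻¹ * x) * ‖g α‖ₑ ^ q ∂haar ∂haar = B * ∫⁻ α, ‖g α‖ₑ ^ q ∂haar := by
    rw [lintegral_lintegral_swap]
    · have : ∀ α, ∫⁻ x, h (α⁻¹ * x) * ‖g α‖ₑ ^ q ∂haar = B * ‖g α‖ₑ ^ q := fun α => by
        rw [lintegral_mul_const _ (f := fun x => h (α⁻¹ * x)) (hh.comp (measurable_const_mul _)),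
          lintegral_mul_left_eq_self h]
      simp only [this]
      rw [lintegral_const_mul'' _ (hg.enorm.pow_const q)]
    · refine AEMeasurable.mul ?_ ?_
      · exact (hh.comp ((measurable_inv.comp measurable_snd).mul measurable_fst)).aemeasurable
      · exact (hg.comp_snd.enorm).pow_const q
  have hmain : ∫⁻ x, ‖F x‖ₑ ^ q ∂haar ≤ B ^ q * ∫⁻ α, ‖g α‖ₑ ^ q ∂haar := by
    calc ∫⁻ x, ‖F x‖ₑ ^ q ∂haar
        ≤ ∫⁻ x, (∫⁻ α, h (α⁻¹ * x) * ‖g α‖ₑ ^ q ∂haar) * B ^ (q - 1) ∂haar := by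
          refine lintegral_mono_ae ?_
          filter_upwards [hF] with x hx
          exact (ENNReal.rpow_le_rpow hx hq0.le).trans (hpt x)
      _ = B * (∫⁻ α, ‖g α‖ₑ ^ q ∂haar) * B ^ (q - 1) := by
          rw [lintegral_mul_const'', hswap]
          refine AEMeasurable.lintegral_prod_right' (f := fun z : SO3 × SO3 =>
            h (z.2⁻¹ * z.1) * ‖g z.2‖ₑ ^ q) ?_
          refine AEMeasurable.mul ?_ ?_
          · exact (hh.comp ((measurable_inv.comp measurable_snd).mul measurable_fst)).aemeasurable
          · exact (hg.comp_snd.enorm).pow_const q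
      _ = B ^ q * ∫⁻ α, ‖g α‖ₑ ^ q ∂haar := by
          rw [mul_right_comm]
          congr 1
          nth_rewrite 1 [← ENNReal.rpow_one B]
          rw [← ENNReal.rpow_add_of_nonneg _ _ zero_le_one (by linarith)]
          congr 1
          ring
  calc _ ≤ (B ^ q * ∫⁻ α, ‖g α‖ₑ ^ q ∂haar) ^ (1 / q) :=
        ENNReal.rpow_le_rpow hmain (by positivity)
    _ = _ := by
      rw [ENNReal.mul_rpow_of_nonneg _ _ (by positivity), ← ENNReal.rpow_mul, mul_one_div,
        div_self hq0.ne', ENNReal.rpow_one]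

/-! ### Weak and strong forms of L_m -/

theorem measurableEmbedding_entries : MeasurableEmbedding entries := by
  have h : Topology.IsClosedEmbedding entries :=
    continuous_entries.isClosedEmbedding injective_entries
  exact h.measurableEmbedding

/-- An integrable function on `SO(3)` is determined by its integrals against smooth functions. -/
theorem ae_eq_zero_of_forall_integral_mul {g : SO3 → ℂ} (hg : Integrable g haar)
    (h : ∀ φ : SO3 → ℂ, IsCk ⊤ φ → ∫ x, g x * φ x ∂haar = 0) : g =ᵐ[haar] 0 := by
  -- The question is moved to the ambient space: g, extended by zero, is tested against smooth
  -- functions there with respect to the image of the Haar measure.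
  have hext : Function.extend entries g 0 ∘ entries = g :=
    funext fun x => injective_entries.extend_apply g 0 x
  have hint : Integrable (Function.extend entries g 0) (haar.map entries) := by
    rw [measurableEmbedding_entries.integrable_map_iff, hext]
    exact hg
  have h0 := ae_eq_zero_of_integral_contDiff_smul_eq_zero hint.locallyIntegrable
    fun φ hφ _ => by
      rw [measurableEmbedding_entries.integral_map]
      have h1 := h (fun x => (φ (entries x) : ℂ))
        ⟨fun M => (φ M : ℂ), Complex.ofRealCLM.contDiff.comp hφ, fun _ => rfl⟩
      rw [← h1]
      refine integral_congr_ae (Eventually.of_forall fun x => ?_)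
      simp only [injective_entries.extend_apply, Complex.real_smul, mul_comm]
  rw [measurableEmbedding_entries.ae_map_iff] at h0
  filter_upwards [h0] with x hx
  rwa [injective_entries.extend_apply] at hx

theorem ae_eq_of_isWeakDiffOp {m : ℕ} {f g g' : SO3 → ℂ} (hg : Integrable g haar)
    (hg' : Integrable g' haar) (h : IsWeakDiffOp m f g) (h' : IsWeakDiffOp m f g') :
    g =ᵐ[haar] g' := by
  have h0 := ae_eq_zero_of_forall_integral_mul (hg.sub hg') fun φ hφ => by
    have hφc : Continuous φ := continuous_of_ckAt (n := 0) fun x => hφ.ckAt le_top x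
    obtain ⟨C, hC⟩ := isCompact_univ.exists_bound_of_continuousOn hφc.continuousOn
    have hb : ∀ᵐ x ∂haar, ‖φ x‖ ≤ C := Eventually.of_forall fun x => hC x (mem_univ x)
    simp only [Pi.sub_apply, sub_mul]
    rw [integral_sub (hg.mul_bdd hφc.aestronglyMeasurable hb)
      (hg'.mul_bdd hφc.aestronglyMeasurable hb), ← h φ hφ, ← h' φ hφ, sub_self]
  filter_upwards [h0] with x hx
  exact sub_eq_zero.mp hx

/-- `g = L_m f` in the strong sense: the closure in `L_1` of the operator on `C^{2m}`. -/
structure IsStrongDiffOp (m : ℕ) (f g : SO3 → ℂ) : Prop where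
  integrable_left : Integrable f haar
  integrable_right : Integrable g haar
  exists_seq : ∃ u : ℕ → SO3 → ℂ, (∀ n x, CkAt (2 * m) (u n) x) ∧
    Tendsto (fun n => ∫⁻ x, ‖u n x - f x‖ₑ ∂haar) atTop (𝓝 0) ∧
    Tendsto (fun n => ∫⁻ x, ‖diffOp m (u n) x - g x‖ₑ ∂haar) atTop (𝓝 0)

theorem CkAt.diffOp {m : ℕ} {f : SO3 → ℂ} {x : SO3} (h : CkAt (2 * m) f x) :
    CkAt 0 (diffOp m f) x :=
  (CkAt.shiftedProd m (h.mono (by omega))).const_mul _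

theorem continuous_diffOp {m : ℕ} {f : SO3 → ℂ} (h : ∀ x, CkAt (2 * m) f x) :
    Continuous (diffOp m f) := continuous_of_ckAt fun x => (h x).diffOp

theorem isStrongDiffOp_diffOp {m : ℕ} {f : SO3 → ℂ} (h : ∀ x, CkAt (2 * m) f x) :
    IsStrongDiffOp m f (diffOp m f) where
  integrable_left := integrable_of_continuous (continuous_of_ckAt h)
  integrable_right := integrable_of_continuous (continuous_diffOp h)
  exists_seq := ⟨fun _ => f, fun _ => h, by simp, by simp⟩

theorem diffOp_sum {ι : Type*} {m : ℕ} {f : ι → SO3 → ℂ} {x : SO3} (s : Finset ι)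
    (hf : ∀ i ∈ s, CkAt (2 * m) (f i) x) :
    diffOp m (fun y => ∑ i ∈ s, f i y) x = ∑ i ∈ s, diffOp m (f i) x := by
  simp only [diffOp, shiftedProd_sum m s hf, Finset.mul_sum]

/-- Needed to assemble f from its localizations ψ_j f. -/
theorem IsStrongDiffOp.sum {ι : Type*} {m : ℕ} {f g : ι → SO3 → ℂ} (s : Finset ι)
    (h : ∀ i ∈ s, IsStrongDiffOp m (f i) (g i)) :
    IsStrongDiffOp m (fun x => ∑ i ∈ s, f i x) (fun x => ∑ i ∈ s, g i x) := by
  have h3 : ∀ i, ∃ u : ℕ → SO3 → ℂ, i ∈ s → (∀ n x, CkAt (2 * m) (u n) x) ∧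
      Tendsto (fun n => ∫⁻ x, ‖u n x - f i x‖ₑ ∂haar) atTop (𝓝 0) ∧
      Tendsto (fun n => ∫⁻ x, ‖diffOp m (u n) x - g i x‖ₑ ∂haar) atTop (𝓝 0) := fun i => by
    by_cases hi : i ∈ s
    · obtain ⟨u, hu⟩ := (h i hi).exists_seq
      exact ⟨u, fun _ => hu⟩
    · exact ⟨fun _ _ => 0, fun h => absurd h hi⟩
  choose u hu using h3
  have hbound : ∀ (v : ℕ → ι → SO3 → ℂ) (w : ι → SO3 → ℂ),
      (∀ n, ∀ i ∈ s, Continuous (v n i)) → (∀ i ∈ s, Integrable (w i) haar) →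
      (∀ i ∈ s, Tendsto (fun n => ∫⁻ x, ‖v n i x - w i x‖ₑ ∂haar) atTop (𝓝 0)) →
      Tendsto (fun n => ∫⁻ x, ‖∑ i ∈ s, v n i x - ∑ i ∈ s, w i x‖ₑ ∂haar) atTop (𝓝 0) := by
    intro v w hv hw ht
    have h0 := tendsto_finsetSum s ht
    rw [Finset.sum_const_zero] at h0
    refine tendsto_of_tendsto_of_tendsto_of_le_of_le tendsto_const_nhds h0 (fun _ => bot_le)
      fun n => ?_
    rw [← lintegral_finsetSum']
    · refine lintegral_mono fun x => ?_
      rw [← Finset.sum_sub_distrib]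
      exact enorm_sum_le _ _
    · exact fun i hi => ((hv n i hi).aestronglyMeasurable.sub (hw i hi).1).enorm
  refine ⟨integrable_finsetSum _ fun i hi => (h i hi).integrable_left,
    integrable_finsetSum _ fun i hi => (h i hi).integrable_right,
    fun n x => ∑ i ∈ s, u i n x, fun n x => CkAt.sum s fun i hi => (hu i hi).1 n x, ?_, ?_⟩
  · exact hbound (fun n i => u i n) f
      (fun n i hi => continuous_of_ckAt ((hu i hi).1 n)) (fun i hi => (h i hi).integrable_left)
      fun i hi => (hu i hi).2.1
  · have e : ∀ n x, diffOp m (fun x => ∑ i ∈ s, u i n x) x = ∑ i ∈ s, diffOp m (u i n) x :=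
      fun n x => diffOp_sum s fun i hi => (hu i hi).1 n x
    simp only [e]
    exact hbound (fun n i => diffOp m (u i n)) g
      (fun n i hi => continuous_diffOp ((hu i hi).1 n)) (fun i hi => (h i hi).integrable_right)
      fun i hi => (hu i hi).2.2

theorem tendsto_integral_mul_of_tendsto_lintegral {u : ℕ → SO3 → ℂ} {f φ : SO3 → ℂ}
    (hu : ∀ n, Continuous (u n)) (hf : Integrable f haar) (hφ : Continuous φ)
    (h : Tendsto (fun n => ∫⁻ x, ‖u n x - f x‖ₑ ∂haar) atTop (𝓝 0)) :
    Tendsto (fun n => ∫ x, u n x * φ x ∂haar) atTop (𝓝 (∫ x, f x * φ x ∂haar)) := by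
  obtain ⟨C, hC⟩ := isCompact_univ.exists_bound_of_continuousOn hφ.continuousOn
  have hb : ∀ᵐ x ∂haar, ‖φ x‖ ≤ C := Eventually.of_forall fun x => hC x (mem_univ x)
  refine tendsto_integral_of_L1 _ (hf.mul_bdd hφ.aestronglyMeasurable hb).1
    (Eventually.of_forall fun n => integrable_of_continuous ((hu n).mul hφ)) ?_
  have h0 := ENNReal.Tendsto.mul_const (b := ENNReal.ofReal C) h (Or.inr ENNReal.ofReal_ne_top)
  rw [zero_mul] at h0
  refine tendsto_of_tendsto_of_tendsto_of_le_of_le tendsto_const_nhds h0 (fun _ => bot_le)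
    fun n => ?_
  rw [← lintegral_mul_const' _ _ ENNReal.ofReal_ne_top]
  refine lintegral_mono fun x => ?_
  rw [← sub_mul, enorm_mul]
  gcongr
  rw [← ofReal_norm]
  exact ENNReal.ofReal_le_ofReal (hC x (mem_univ x))

theorem integral_mul_diffOp (m : ℕ) {f g : SO3 → ℂ} (hf : ∀ x, CkAt (2 * m) f x)
    (hg : ∀ x, CkAt (2 * m) g x) :
    ∫ x, f x * diffOp m g x ∂haar = ∫ x, diffOp m f x * g x ∂haar := by
  simp only [diffOp, mul_assoc, mul_left_comm (f _)]
  rw [integral_const_mul, integral_const_mul, integral_shiftedProd_mul m hf hg]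

/-- Self-adjointness holds for the C^{2m} approximants, and both integrals pass to the L_1 limit
because φ and L_m φ are bounded. -/
theorem IsStrongDiffOp.isWeakDiffOp {m : ℕ} {f g : SO3 → ℂ} (h : IsStrongDiffOp m f g) :
    IsWeakDiffOp m f g := by
  intro φ hφ
  obtain ⟨u, hu, huf, hug⟩ := h.exists_seq
  have hφc : ∀ x, CkAt (2 * m) φ x := fun x => hφ.ckAt le_top x
  have h1 := tendsto_integral_mul_of_tendsto_lintegral (fun n => continuous_of_ckAt (hu n))
    h.integrable_left (continuous_diffOp hφc) huf
  have h2 := tendsto_integral_mul_of_tendsto_lintegral (fun n => continuous_diffOp (hu n))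
    h.integrable_right (continuous_of_ckAt hφc) hug
  refine tendsto_nhds_unique h1 (h2.congr fun n => ?_)
  exact (integral_mul_diffOp m (hu n) hφc).symm

theorem IsStrongDiffOp.weakDiffOp_spec {m : ℕ} {f g : SO3 → ℂ} (h : IsStrongDiffOp m f g) :
    Integrable (weakDiffOp m f) haar ∧ IsWeakDiffOp m f (weakDiffOp m f) := by
  have hex : ∃ g, Integrable g haar ∧ IsWeakDiffOp m f g :=
    ⟨g, h.integrable_right, h.isWeakDiffOp⟩
  rw [weakDiffOp, dif_pos hex]
  exact hex.choose_spec

/-- Removes the choice made in `weakDiffOp`: under the integrals defining the coefficients A_ξ, the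
explicit limit g may be used instead. -/
theorem IsStrongDiffOp.weakDiffOp_ae_eq {m : ℕ} {f g : SO3 → ℂ} (h : IsStrongDiffOp m f g) :
    weakDiffOp m f =ᵐ[haar] g :=
  ae_eq_of_isWeakDiffOp h.weakDiffOp_spec.1 h.integrable_right h.weakDiffOp_spec.2 h.isWeakDiffOp

theorem continuous_surfaceSpline (m : ℕ) :
    Continuous fun z : SO3 × SO3 => surfaceSpline m z.1 z.2 := by
  simp only [surfaceSpline_eq]
  exact ((continuous_sinSq.comp (continuous_snd.inv.mul continuous_fst)).sqrt).pow _

theorem surfaceSpline_le_one (m : ℕ) (x α : SO3) : surfaceSpline m x α ≤ 1 := by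
  rw [surfaceSpline_eq]
  exact pow_le_one₀ (Real.sqrt_nonneg _) (Real.sqrt_le_one.mpr (sinSq_le_one _))

theorem norm_surfaceSpline_le (m : ℕ) (x α : SO3) : ‖(surfaceSpline m x α : ℂ)‖ ≤ 1 := by
  rw [Complex.norm_real, Real.norm_of_nonneg (surfaceSpline_nonneg m x α)]
  exact surfaceSpline_le_one m x α

theorem continuous_surfaceSpline_right (m : ℕ) (x : SO3) :
    Continuous fun α => (surfaceSpline m x α : ℂ) := by
  have h : Continuous fun α => surfaceSpline m x α := by
    simp only [surfaceSpline_eq]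
    exact ((continuous_sinSq.comp (continuous_inv.mul continuous_const)).sqrt).pow _
  exact Complex.continuous_ofReal.comp h

theorem integrable_mul_surfaceSpline (m : ℕ) {g : SO3 → ℂ} (hg : Integrable g haar) (x : SO3) :
    Integrable (fun α => g α * (surfaceSpline m x α : ℂ)) haar :=
  hg.mul_bdd (continuous_surfaceSpline_right m x).aestronglyMeasurable
    (Eventually.of_forall fun α => norm_surfaceSpline_le m x α)

/-- The representation formula holds everywhere for the approximants. Since 0 ≤ k_m ≤ 1, the
integral is controlled by the L_1 distance of the densities, so the formula survives the limit
almost everywhere. -/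
theorem IsStrongDiffOp.ae_eq_integral {m : ℕ} (hm : 2 ≤ m) {f g : SO3 → ℂ}
    (h : IsStrongDiffOp m f g) :
    ∀ᵐ x ∂haar, f x = ∫ α, g α * (surfaceSpline m x α : ℂ) ∂haar := by
  obtain ⟨u, hu, huf, hug⟩ := h.exists_seq
  have hle : ∀ n, ∫⁻ x, ‖f x - ∫ α, g α * (surfaceSpline m x α : ℂ) ∂haar‖ₑ ∂haar ≤
      ∫⁻ x, ‖u n x - f x‖ₑ ∂haar + ∫⁻ x, ‖diffOp m (u n) x - g x‖ₑ ∂haar := by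
    intro n
    have hi : Integrable (diffOp m (u n)) haar := integrable_of_continuous (continuous_diffOp (hu n))
    have hpt : ∀ x, ‖f x - ∫ α, g α * (surfaceSpline m x α : ℂ) ∂haar‖ₑ ≤
        ‖u n x - f x‖ₑ + ∫⁻ α, ‖diffOp m (u n) α - g α‖ₑ ∂haar := by
      intro x
      have e : f x - ∫ α, g α * (surfaceSpline m x α : ℂ) ∂haar = -(u n x - f x) +
          ∫ α, (diffOp m (u n) α - g α) * (surfaceSpline m x α : ℂ) ∂haar := by
        simp only [sub_mul]
        rw [integral_sub (integrable_mul_surfaceSpline m hi x)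
          (integrable_mul_surfaceSpline m h.integrable_right x),
          integral_diffOp_mul_surfaceSpline hm (hu n)]
        ring
      rw [e]
      refine (enorm_add_le _ _).trans ?_
      rw [enorm_neg]
      gcongr
      refine (enorm_integral_le_lintegral_enorm _).trans (lintegral_mono fun α => ?_)
      rw [enorm_mul]
      refine mul_le_of_le_one_right' ?_
      rw [← ofReal_norm]
      exact ENNReal.ofReal_le_one.mpr (norm_surfaceSpline_le m x α)
    refine (lintegral_mono hpt).trans ?_
    rw [lintegral_add_right _ measurable_const, lintegral_const, measure_univ, mul_one]
  have h0 : ∫⁻ x, ‖f x - ∫ α, g α * (surfaceSpline m x α : ℂ) ∂haar‖ₑ ∂haar = 0 := by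
    have ht := huf.add hug
    rw [add_zero] at ht
    exact le_antisymm (ge_of_tendsto' ht hle) bot_le
  rw [lintegral_eq_zero_iff'] at h0
  · filter_upwards [h0] with x hx
    exact sub_eq_zero.mp (enorm_eq_zero.mp hx)
  · refine (h.integrable_left.1.sub ?_).enorm
    refine AEStronglyMeasurable.integral_prod_right' (f := fun z : SO3 × SO3 =>
      g z.2 * (surfaceSpline m z.1 z.2 : ℂ)) ?_
    exact h.integrable_right.1.comp_snd.mul
      (Complex.continuous_ofReal.comp (continuous_surfaceSpline m)).aestronglyMeasurable

/-! ### From the error kernel to the error of the approximant -/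

/-- The coefficients A_ξ are integrals over α, so the finite sum over ξ goes under the integral and
joins the representation of f. -/
theorem sub_approximant_eq {m : ℕ} {f g : SO3 → ℂ} (h : IsStrongDiffOp m f g) {x : SO3}
    (hx : f x = ∫ α, g α * (surfaceSpline m x α : ℂ) ∂haar) {Ξ : Finset SO3} {a : Ξ → SO3 → ℝ}
    {ρ : ℝ} {L : ℕ} {K : ℝ} (ha : IsCoeffKernel Ξ a ρ L K) :
    f x - approximant m Ξ a f x = ∫ α, g α * (errorKernel m Ξ a x α : ℂ) ∂haar := by
  have hint : ∀ ξ, Integrable (fun α => g α * (a ξ α : ℂ)) haar := fun ξ =>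
    h.integrable_right.mul_bdd (c := K)
      (Complex.measurable_ofReal.comp (ha.measurable ξ)).aestronglyMeasurable
      (Eventually.of_forall fun α => by
        rw [Complex.norm_real, Real.norm_eq_abs]
        exact (Finset.single_le_sum (f := fun ξ => |a ξ α|) (fun ξ _ => abs_nonneg _)
          (Finset.mem_univ ξ)).trans (ha.stability α))
  have h1 : approximant m Ξ a f x =
      ∫ α, ∑ ξ : Ξ, g α * (a ξ α : ℂ) * (surfaceSpline m x ξ : ℂ) ∂haar := by
    rw [integral_finsetSum _ fun ξ _ => (hint ξ).mul_const _, approximant]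
    refine Finset.sum_congr rfl fun ξ _ => ?_
    rw [integral_mul_const]
    congr 1
    refine integral_congr_ae ?_
    filter_upwards [h.weakDiffOp_ae_eq] with α hα
    rw [hα]
  rw [h1, hx, ← integral_sub (integrable_mul_surfaceSpline m h.integrable_right x)
    (integrable_finsetSum _ fun ξ _ => (hint ξ).mul_const _)]
  refine integral_congr_ae (Eventually.of_forall fun α => ?_)
  simp only [errorKernel]
  push_cast
  rw [mul_sub, Finset.mul_sum]
  simp only [mul_assoc]

/-- The estimate of the error by the norm of `L_m f`. -/
theorem exists_sub_approximant_le {m L : ℕ} (hm : 2 ≤ m) (hL : 2 * m ≤ L) (K : ℝ) :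
    ∃ C : ℝ, 0 < C ∧ ∀ (Ξ : Finset SO3) (a : Ξ → SO3 → ℝ) (ρ : ℝ), IsCoeffKernel Ξ a ρ L K →
      (∀ p : ℝ≥0∞, 1 ≤ p → p ≠ ⊤ → ∀ f g : SO3 → ℂ, IsStrongDiffOp m f g →
        eLpNorm (fun x => f x - approximant m Ξ a f x) p haar ≤
          ENNReal.ofReal (C * ρ ^ (2 * m)) * eLpNorm g p haar) ∧
      (∀ f : SO3 → ℂ, (∀ x, CkAt (2 * m) f x) → ∀ B : ℝ≥0∞, (∀ x, ‖diffOp m f x‖ₑ ≤ B) →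
        ∀ x, ‖f x - approximant m Ξ a f x‖ₑ ≤ ENNReal.ofReal (C * ρ ^ (2 * m)) * B) := by
  obtain ⟨C, hC, hE⟩ := abs_errorKernel_le hm hL K
  -- The mass of the kernel bound is at most C ρ^{2m+1} · π/(ρ/2) = 2πC ρ^{2m}.
  refine ⟨2 * Real.pi * C, by positivity, fun Ξ a ρ ha => ?_⟩
  have hρ := ha.radius_pos
  set H : SO3 → ℝ := fun y => C * ρ ^ (2 * m + 1) * (((ρ / 2) ^ 2 + sinSq y) ^ 2)⁻¹ with hH
  have hHc : Continuous H := by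
    refine continuous_const.mul (Continuous.inv₀ ((continuous_const.add continuous_sinSq).pow 2)
      fun y => ?_)
    have := sinSq_nonneg y
    positivity
  have hH0 : ∀ y, 0 ≤ H y := fun y => by
    have := sinSq_nonneg y
    positivity
  have hHint : ∫⁻ y, ENNReal.ofReal (H y) ∂haar ≤
      ENNReal.ofReal (2 * Real.pi * C * ρ ^ (2 * m)) := by
    rw [← ofReal_integral_eq_lintegral_ofReal (integrable_of_continuous hHc)
      (Eventually.of_forall hH0)]
    refine ENNReal.ofReal_le_ofReal ?_
    rw [hH, integral_const_mul]
    have := integral_inv_sq_add_sinSq_le (half_pos hρ)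
    calc _ ≤ C * ρ ^ (2 * m + 1) * (Real.pi / (ρ / 2)) := by gcongr
      _ = _ := by rw [pow_succ]; field_simp
  have hinv : ∀ y, ENNReal.ofReal (H y⁻¹) = ENNReal.ofReal (H y) := fun y => by
    simp only [hH, sinSq_inv]
  have hbound : ∀ (g : SO3 → ℂ) x, ‖∫ α, g α * (errorKernel m Ξ a x α : ℂ) ∂haar‖ₑ ≤
      ∫⁻ α, ‖g α‖ₑ * ENNReal.ofReal (H (α⁻¹ * x)) ∂haar := by
    intro g x
    refine (enorm_integral_le_lintegral_enorm _).trans (lintegral_mono fun α => ?_)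
    rw [enorm_mul]
    gcongr
    rw [← ofReal_norm, Complex.norm_real, Real.norm_eq_abs]
    exact ENNReal.ofReal_le_ofReal (hE Ξ a ρ ha x α)
  refine ⟨fun p hp1 hp f g h => ?_, fun f hf B hB x => ?_⟩
  · refine (eLpNorm_le_of_le_convolution (h := fun y => ENNReal.ofReal (H y)) hp1 hp
      h.integrable_right.1 hHc.measurable.ennreal_ofReal hinv ?_).trans ?_
    · filter_upwards [h.ae_eq_integral hm] with x hx
      rw [sub_approximant_eq h hx ha]
      exact hbound g x
    · gcongr
  · rw [sub_approximant_eq (isStrongDiffOp_diffOp hf)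
      (integral_diffOp_mul_surfaceSpline hm hf x).symm ha]
    refine (hbound _ x).trans ?_
    calc _ ≤ ∫⁻ α, B * ENNReal.ofReal (H (α⁻¹ * x)) ∂haar := by
          refine lintegral_mono fun α => ?_
          gcongr
          exact hB α
      _ = B * ∫⁻ y, ENNReal.ofReal (H y) ∂haar := by
          have hm : Measurable fun α => ENNReal.ofReal (H (α⁻¹ * x)) :=
            hHc.measurable.ennreal_ofReal.comp (measurable_inv.mul_const x)
          rw [lintegral_const_mul _ hm,
            lintegral_comp_inv_mul (h := fun y => ENNReal.ofReal (H y)) hinv]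
      _ ≤ _ := by
          rw [mul_comm]
          gcongr

/-! ### Differential operators on open subsets of `ℝ³` -/

theorem contDiffOn_pd {O : Set E3} (hO : IsOpen O) {n : ℕ} {u : E3 → ℂ}
    (hu : ContDiffOn ℝ (n + 1 : ℕ) u O) (i : Fin 3) : ContDiffOn ℝ n (pd i u) O :=
  (hu.fderiv_of_isOpen hO (m := n) (by norm_cast)).clm_apply contDiffOn_const

theorem contDiffOn_pd_infty {O : Set E3} (hO : IsOpen O) {u : E3 → ℂ}
    (hu : ContDiffOn ℝ ∞ u O) (i : Fin 3) : ContDiffOn ℝ ∞ (pd i u) O :=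
  (hu.fderiv_of_isOpen hO (m := ∞) (by simp)).clm_apply contDiffOn_const

theorem eqOn_pd {O : Set E3} (hO : IsOpen O) {u v : E3 → ℂ} (h : EqOn u v O) (i : Fin 3) :
    EqOn (pd i u) (pd i v) O := fun y hy => by
  have : u =ᶠ[𝓝 y] v := h.eventuallyEq_of_mem (hO.mem_nhds hy)
  simp only [pd, this.fderiv_eq]

theorem eqOn_pd_iterate {O : Set E3} (hO : IsOpen O) {u v : E3 → ℂ} (h : EqOn u v O) (i : Fin 3)
    (n : ℕ) : EqOn ((pd i)^[n] u) ((pd i)^[n] v) O := by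
  induction n with
  | zero => exact h
  | succ n ih =>
    simp only [Function.iterate_succ_apply']
    exact eqOn_pd hO ih i

theorem contDiffOn_pd_iterate {O : Set E3} (hO : IsOpen O) {n k : ℕ} {u : E3 → ℂ}
    (hu : ContDiffOn ℝ (n + k : ℕ) u O) (i : Fin 3) : ContDiffOn ℝ n ((pd i)^[k] u) O := by
  induction k generalizing n with
  | zero => exact hu
  | succ k ih =>
    rw [Function.iterate_succ_apply']
    exact contDiffOn_pd hO (ih (by convert hu using 2; ring)) i

theorem contDiffOn_multiDeriv {O : Set E3} (hO : IsOpen O) {n : ℕ} {β : Fin 3 → ℕ} {u : E3 → ℂ}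
    (hu : ContDiffOn ℝ (n + ∑ i, β i : ℕ) u O) : ContDiffOn ℝ n (multiDeriv β u) O := by
  rw [Fin.sum_univ_three] at hu
  refine contDiffOn_pd_iterate hO (contDiffOn_pd_iterate hO (contDiffOn_pd_iterate hO ?_ 2) 1) 0
  convert hu using 2
  ring

theorem pd_comm {O : Set E3} (hO : IsOpen O) {u : E3 → ℂ} (hu : ContDiffOn ℝ 2 u O)
    (i j : Fin 3) : EqOn (pd i (pd j u)) (pd j (pd i u)) O := fun y hy => by
  have hat : ContDiffAt ℝ 2 u y := hu.contDiffAt (hO.mem_nhds hy)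
  have hd : DifferentiableAt ℝ (fderiv ℝ u) y :=
    (hat.fderiv_right (m := 1) (by norm_num)).differentiableAt one_ne_zero
  have hs := hat.isSymmSndFDerivAt (by simp)
  have e : ∀ i j, pd i (pd j u) y =
      fderiv ℝ (fderiv ℝ u) y (EuclideanSpace.single i 1) (EuclideanSpace.single j 1) := by
    intro i j
    change fderiv ℝ (fun z => fderiv ℝ u z (EuclideanSpace.single j 1)) y _ = _
    rw [fderiv_clm_apply hd (differentiableAt_const _)]
    simp
  rw [e, e]
  exact hs _ _

theorem pd_iterate_comm {O : Set E3} (hO : IsOpen O) {n : ℕ} {u : E3 → ℂ}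
    (hu : ContDiffOn ℝ (n + 1 : ℕ) u O) (l i : Fin 3) :
    EqOn (pd l ((pd i)^[n] u)) ((pd i)^[n] (pd l u)) O := by
  induction n with
  | zero => exact fun _ _ => rfl
  | succ n ih =>
    simp only [Function.iterate_succ_apply']
    have h2 : ContDiffOn ℝ 2 ((pd i)^[n] u) O :=
      contDiffOn_pd_iterate (n := 2) hO (by convert hu using 2; ring) i
    exact (pd_comm hO h2 l i).trans
      (eqOn_pd hO (ih (hu.of_le (by norm_cast; omega))) i)

/-- `multiDeriv` applies the partial derivatives in a fixed order, so ∂_l is carried past the outer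
ones by the symmetry of second derivatives. -/
theorem pd_multiDeriv {O : Set E3} (hO : IsOpen O) {β : Fin 3 → ℕ} {u : E3 → ℂ}
    (hu : ContDiffOn ℝ (∑ i, β i + 1 : ℕ) u O) (l : Fin 3) :
    EqOn (pd l (multiDeriv β u)) (multiDeriv (β + Pi.single l 1) u) O := by
  rw [Fin.sum_univ_three] at hu
  have h2 : ∀ k : ℕ, k ≤ β 0 + β 1 → ContDiffOn ℝ (k + 1 : ℕ) ((pd 2)^[β 2] u) O := fun k hk =>
    contDiffOn_pd_iterate hO (hu.of_le (by norm_cast; omega)) 2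
  have h1 : ContDiffOn ℝ (β 0 + 1 : ℕ) ((pd 1)^[β 1] ((pd 2)^[β 2] u)) O :=
    contDiffOn_pd_iterate hO ((h2 (β 0 + β 1) le_rfl).of_le (by norm_cast; omega)) 1
  fin_cases l
  · intro y _
    simp [multiDeriv, Function.iterate_succ_apply']
  · refine (pd_iterate_comm hO h1 1 0).trans ?_
    simp only [multiDeriv, Fin.mk_one, Pi.add_apply, Pi.single_eq_same,
      Function.iterate_succ_apply']
    simp [EqOn]
  · refine (pd_iterate_comm hO h1 2 0).trans ?_
    refine (eqOn_pd_iterate hO (pd_iterate_comm hO (h2 (β 1) (by omega)) 2 1) 0 _).trans ?_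
    simp [EqOn, multiDeriv, Function.iterate_succ_apply']

theorem mem_multiIndices {k : ℕ} {β : Fin 3 → ℕ} : β ∈ multiIndices k ↔ ∑ i, β i ≤ k := by
  simp only [multiIndices, Finset.mem_filter, Fintype.mem_piFinset, Finset.mem_range,
    and_iff_right_iff_imp]
  intro h i
  exact Nat.lt_succ_of_le ((Finset.single_le_sum (fun j _ => Nat.zero_le (β j))
    (Finset.mem_univ i)).trans h)

/-- `A` acts on `C^k` functions on `O` as a linear differential operator of order at most `k`
with smooth coefficients. -/
def IsDiffOpOn (O : Set E3) (k : ℕ) (A : (E3 → ℂ) → E3 → ℂ) : Prop :=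
  ∃ c : (Fin 3 → ℕ) → E3 → ℂ, (∀ β, ContDiffOn ℝ ∞ (c β) O) ∧
    ∀ u, ContDiffOn ℝ k u O → ∀ y ∈ O, A u y = ∑ β ∈ multiIndices k, c β y * multiDeriv β u y

theorem IsDiffOpOn.congr {O : Set E3} {k : ℕ} {A B : (E3 → ℂ) → E3 → ℂ} (hA : IsDiffOpOn O k A)
    (h : ∀ u, ContDiffOn ℝ k u O → ∀ y ∈ O, B u y = A u y) : IsDiffOpOn O k B := by
  obtain ⟨c, hc, hA⟩ := hA
  exact ⟨c, hc, fun u hu y hy => (h u hu y hy).trans (hA u hu y hy)⟩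

theorem IsDiffOpOn.add {O : Set E3} {k : ℕ} {A B : (E3 → ℂ) → E3 → ℂ} (hA : IsDiffOpOn O k A)
    (hB : IsDiffOpOn O k B) : IsDiffOpOn O k (fun u y => A u y + B u y) := by
  obtain ⟨c, hc, hA⟩ := hA
  obtain ⟨d, hd, hB⟩ := hB
  refine ⟨fun β y => c β y + d β y, fun β => (hc β).add (hd β), fun u hu y hy => ?_⟩
  beta_reduce
  rw [hA u hu y hy, hB u hu y hy, ← Finset.sum_add_distrib]
  exact Finset.sum_congr rfl fun β _ => by ring

theorem IsDiffOpOn.smooth_mul {O : Set E3} {k : ℕ} {A : (E3 → ℂ) → E3 → ℂ}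
    (hA : IsDiffOpOn O k A) {b : E3 → ℂ} (hb : ContDiffOn ℝ ∞ b O) :
    IsDiffOpOn O k (fun u y => b y * A u y) := by
  obtain ⟨c, hc, hA⟩ := hA
  refine ⟨fun β y => b y * c β y, fun β => hb.mul (hc β), fun u hu y hy => ?_⟩
  beta_reduce
  rw [hA u hu y hy, Finset.mul_sum]
  exact Finset.sum_congr rfl fun β _ => by ring

theorem isDiffOpOn_single {O : Set E3} {k : ℕ} {β : Fin 3 → ℕ} (hβ : ∑ i, β i ≤ k) {c : E3 → ℂ}
    (hc : ContDiffOn ℝ ∞ c O) : IsDiffOpOn O k (fun u y => c y * multiDeriv β u y) := by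
  refine ⟨fun γ y => if γ = β then c y else 0, fun γ => ?_, fun u hu y hy => ?_⟩
  · by_cases h : γ = β
    · simpa [h] using hc
    · simpa [h] using contDiffOn_const
  · simp [ite_mul, mem_multiIndices, hβ]

theorem isDiffOpOn_zero (O : Set E3) (k : ℕ) : IsDiffOpOn O k (fun _ _ => 0) :=
  ⟨fun _ _ => 0, fun _ => contDiffOn_const, fun u hu y hy => by simp⟩

theorem IsDiffOpOn.sum {ι : Type*} {O : Set E3} {k : ℕ} {A : ι → (E3 → ℂ) → E3 → ℂ}
    (s : Finset ι) (hA : ∀ i ∈ s, IsDiffOpOn O k (A i)) :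
    IsDiffOpOn O k (fun u y => ∑ i ∈ s, A i u y) := by
  classical
  induction s using Finset.induction_on with
  | empty => simpa using isDiffOpOn_zero O k
  | insert a s ha ih =>
    simp only [Finset.sum_insert ha]
    exact (hA a (Finset.mem_insert_self a s)).add
      (ih fun i hi => hA i (Finset.mem_insert_of_mem hi))

theorem IsDiffOpOn.mono {O : Set E3} {k n : ℕ} {A : (E3 → ℂ) → E3 → ℂ}
    (hA : IsDiffOpOn O k A) (hkn : k ≤ n) : IsDiffOpOn O n A := by
  obtain ⟨c, hc, hA⟩ := hA
  refine (IsDiffOpOn.sum (multiIndices k) fun β hβ =>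
    isDiffOpOn_single (k := n) ((mem_multiIndices.mp hβ).trans hkn) (hc β)).congr
    fun u hu y hy => hA u (hu.of_le (by exact_mod_cast hkn)) y hy

theorem IsDiffOpOn.contDiffOn {O : Set E3} (hO : IsOpen O) {k n : ℕ} {A : (E3 → ℂ) → E3 → ℂ}
    (hA : IsDiffOpOn O k A) {u : E3 → ℂ} (hu : ContDiffOn ℝ (n + k : ℕ) u O) :
    ContDiffOn ℝ n (A u) O := by
  obtain ⟨c, hc, hA⟩ := hA
  refine ContDiffOn.congr (f := fun y => ∑ β ∈ multiIndices k, c β y * multiDeriv β u y) ?_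
    fun y hy => hA u (hu.of_le (by norm_cast; omega)) y hy
  refine ContDiffOn.sum fun β hβ => ?_
  refine ((hc β).of_le (by exact_mod_cast le_top)).mul (contDiffOn_multiDeriv hO (hu.of_le ?_))
  have := mem_multiIndices.mp hβ
  exact_mod_cast Nat.add_le_add_left this n

/-- The Leibniz rule: the new derivative falls on a coefficient or raises a multi-index by one. -/
theorem IsDiffOpOn.pd {O : Set E3} (hO : IsOpen O) {k : ℕ} {A : (E3 → ℂ) → E3 → ℂ}
    (hA : IsDiffOpOn O k A) (l : Fin 3) : IsDiffOpOn O (k + 1) (fun u => pd l (A u)) := by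
  obtain ⟨c, hc, hA⟩ := hA
  have h1 : IsDiffOpOn O (k + 1) (fun u y => ∑ β ∈ multiIndices k,
      (RotationGroup.pd l (c β) y * multiDeriv β u y +
        c β y * multiDeriv (β + Pi.single l 1) u y)) := by
    refine IsDiffOpOn.sum _ fun β hβ => ?_
    have hβ' := mem_multiIndices.mp hβ
    refine (isDiffOpOn_single (by omega) (contDiffOn_pd_infty hO (hc β) l)).add
      (isDiffOpOn_single ?_ (hc β))
    simp only [Pi.add_apply, Finset.sum_add_distrib, Finset.sum_pi_single', Finset.mem_univ,
      if_true]
    omega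
  refine h1.congr fun u hu y hy => ?_
  have hA' : EqOn (A u) (fun y => ∑ β ∈ multiIndices k, c β y * multiDeriv β u y) O :=
    fun y hy => hA u (hu.of_le (by norm_cast; omega)) y hy
  rw [eqOn_pd hO hA' l hy]
  have hdc : ∀ β, DifferentiableAt ℝ (c β) y := fun β =>
    ((hc β).contDiffAt (hO.mem_nhds hy)).differentiableAt (by simp)
  have hdm : ∀ β ∈ multiIndices k, DifferentiableAt ℝ (multiDeriv β u) y := fun β hβ => by
    have h2 : ContDiffOn ℝ (1 : ℕ) (multiDeriv β u) O := contDiffOn_multiDeriv hO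
      (hu.of_le (by have := mem_multiIndices.mp hβ; norm_cast; omega))
    exact (h2.contDiffAt (hO.mem_nhds hy)).differentiableAt (by simp)
  change fderiv ℝ (fun y => ∑ β ∈ multiIndices k, c β y * multiDeriv β u y) y
    (EuclideanSpace.single l 1) = _
  rw [fderiv_fun_sum fun β hβ => (hdc β).fun_mul (hdm β hβ), sum_apply]
  refine Finset.sum_congr rfl fun β hβ => ?_
  rw [fderiv_fun_mul (hdc β) (hdm β hβ)]
  have h3 := pd_multiDeriv hO (β := β) (u := u)
    (hu.of_le (by have := mem_multiIndices.mp hβ; norm_cast; omega)) l hy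
  rw [← h3]
  simp only [RotationGroup.pd, add_apply, smul_apply,
    smul_eq_mul]
  ring

/-! ### The Laplace–Beltrami operator in a chart -/

/-- The derivative along the `i`-th of the vector fields `b`. -/
noncomputable def chartField (b : Fin 3 → E3 → E3) (i : Fin 3) (u : E3 → ℂ) : E3 → ℂ :=
  fun y => ∑ l, ((b i y l : ℝ) : ℂ) * pd l u y

/-- The coordinate representation of `∏ (Δ - r_j)` in terms of the coordinate representations `b`
of the fields `X_i`. -/
noncomputable def chartShiftedProd (b : Fin 3 → E3 → E3) : ℕ → (E3 → ℂ) → E3 → ℂ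
  | 0, u => u
  | n + 1, u => fun y => -∑ i, chartField b i (chartField b i (chartShiftedProd b n u)) y -
      (((n : ℝ) ^ 2 - 1 / 4 : ℝ) : ℂ) * chartShiftedProd b n u y

theorem IsDiffOpOn.chartField {O : Set E3} (hO : IsOpen O) {k : ℕ} {A : (E3 → ℂ) → E3 → ℂ}
    (hA : IsDiffOpOn O k A) {b : Fin 3 → E3 → E3} (hb : ∀ i, ContDiffOn ℝ ∞ (b i) O) (i : Fin 3) :
    IsDiffOpOn O (k + 1) (fun u => chartField b i (A u)) := by
  refine IsDiffOpOn.sum _ fun l _ => (hA.pd hO l).smooth_mul ?_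
  exact Complex.ofRealCLM.contDiff.comp_contDiffOn (contDiffOn_euclidean.mp (hb i) l)

theorem isDiffOpOn_chartShiftedProd {O : Set E3} (hO : IsOpen O) {b : Fin 3 → E3 → E3}
    (hb : ∀ i, ContDiffOn ℝ ∞ (b i) O) (n : ℕ) :
    IsDiffOpOn O (2 * n) (chartShiftedProd b n) := by
  induction n with
  | zero =>
    refine (isDiffOpOn_single (β := 0) (c := fun _ => 1) (by simp) contDiffOn_const).congr
      fun u _ y _ => ?_
    simp [chartShiftedProd, multiDeriv]
  | succ n ih =>
    have h1 := (IsDiffOpOn.sum Finset.univ fun i _ =>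
      (ih.chartField hO hb i).chartField hO hb i).smooth_mul (b := fun _ => -1) contDiffOn_const
    have h2 := (ih.mono (show 2 * n ≤ 2 * n + 1 + 1 by omega)).smooth_mul
      (b := fun _ => -(((n : ℝ) ^ 2 - 1 / 4 : ℝ) : ℂ)) contDiffOn_const
    refine (h1.add h2).congr fun u _ y _ => ?_
    simp only [chartShiftedProd]
    ring

namespace ChartedPartition

variable (P : ChartedPartition) (j : Fin P.N)

theorem isOpen_target : IsOpen (P.h j).target := (P.h j).open_target

/-- The fields `X_i` in the chart `h j`. -/
theorem exists_chart_fields : ∃ b : Fin 3 → E3 → E3,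
    (∀ i, ContDiffOn ℝ ∞ (b i) (P.h j).target) ∧
    (∀ (n : ℕ) (u : E3 → ℂ) (x : SO3), x ∈ (P.h j).source → ContDiffAt ℝ n u (P.h j x) →
      CkAt n (fun y => u (P.h j y)) x) ∧
    ∀ (u : E3 → ℂ) (x : SO3), x ∈ (P.h j).source → DifferentiableAt ℝ u (P.h j x) →
      ∀ i, lieDeriv i (fun y => u (P.h j y)) x = chartField b i u (P.h j x) := by
  obtain ⟨U, F, hU, hF, hUF⟩ := P.h_smooth j
  have hev : ∀ x ∈ (P.h j).source, ∀ᶠ y in 𝓝 x, P.h j y = F (entries y) := fun x hx => by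
    filter_upwards [(P.h j).open_source.mem_nhds hx] with y hy using (hUF y hy).2.symm
  have hFat : ∀ x ∈ (P.h j).source, ContDiffAt ℝ ∞ F (entries x) := fun x hx =>
    hF.contDiffAt (hU.mem_nhds (hUF x hx).1)
  -- The components of X_i in the chart are DF(x)(x E_i), with F a smooth ambient extension of the
  -- chart and x the point with coordinates y.
  refine ⟨fun i y => fderiv ℝ F (entries ((P.h j).symm y))
    (fieldCLM i (entries ((P.h j).symm y))), fun i => ?_, fun n u x hx hu => ?_,
    fun u x hx hu i => ?_⟩
  · have hmaps : MapsTo (fun y => entries ((P.h j).symm y)) (P.h j).target U := fun y hy =>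
      (hUF _ ((P.h j).map_target hy)).1
    have h1 : ContDiffOn ℝ ∞ (fun y => fderiv ℝ F (entries ((P.h j).symm y))) (P.h j).target :=
      (hF.fderiv_of_isOpen hU (m := ∞) (by simp)).comp (P.symm_smooth j) hmaps
    exact h1.clm_apply ((fieldCLM i).contDiff.comp_contDiffOn (P.symm_smooth j))
  · refine ⟨fun M => u (F M), ?_, ?_⟩
    · rw [← (hUF x hx).2] at hu
      exact hu.comp _ ((hFat x hx).of_le (by exact_mod_cast le_top))
    · filter_upwards [hev x hx] with y hy
      rw [hy]
  · have hFd : DifferentiableAt ℝ F (entries x) := (hFat x hx).differentiableAt (by simp)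
    have hxF := (hUF x hx).2
    rw [← hxF] at hu
    have h1 : lieDeriv i (fun y => u (P.h j y)) x = lieDeriv i (fun y => u (F (entries y))) x := by
      refine lieDeriv_congr i ?_
      filter_upwards [hev x hx] with y hy
      rw [hy]
    have h2 := lieDeriv_comp_entries (F := fun M => u (F M)) i (hu.comp _ hFd)
    rw [h1, h2, show (fun M => u (F M)) = u ∘ F from rfl, fderiv_comp _ hu hFd]
    simp only [ContinuousLinearMap.comp_apply, chartField, pd]
    rw [(P.h j).left_inv hx, ← hxF]
    set v := fderiv ℝ F (entries x) (fieldCLM i (entries x)) with hv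
    have hvs : v = ∑ l, v l • EuclideanSpace.single l (1 : ℝ) := by
      have := (EuclideanSpace.basisFun (Fin 3) ℝ).sum_repr v
      simpa using this.symm
    conv_lhs => rw [hvs]
    rw [map_sum]
    exact Finset.sum_congr rfl fun l _ => by rw [map_smul, Complex.real_smul]

/-- `L_m` in a chart. -/
theorem exists_chart_diffOp (m : ℕ) : ∃ c : (Fin 3 → ℕ) → E3 → ℂ,
    (∀ β, ContDiffOn ℝ ∞ (c β) (P.h j).target) ∧
    ∀ u, ContDiffOn ℝ (2 * m : ℕ) u (P.h j).target → ∀ x ∈ (P.h j).source,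
      CkAt (2 * m) (fun y => u (P.h j y)) x ∧
      diffOp m (fun y => u (P.h j y)) x =
        ∑ β ∈ multiIndices (2 * m), c β (P.h j x) * multiDeriv β u (P.h j x) := by
  obtain ⟨b, hb, hck, hlie⟩ := P.exists_chart_fields j
  have hO := P.isOpen_target j
  have hat : ∀ {n : ℕ} {u : E3 → ℂ}, ContDiffOn ℝ n u (P.h j).target → ∀ x ∈ (P.h j).source,
      ContDiffAt ℝ n u (P.h j x) := fun hu x hx =>
    hu.contDiffAt (hO.mem_nhds ((P.h j).map_source hx))
  have hfield : ∀ {n : ℕ} {u : E3 → ℂ}, ContDiffOn ℝ (n + 1 : ℕ) u (P.h j).target → ∀ i,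
      ContDiffOn ℝ n (chartField b i u) (P.h j).target := fun hu i => by
    have hid : IsDiffOpOn (P.h j).target 0 (fun u => u) :=
      isDiffOpOn_chartShiftedProd hO hb 0
    exact (hid.chartField hO hb i).contDiffOn hO hu
  have hlap : ∀ v, ContDiffOn ℝ (2 : ℕ) v (P.h j).target → ∀ x ∈ (P.h j).source,
      laplacian (fun y => v (P.h j y)) x =
        -∑ i, chartField b i (chartField b i v) (P.h j x) := by
    intro v hv x hx
    simp only [laplacian]
    congr 1
    refine Finset.sum_congr rfl fun i _ => ?_
    rw [lieDeriv_congr i (g := fun y => chartField b i v (P.h j y))]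
    · exact hlie _ x hx ((hat (n := 1) (hfield hv i) x hx).differentiableAt (by simp)) i
    · filter_upwards [(P.h j).open_source.mem_nhds hx] with y hy
      exact hlie v y hy ((hat hv y hy).differentiableAt (by simp)) i
  have hsp : ∀ n : ℕ, ∀ u, ContDiffOn ℝ (2 * n : ℕ) u (P.h j).target → ∀ x ∈ (P.h j).source,
      shiftedProd n (fun y => u (P.h j y)) x = chartShiftedProd b n u (P.h j x) := by
    intro n
    induction n with
    | zero => exact fun u _ x _ => rfl
    | succ n ih =>
      intro u hu x hx
      have hu' : ContDiffOn ℝ (2 * n : ℕ) u (P.h j).target := hu.of_le (by norm_cast; omega)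
      have hv : ContDiffOn ℝ (2 : ℕ) (chartShiftedProd b n u) (P.h j).target :=
        (isDiffOpOn_chartShiftedProd hO hb n).contDiffOn hO (hu.of_le (by norm_cast; omega))
      simp only [shiftedProd, chartShiftedProd]
      rw [ih u hu' x hx, laplacian_congr (g := fun y => chartShiftedProd b n u (P.h j y)),
        hlap _ hv x hx]
      filter_upwards [(P.h j).open_source.mem_nhds hx] with y hy using ih u hu' y hy
  obtain ⟨c, hc, hrep⟩ := isDiffOpOn_chartShiftedProd hO hb m
  refine ⟨fun β y => ((Real.pi * (-4) ^ (m - 1) / (Nat.factorial (2 * m - 2) : ℝ) : ℝ) : ℂ) *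
    c β y, fun β => contDiffOn_const.mul (hc β), fun u hu x hx =>
    ⟨hck _ u x hx (hat hu x hx), ?_⟩⟩
  rw [diffOp, hsp m u hu x hx, hrep u hu _ ((P.h j).map_source hx), Finset.mul_sum]
  exact Finset.sum_congr rfl fun β _ => by ring

end ChartedPartition

/-! ### Comparison of the Haar measure with the Lebesgue measure of a chart -/

theorem haar_sinSq_inv_mul_le (x₀ : SO3) {r : ℝ} (hr : 0 ≤ r) :
    haar {x | sinSq (x₀⁻¹ * x) ≤ r ^ 2} ≤ ENNReal.ofReal (4 * Real.pi * r ^ 3) := by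
  have h1 : haar {x | sinSq (x₀⁻¹ * x) ≤ r ^ 2} = haar {x | sinSq x ≤ r ^ 2} :=
    measure_preimage_mul haar x₀⁻¹ {x | sinSq x ≤ r ^ 2}
  rw [h1]
  rcases hr.eq_or_lt with rfl | hr
  · simp [haar_sinSq_le_zero]
  · exact haar_sinSq_le_pow hr

/-- A set of diameter d has Haar measure O(d³), by invariance and the volume of balls, and such a
bound on small sets implies domination by the Hausdorff measure. With it the comparison with
Lebesgue measure needs no Jacobian. -/
theorem haar_map_entries_le :
    ∃ C : NNReal, C ≠ 0 ∧ haar.map entries ≤ C • Measure.hausdorffMeasure (X := Mat9) 3 := by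
  set C : NNReal := ⟨64 * Real.pi, by positivity⟩ with hC
  have hC0 : C ≠ 0 := by
    rw [← NNReal.coe_ne_zero]
    exact (by positivity : (0 : ℝ) < 64 * Real.pi).ne'
  refine ⟨C, hC0, ?_⟩
  have key : C⁻¹ • haar.map entries ≤ Measure.hausdorffMeasure (X := Mat9) 3 := by
    refine Measure.le_hausdorffMeasure 3 _ 1 one_pos fun s hs => ?_
    have hd : Metric.ediam s ≠ ⊤ := (hs.trans_lt ENNReal.one_lt_top).ne
    rw [Measure.smul_apply, measurableEmbedding_entries.map_apply]
    rcases (entries ⁻¹' s).eq_empty_or_nonempty with he | ⟨x₀, hx₀⟩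
    · simp [he]
    set d := (Metric.ediam s).toReal with hdd
    have hd0 : 0 ≤ d := ENNReal.toReal_nonneg
    -- The nine entries differ by at most d each, so 8s ≤ 9d², and the radius 2d is ample. The ball
    -- has measure at most 4π(2d)³ = 32πd³, below 64πd³.
    have hsub : entries ⁻¹' s ⊆ {x | sinSq (x₀⁻¹ * x) ≤ (2 * d) ^ 2} := by
      intro x hx
      have hdist : dist (entries x) (entries x₀) ≤ d := by
        rw [dist_edist]
        exact ENNReal.toReal_mono hd (Metric.edist_le_ediam_of_mem hx hx₀)
      have h8 := sinSq_inv_mul x x₀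
      have hij : ∀ i j, (entries x i j - entries x₀ i j) ^ 2 ≤ d ^ 2 := fun i j => by
        rw [sq_le_sq, abs_of_nonneg hd0, ← Real.dist_eq]
        exact ((dist_le_pi_dist _ _ j).trans (dist_le_pi_dist _ _ i)).trans hdist
      have h9 : ∑ i, ∑ j, (entries x i j - entries x₀ i j) ^ 2 ≤ ∑ _i : Fin 3, ∑ _j : Fin 3, d ^ 2 :=
        Finset.sum_le_sum fun i _ => Finset.sum_le_sum fun j _ => hij i j
      simp only [Finset.sum_const, Finset.card_univ, Fintype.card_fin, nsmul_eq_mul] at h9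
      push_cast at h9
      rw [mem_ofPred_eq]
      nlinarith
    have h1 : haar (entries ⁻¹' s) ≤ (C : ℝ≥0∞) * Metric.ediam s ^ (3 : ℝ) := by
      refine (measure_mono hsub).trans ((haar_sinSq_inv_mul_le x₀ (by positivity)).trans ?_)
      rw [← ENNReal.ofReal_toReal hd, ← hdd, ENNReal.ofReal_rpow_of_nonneg hd0 (by norm_num),
        ← ENNReal.ofReal_coe_nnreal, ← ENNReal.ofReal_mul (by positivity)]
      refine ENNReal.ofReal_le_ofReal ?_
      rw [show d ^ (3 : ℝ) = d ^ 3 by exact_mod_cast Real.rpow_natCast d 3]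
      have hp : 0 ≤ Real.pi * d ^ 3 := by positivity
      change _ ≤ 64 * Real.pi * d ^ 3
      nlinarith
    rw [ENNReal.smul_def, smul_eq_mul, ENNReal.coe_inv hC0]
    calc (C : ℝ≥0∞)⁻¹ * haar (entries ⁻¹' s)
        ≤ (C : ℝ≥0∞)⁻¹ * ((C : ℝ≥0∞) * Metric.ediam s ^ (3 : ℝ)) := by gcongr
      _ = _ := by
        rw [← mul_assoc, ENNReal.inv_mul_cancel (by simpa using hC0) ENNReal.coe_ne_top, one_mul]
  refine Measure.le_iff.mpr fun s hs => ?_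
  have h2 := key s
  rw [Measure.smul_apply, ENNReal.smul_def, smul_eq_mul, ENNReal.coe_inv hC0] at h2
  rw [Measure.smul_apply, ENNReal.smul_def, smul_eq_mul]
  calc (haar.map entries) s = C * ((C : ℝ≥0∞)⁻¹ * (haar.map entries) s) := by
        rw [← mul_assoc, ENNReal.mul_inv_cancel (by simpa using hC0) ENNReal.coe_ne_top, one_mul]
    _ ≤ _ := by gcongr

namespace ChartedPartition

variable (P : ChartedPartition) (j : Fin P.N)

/-- The compact subset of `SO(3)` which the chart `h j` maps onto `K`. -/
theorem isCompact_symm_image {K : Set E3} (hK : IsCompact K) (hKO : K ⊆ (P.h j).target) :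
    IsCompact ((P.h j).symm '' K) :=
  hK.image_of_continuousOn ((P.h j).continuousOn_symm.mono hKO)

theorem symm_image_subset_source {K : Set E3} (hKO : K ⊆ (P.h j).target) :
    (P.h j).symm '' K ⊆ (P.h j).source := by
  rintro _ ⟨y, hy, rfl⟩
  exact (P.h j).map_target (hKO hy)

theorem mem_symm_image_iff {K : Set E3} (hKO : K ⊆ (P.h j).target) {x : SO3}
    (hx : x ∈ (P.h j).source) : x ∈ (P.h j).symm '' K ↔ P.h j x ∈ K := by
  constructor
  · rintro ⟨y, hy, rfl⟩
    rwa [(P.h j).right_inv (hKO hy)]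
  · exact fun h => ⟨_, h, (P.h j).left_inv hx⟩

theorem aemeasurable_chart {K : Set E3} (hK : IsCompact K) (hKO : K ⊆ (P.h j).target) :
    AEMeasurable (P.h j) (haar.restrict ((P.h j).symm '' K)) :=
  ((P.h j).continuousOn.mono (P.symm_image_subset_source j hKO)).aemeasurable
    (P.isCompact_symm_image j hK hKO).measurableSet

/-- Three bounds are chained: Haar measure by three-dimensional Hausdorff measure of matrices, the
latter by that of ℝ³ through the inverse chart, which is Lipschitz on the compact set K, and finally
by Lebesgue measure. -/
theorem exists_map_le {K : Set E3} (hK : IsCompact K) (hKO : K ⊆ (P.h j).target) :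
    ∃ C : NNReal, (haar.restrict ((P.h j).symm '' K)).map (P.h j) ≤ C • volume.restrict K := by
  obtain ⟨C₁, -, hC₁⟩ := haar_map_entries_le
  have hO := P.isOpen_target j
  obtain ⟨C₂, hC₂⟩ : ∃ C₂, LipschitzOnWith C₂ (fun y => entries ((P.h j).symm y)) K := by
    refine LocallyLipschitzOn.exists_lipschitzOnWith_of_compact hK fun y hy => ?_
    have hat : ContDiffAt ℝ 1 (fun y => entries ((P.h j).symm y)) y :=
      ((P.symm_smooth j).contDiffAt (hO.mem_nhds (hKO hy))).of_le (by exact_mod_cast le_top)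
    obtain ⟨c, t, ht, hc⟩ := hat.exists_lipschitzOnWith
    exact ⟨c, t, mem_nhdsWithin_of_mem_nhds ht, hc⟩
  -- Both measures are translation invariant on ℝ³, hence proportional; the factor is not needed.
  obtain ⟨C₃, hC₃⟩ : ∃ C₃ : NNReal,
      (Measure.hausdorffMeasure (X := E3) 3) = C₃ • (volume : Measure E3) := by
    have h : (Measure.hausdorffMeasure (X := E3) ((3 : ℕ) : ℝ)) = _ • (volume : Measure E3) :=
      Measure.isAddLeftInvariant_eq_smul _ _
    exact ⟨_, by exact_mod_cast h⟩
  refine ⟨C₁ * C₂ ^ 3 * C₃, Measure.le_iff.mpr fun s hs => ?_⟩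
  have hS := (P.isCompact_symm_image j hK hKO).measurableSet
  rw [Measure.map_apply_of_aemeasurable (P.aemeasurable_chart j hK hKO) hs,
    Measure.restrict_apply' hS, Measure.smul_apply, Measure.restrict_apply' hK.measurableSet]
  have himg : entries '' ((P.h j) ⁻¹' s ∩ (P.h j).symm '' K) =
      (fun y => entries ((P.h j).symm y)) '' (s ∩ K) := by
    rw [← image_image entries (P.h j).symm]
    refine congrArg (image entries) (Set.ext fun x => ?_)
    constructor
    · rintro ⟨hxs, y, hy, rfl⟩
      rw [mem_preimage, (P.h j).right_inv (hKO hy)] at hxs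
      exact ⟨y, ⟨hxs, hy⟩, rfl⟩
    · rintro ⟨y, ⟨hys, hy⟩, rfl⟩
      refine ⟨?_, y, hy, rfl⟩
      rwa [mem_preimage, (P.h j).right_inv (hKO hy)]
  calc haar ((P.h j) ⁻¹' s ∩ (P.h j).symm '' K)
      = haar.map entries (entries '' ((P.h j) ⁻¹' s ∩ (P.h j).symm '' K)) := by
        rw [measurableEmbedding_entries.map_apply, preimage_image_eq _ injective_entries]
    _ ≤ C₁ * Measure.hausdorffMeasure (X := Mat9) 3
          (entries '' ((P.h j) ⁻¹' s ∩ (P.h j).symm '' K)) := hC₁ _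
    _ ≤ C₁ * ((C₂ : ℝ≥0∞) ^ (3 : ℝ) * Measure.hausdorffMeasure (X := E3) 3 (s ∩ K)) := by
        rw [himg]
        gcongr
        exact (hC₂.mono inter_subset_right).hausdorffMeasure_image_le (by norm_num)
    _ = (C₁ * C₂ ^ 3 * C₃ : NNReal) • volume (s ∩ K) := by
        rw [hC₃, Measure.smul_apply, ENNReal.smul_def, ENNReal.smul_def, smul_eq_mul, smul_eq_mul]
        rw [show ((C₂ : ℝ≥0∞) ^ (3 : ℝ)) = (C₂ : ℝ≥0∞) ^ 3 by exact_mod_cast ENNReal.rpow_natCast (C₂ : ℝ≥0∞) 3]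
        push_cast
        ring

end ChartedPartition

/-! ### Mollification -/

/-- The convolution `u * f` on `ℝ³`. -/
noncomputable def conv (u f : E3 → ℂ) : E3 → ℂ :=
  convolution u f (ContinuousLinearMap.mul ℝ ℂ) volume

theorem conv_apply (u f : E3 → ℂ) (x : E3) : conv u f x = ∫ t, u t * f (x - t) := rfl

theorem conv_apply_swap (u f : E3 → ℂ) (x : E3) : conv u f x = ∫ t, u (x - t) * f t :=
  convolution_eq_swap _

theorem contDiff_conv {u f : E3 → ℂ} (hu : Integrable u) (hf : ContDiff ℝ ∞ f)
    (hc : HasCompactSupport f) : ContDiff ℝ ∞ (conv u f) :=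
  hc.contDiff_convolution_right _ hu.locallyIntegrable hf

theorem contDiff_pd {f : E3 → ℂ} (hf : ContDiff ℝ ∞ f) (i : Fin 3) : ContDiff ℝ ∞ (pd i f) :=
  contDiffOn_univ.mp (contDiffOn_pd_infty isOpen_univ (contDiffOn_univ.mpr hf) i)

theorem tsupport_pd_subset (f : E3 → ℂ) (i : Fin 3) : tsupport (pd i f) ⊆ tsupport f :=
  tsupport_fderiv_apply_subset ℝ _

theorem contDiff_pd_iterate {f : E3 → ℂ} (hf : ContDiff ℝ ∞ f) (i : Fin 3) (n : ℕ) :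
    ContDiff ℝ ∞ ((pd i)^[n] f) := by
  induction n with
  | zero => exact hf
  | succ n ih =>
    rw [Function.iterate_succ_apply']
    exact contDiff_pd ih i

theorem tsupport_pd_iterate_subset (f : E3 → ℂ) (i : Fin 3) (n : ℕ) :
    tsupport ((pd i)^[n] f) ⊆ tsupport f := by
  induction n with
  | zero => exact subset_rfl
  | succ n ih =>
    rw [Function.iterate_succ_apply']
    exact (tsupport_pd_subset _ i).trans ih

theorem pd_conv {u f : E3 → ℂ} (hu : Integrable u) (hf : ContDiff ℝ ∞ f)
    (hc : HasCompactSupport f) (i : Fin 3) : pd i (conv u f) = conv u (pd i f) := by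
  ext x
  have h := hc.hasFDerivAt_convolution_right (ContinuousLinearMap.mul ℝ ℂ)
    hu.locallyIntegrable (hf.of_le (by exact_mod_cast le_top)) x (μ := volume)
  have h2 := convolution_precompR_apply (ContinuousLinearMap.mul ℝ ℂ) hu.locallyIntegrable
    (hc.fderiv ℝ) (hf.continuous_fderiv (by simp)) x (EuclideanSpace.single i (1 : ℝ))
    (μ := volume)
  rw [← h.fderiv] at h2
  exact h2

theorem pd_iterate_conv {u f : E3 → ℂ} (hu : Integrable u) (hf : ContDiff ℝ ∞ f)
    (hc : HasCompactSupport f) (i : Fin 3) (n : ℕ) :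
    (pd i)^[n] (conv u f) = conv u ((pd i)^[n] f) := by
  induction n with
  | zero => rfl
  | succ n ih =>
    rw [Function.iterate_succ_apply', ih, pd_conv hu (contDiff_pd_iterate hf i n)
      (hc.of_isClosed_subset isClosed_closure (tsupport_pd_iterate_subset f i n)),
      Function.iterate_succ_apply']

theorem multiDeriv_conv {u f : E3 → ℂ} (hu : Integrable u) (hf : ContDiff ℝ ∞ f)
    (hc : HasCompactSupport f) (β : Fin 3 → ℕ) :
    multiDeriv β (conv u f) = conv u (multiDeriv β f) := by
  have hc' : ∀ {g : E3 → ℂ}, HasCompactSupport g → ∀ i n, HasCompactSupport ((pd i)^[n] g) :=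
    fun hg i n => hg.of_isClosed_subset isClosed_closure (tsupport_pd_iterate_subset _ i n)
  have hf2 := contDiff_pd_iterate hf 2 (β 2)
  rw [multiDeriv, pd_iterate_conv hu hf hc, pd_iterate_conv hu hf2 (hc' hc _ _),
    pd_iterate_conv hu (contDiff_pd_iterate hf2 1 _) (hc' (hc' hc _ _) _ _), multiDeriv]

theorem pd_iterate_const_mul_comp_sub_left (c : ℂ) (f : E3 → ℂ) (y : E3) (i : Fin 3) (n : ℕ) :
    (pd i)^[n] (fun z => c * f (y - z)) = fun z => (-1) ^ n * c * (pd i)^[n] f (y - z) := by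
  have key : ∀ (c : ℂ) (f : E3 → ℂ), pd i (fun z => c * f (y - z)) =
      fun z => (-1 * c) * pd i f (y - z) := by
    intro c f
    ext z
    have h1 : fderiv ℝ (fun z => c • f (y - z)) z = c • fderiv ℝ (fun z => f (y - z)) z :=
      congrFun (fderiv_const_smul_field (𝕜 := ℝ) (f := fun z => f (y - z)) c) z
    have h2 : fderiv ℝ (fun z => f (y - z)) z = -fderiv ℝ f (y - z) := by
      have h3 : (fun z => f (y - z)) = fun z => (fun w => f ((-1 : ℝ) • w)) (z - y) := by
        ext z
        simp
      rw [h3, fderiv_comp_sub (f := fun w => f ((-1 : ℝ) • w)) y, fderiv_comp_smul]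
      simp
    simp only [smul_eq_mul] at h1
    simp only [pd]
    rw [h1, h2]
    simp
  induction n with
  | zero => simp
  | succ n ih =>
    rw [Function.iterate_succ_apply', ih, key, Function.iterate_succ_apply']
    ext z
    ring

theorem multiDeriv_comp_sub_left (f : E3 → ℂ) (y : E3) (β : Fin 3 → ℕ) :
    multiDeriv β (fun z => f (y - z)) =
      fun z => (-1) ^ (∑ i, β i) * multiDeriv β f (y - z) := by
  have h := pd_iterate_const_mul_comp_sub_left 1 f y 2 (β 2)
  simp only [one_mul, mul_one] at h
  rw [multiDeriv, h, pd_iterate_const_mul_comp_sub_left, pd_iterate_const_mul_comp_sub_left,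
    Fin.sum_univ_three]
  ext z
  rw [multiDeriv]
  ring

theorem lintegral_enorm_conv_le {u f : E3 → ℂ} (hu : Integrable u) (hf : Integrable f) :
    ∫⁻ x, ‖conv u f x‖ₑ ≤ (∫⁻ x, ‖u x‖ₑ) * ∫⁻ x, ‖f x‖ₑ := by
  have hm : AEMeasurable (fun p : E3 × E3 => ‖u p.2 * f (p.1 - p.2)‖ₑ)
      ((volume : Measure E3).prod volume) :=
    (hu.aestronglyMeasurable.convolution_integrand (ContinuousLinearMap.mul ℝ ℂ)
      hf.aestronglyMeasurable).enorm
  calc ∫⁻ x, ‖conv u f x‖ₑ ≤ ∫⁻ x, ∫⁻ t, ‖u t * f (x - t)‖ₑ :=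
        lintegral_mono fun x => enorm_integral_le_lintegral_enorm _
    _ = ∫⁻ t, ∫⁻ x, ‖u t * f (x - t)‖ₑ := lintegral_lintegral_swap hm
    _ = ∫⁻ t, ‖u t‖ₑ * ∫⁻ x, ‖f x‖ₑ := by
        refine lintegral_congr fun t => ?_
        simp only [enorm_mul]
        rw [lintegral_const_mul' _ _ (by simp), lintegral_sub_right_eq_self (fun x => ‖f x‖ₑ) t]
    _ = _ := by
        rw [lintegral_mul_const'' _ hu.aestronglyMeasurable.enorm]

theorem conv_sub_left {u v f : E3 → ℂ} (hu : Integrable u) (hv : Integrable v)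
    (hf : Continuous f) (hc : HasCompactSupport f) :
    conv (fun x => u x - v x) f = fun x => conv u f x - conv v f x := by
  ext x
  have h : ∀ {w : E3 → ℂ}, Integrable w → Integrable fun t => w t * f (x - t) := fun hw =>
    hc.convolutionExists_right (ContinuousLinearMap.mul ℝ ℂ) hw.locallyIntegrable hf x
  simp only [conv_apply, sub_mul]
  exact integral_sub (h hu) (h hv)

/-- There are smooth functions with arbitrarily small support which approximate the unit of the
convolution algebra `L₁(ℝ³)`. -/
theorem exists_mollifier {δ : ℝ} (hδ : 0 < δ) : ∃ f : ℕ → E3 → ℂ,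
    (∀ n, ContDiff ℝ ∞ (f n)) ∧ (∀ n, tsupport (f n) ⊆ Metric.closedBall 0 δ) ∧
    ∀ u, Integrable u →
      Filter.Tendsto (fun n => ∫⁻ x, ‖conv u (f n) x - u x‖ₑ) Filter.atTop (𝓝 0) := by
  let φ : ℕ → ContDiffBump (0 : E3) := fun n =>
    ⟨δ / (2 * (n + 1)), δ / (n + 1), by positivity, by
      rw [div_lt_div_iff₀ (by positivity) (by positivity)]
      have : (0 : ℝ) ≤ n := n.cast_nonneg
      nlinarith [mul_pos hδ (show (0 : ℝ) < n + 1 by positivity)]⟩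
  have hr : Filter.Tendsto (fun n => (φ n).rOut) Filter.atTop (𝓝 0)   := by
    simpa [φ, div_eq_mul_inv] using
      (tendsto_one_div_add_atTop_nhds_zero_nat (𝕜 := ℝ)).const_mul δ
  have hrδ : ∀ n, (φ n).rOut ≤ δ := fun n => by
    change δ / ((n : ℝ) + 1) ≤ δ
    exact div_le_self hδ.le (by have : (0 : ℝ) ≤ n := n.cast_nonneg
                                linarith)
  set f : ℕ → E3 → ℂ := fun n x => ((φ n).normed volume x : ℂ) with hf
  have hsm : ∀ n, ContDiff ℝ ∞ (f n) := fun n => Complex.ofRealCLM.contDiff.comp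
    (φ n).contDiff_normed
  have hts : ∀ n, tsupport (f n) ⊆ Metric.closedBall 0 (φ n).rOut := fun n => by
    rw [← (φ n).tsupport_normed_eq (μ := volume)]
    exact closure_mono fun x hx h0 => hx (by simp [hf, h0])
  have hcs : ∀ n, HasCompactSupport (f n) := fun n =>
    (isCompact_closedBall _ _).of_isClosed_subset isClosed_closure (hts n)
  have hint : ∀ n, Integrable (f n) := fun n => (hsm n).continuous.integrable_of_hasCompactSupport
    (hcs n)
  have hone : ∀ n, ∫⁻ x, ‖f n x‖ₑ = 1 := fun n => by
    have h1 : ∀ x, ‖f n x‖ₑ = ENNReal.ofReal ((φ n).normed volume x) := fun x => by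
      rw [hf, ← ofReal_norm, Complex.norm_real, Real.norm_of_nonneg ((φ n).nonneg_normed x)]
    simp only [h1]
    rw [← ofReal_integral_eq_lintegral_ofReal (φ n).integrable_normed
      (Filter.Eventually.of_forall (φ n).nonneg_normed), (φ n).integral_normed, ENNReal.ofReal_one]
  have hcomp : ∀ n (g : E3 → ℂ), conv g (f n) =
      convolution ((φ n).normed volume) g (ContinuousLinearMap.lsmul ℝ ℝ) volume := by
    intro n g
    ext x
    rw [conv_apply_swap]
    exact integral_congr_ae (Filter.Eventually.of_forall fun t => by simp [hf, mul_comm])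
  -- For continuous g with compact support the convergence is uniform, and the difference vanishes
  -- off the δ-thickening B of the support, which has finite volume.
  have hcont : ∀ g : E3 → ℂ, Continuous g → HasCompactSupport g →
      Filter.Tendsto (fun n => ∫⁻ x, ‖conv g (f n) x - g x‖ₑ) Filter.atTop (𝓝 0) := by
    intro g hg hgc
    have huc := hgc.uniformContinuous_of_continuous hg
    set B := Metric.cthickening δ (tsupport g) with hB
    have hBc : IsCompact B := hgc.isCompact.cthickening
    have hBt : volume B ≠ ⊤ := hBc.measure_lt_top.ne
    rw [ENNReal.tendsto_nhds_zero]
    intro ε hε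
    obtain ⟨η, hη0, hη⟩ : ∃ η : NNReal, 0 < η ∧ (η : ℝ≥0∞) * volume B ≤ ε := by
      rcases eq_or_ne ε ⊤ with rfl | hεt
      · exact ⟨1, one_pos, le_top⟩
      obtain ⟨η, h1, h2⟩ := ENNReal.exists_nnreal_pos_mul_lt hBt hε.ne'
      exact ⟨η, h1, h2.le⟩
    obtain ⟨r, hr0, hrr⟩ := Metric.uniformContinuous_iff.mp huc η (by exact_mod_cast hη0)
    filter_upwards [hr.eventually (gt_mem_nhds hr0)] with n hn
    have hle : ∀ x, ‖conv g (f n) x - g x‖ₑ ≤ B.indicator (fun _ => (η : ℝ≥0∞)) x := by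
      intro x
      by_cases hx : x ∈ B
      · rw [indicator_of_mem hx, ← edist_eq_enorm_sub, edist_nndist, ENNReal.coe_le_coe, hcomp n g]
        refine (φ n).dist_normed_convolution_le hg.aestronglyMeasurable fun y hy => ?_
        exact (hrr ((Metric.mem_ball.mp hy).trans hn)).le
      · rw [indicator_of_notMem hx]
        have h0 : ∀ y, dist x y ≤ δ → g y = 0 := fun y hy => by
          by_contra h
          exact hx (Metric.mem_cthickening_of_dist_le x y δ _ (subset_tsupport g h) hy)
        have h1 : conv g (f n) x = g x := by
          rw [hcomp n g]
          refine (φ n).normed_convolution_eq_right fun y hy => ?_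
          rw [h0 x (by simpa using hδ.le),
            h0 y (by rw [dist_comm]; exact (Metric.mem_ball.mp hy).le.trans (hrδ n))]
        simp [h1]
    calc ∫⁻ x, ‖conv g (f n) x - g x‖ₑ ≤ ∫⁻ x, B.indicator (fun _ => (η : ℝ≥0∞)) x :=
          lintegral_mono hle
      _ = η * volume B := lintegral_indicator_const hBc.measurableSet _
      _ ≤ ε := hη
  refine ⟨f, hsm, fun n => (hts n).trans (Metric.closedBall_subset_closedBall (hrδ n)),
    fun u hu => ?_⟩
  rw [ENNReal.tendsto_nhds_zero]
  intro ε hε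
  have hε3 : ε / 3 ≠ 0 := by simpa using hε.ne'
  -- Convolution with a function of L_1 norm one does not increase the distance of u from g, so this
  -- distance is paid twice and the error for g once.
  obtain ⟨g, hgc, hgu, hg, hgi⟩ := hu.exists_hasCompactSupport_lintegral_sub_le hε3
  filter_upwards [ENNReal.tendsto_nhds_zero.mp (hcont g hg hgc) (ε / 3)
    (pos_iff_ne_zero.mpr hε3)] with n hn
  have hsub : Integrable fun x => u x - g x := hu.sub hgi
  have hd := conv_sub_left hu hgi (hsm n).continuous (hcs n)
  have hY := lintegral_enorm_conv_le hsub (hint n)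
  rw [hone, mul_one] at hY
  have hm1 : AEMeasurable fun x => ‖conv (fun x => u x - g x) (f n) x‖ₑ :=
    (contDiff_conv hsub (hsm n) (hcs n)).continuous.aestronglyMeasurable.enorm
  have hm2 : AEMeasurable fun x => ‖conv g (f n) x - g x‖ₑ :=
    ((contDiff_conv hgi (hsm n) (hcs n)).continuous.sub hg).aestronglyMeasurable.enorm
  calc ∫⁻ x, ‖conv u (f n) x - u x‖ₑ
      ≤ ∫⁻ x, (‖conv (fun x => u x - g x) (f n) x‖ₑ + ‖conv g (f n) x - g x‖ₑ + ‖u x - g x‖ₑ) := by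
        refine lintegral_mono fun x => ?_
        have h1 : conv u (f n) x - u x = conv (fun x => u x - g x) (f n) x +
            (conv g (f n) x - g x) - (u x - g x) := by
          rw [hd]
          ring
        rw [h1]
        exact (enorm_sub_le).trans (add_le_add_left (enorm_add_le _ _) _)
    _ = (∫⁻ x, ‖conv (fun x => u x - g x) (f n) x‖ₑ) + (∫⁻ x, ‖conv g (f n) x - g x‖ₑ) +
          ∫⁻ x, ‖u x - g x‖ₑ := by
        rw [← lintegral_add_left' hm1]
        exact lintegral_add_left' (hm1.add hm2) _
    _ ≤ ε / 3 + ε / 3 + ε / 3 := add_le_add (add_le_add (hY.trans hgu) hn) hgu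
    _ = ε := ENNReal.add_thirds ε

/-! ### Weak derivatives -/

theorem integrableOn_mul_of_tsupport_subset {O : Set E3} (hO : IsOpen O) {v φ : E3 → ℂ}
    (hv : LocallyIntegrableOn v O) (hφ : Continuous φ) (hc : HasCompactSupport φ)
    (hs : tsupport φ ⊆ O) : IntegrableOn (fun y => v y * φ y) O :=
  ((hv.integrableOn_compact_subset hs hc).mul_continuousOn hφ.continuousOn
    hc).of_forall_sdiff_eq_zero hO.measurableSet fun y hy => by
      rw [image_eq_zero_of_notMem_tsupport hy.2, mul_zero]

theorem ae_eq_of_isWeakDeriv {O : Set E3} (hO : IsOpen O) {β : Fin 3 → ℕ} {u v w : E3 → ℂ}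
    (hv : LocallyIntegrableOn v O) (hw : LocallyIntegrableOn w O) (huv : IsWeakDeriv O β u v)
    (huw : IsWeakDeriv O β u w) : v =ᵐ[volume.restrict O] w := by
  have h := hO.ae_eq_zero_of_integral_contDiff_smul_eq_zero (hv.sub hw) fun g hg hgc hgs => by
    set φ : E3 → ℂ := fun y => (g y : ℂ) with hφ
    have hsub : tsupport φ ⊆ tsupport g := closure_mono fun y hy h0 => hy (by simp [hφ, h0])
    have hφs : ContDiff ℝ ∞ φ := Complex.ofRealCLM.contDiff.comp hg
    have hφc : HasCompactSupport φ := hgc.of_isClosed_subset isClosed_closure hsub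
    have h1 := huv φ hφs hφc (hsub.trans hgs)
    rw [huw φ hφs hφc (hsub.trans hgs)] at h1
    have h2 := mul_left_cancel₀ (pow_ne_zero _ (by norm_num)) h1
    rw [← setIntegral_eq_integral_of_forall_compl_eq_zero (s := O) fun y hy => by
      rw [image_eq_zero_of_notMem_tsupport fun h => hy (hgs h), zero_smul]]
    calc ∫ y in O, g y • (v - w) y = ∫ y in O, (v y * φ y - w y * φ y) := by
          refine integral_congr_ae (Filter.Eventually.of_forall fun y => ?_)
          simp only [hφ, Pi.sub_apply, Complex.real_smul]
          ring
      _ = 0 := by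
          rw [integral_sub (integrableOn_mul_of_tsupport_subset hO hv hφs.continuous hφc
            (hsub.trans hgs)) (integrableOn_mul_of_tsupport_subset hO hw hφs.continuous hφc
            (hsub.trans hgs)), h2, sub_self]
  filter_upwards [(ae_restrict_iff' hO.measurableSet).mpr h] with y hy
  exact sub_eq_zero.mp hy

theorem weakDeriv_spec {O : Set E3} {β : Fin 3 → ℕ} {u v : E3 → ℂ}
    (hv : LocallyIntegrableOn v O) (huv : IsWeakDeriv O β u v) :
    LocallyIntegrableOn (weakDeriv O β u) O ∧ IsWeakDeriv O β u (weakDeriv O β u) := by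
  have h : ∃ v, LocallyIntegrableOn v O ∧ IsWeakDeriv O β u v := ⟨v, hv, huv⟩
  rw [weakDeriv, dif_pos h]
  exact h.choose_spec

/-- `weakDeriv` selects a representative that is only known to be locally integrable; uniqueness
almost everywhere transfers membership in L_p to it. -/
theorem memLp_weakDeriv {O : Set E3} (hO : IsOpen O) {β : Fin 3 → ℕ} {u : E3 → ℂ} {p : ℝ≥0∞}
    (hp : 1 ≤ p) (h : ∃ v, MemLp v p (volume.restrict O) ∧ IsWeakDeriv O β u v) :
    MemLp (weakDeriv O β u) p (volume.restrict O) ∧ IsWeakDeriv O β u (weakDeriv O β u) := by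
  obtain ⟨v, hv, huv⟩ := h
  have hvl : LocallyIntegrableOn v O :=
    locallyIntegrableOn_of_locallyIntegrable_restrict (hv.locallyIntegrable hp)
  obtain ⟨h1, h2⟩ := weakDeriv_spec hvl huv
  exact ⟨(memLp_congr_ae (ae_eq_of_isWeakDeriv hO h1 hvl h2 huv)).mpr hv, h2⟩

/-- Functions with weak derivatives which vanish outside of a compact subset `K` of an open set are
approximated by smooth functions supported in a fixed compact neighbourhood of `K`. -/
theorem exists_smooth_approximation {O K : Set E3} (hO : IsOpen O) (hK : IsCompact K)
    (hKO : K ⊆ O) : ∃ N, IsCompact N ∧ K ⊆ N ∧ N ⊆ O ∧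
      ∀ u : E3 → ℂ, Integrable u → (∀ y ∉ K, u y = 0) → ∃ w : ℕ → E3 → ℂ,
        (∀ n, ContDiff ℝ ∞ (w n)) ∧ (∀ n, ∀ y ∉ N, w n y = 0) ∧
        Filter.Tendsto (fun n => ∫⁻ y, ‖w n y - u y‖ₑ) Filter.atTop (𝓝 0) ∧
        ∀ (β : Fin 3 → ℕ) (v : E3 → ℂ), LocallyIntegrableOn v O → IsWeakDeriv O β u v →
          Filter.Tendsto (fun n => ∫⁻ y in N, ‖multiDeriv β (w n) y - v y‖ₑ) Filter.atTop
            (𝓝 0) := by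
  obtain ⟨d, hd, hdO⟩ := hK.exists_cthickening_subset_open hO hKO
  -- Two thickenings are used: mollifying at scale δ spreads K to N, and for y in N the test
  -- function f_n(y - ·) still has its support in N₂ ⊆ O.
  set δ := d / 2 with hδ
  have hδ0 : 0 < δ := half_pos hd
  set N := Metric.cthickening δ K with hN
  set N₂ := Metric.cthickening d K with hN₂
  have hNN₂ : ∀ y ∈ N, ∀ t, dist t y ≤ δ → t ∈ N₂ := fun y hy t ht => by
    have h1 := Metric.cthickening_cthickening_subset hδ0.le hδ0.le K
      (Metric.mem_cthickening_of_dist_le t y δ _ hy ht)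
    rwa [hδ, add_halves] at h1
  have hN₂O : N₂ ⊆ O := hdO
  have hNO : N ⊆ O := (Metric.cthickening_mono (half_le_self hd.le) K).trans hdO
  refine ⟨N, hK.cthickening, Metric.self_subset_cthickening K, hNO, fun u hu hu0 => ?_⟩
  obtain ⟨f, hf, hfs, hft⟩ := exists_mollifier hδ0
  have hfc : ∀ n, HasCompactSupport (f n) := fun n =>
    (isCompact_closedBall _ _).of_isClosed_subset isClosed_closure (hfs n)
  refine ⟨fun n => conv u (f n), fun n => contDiff_conv hu (hf n) (hfc n), fun n y hy => ?_,
    hft u hu, fun β v hv huv => ?_⟩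
  · change conv u (f n) y = 0
    rw [conv_apply]
    refine integral_eq_zero_of_ae (Filter.Eventually.of_forall fun t => ?_)
    by_cases ht : t ∈ K
    · have h0 : f n (y - t) = 0 := image_eq_zero_of_notMem_tsupport fun h => hy (by
        refine Metric.mem_cthickening_of_dist_le y t δ K ht ?_
        simpa [dist_eq_norm] using hfs n h)
      simp [h0]
    · simp [hu0 t ht]
  -- The cut-off makes v integrable on ℝ³ and does not affect its mollification at points of N.
  set v' := N₂.indicator v with hv'
  have hv'i : Integrable v' :=
    (integrable_indicator_iff hK.cthickening.measurableSet).mpr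
      (hv.integrableOn_compact_subset hN₂O hK.cthickening)
  -- D^β first falls on the mollifier. The weak derivative tested with z ↦ f_n(y - z) then brings v
  -- in, and the sign of the reflection cancels that of the definition.
  have hD : ∀ n, ∀ y ∈ N, multiDeriv β (conv u (f n)) y = conv v' (f n) y := by
    intro n y hy
    set φ : E3 → ℂ := fun z => f n (y - z) with hφ
    have hφs : ContDiff ℝ ∞ φ := (hf n).comp (contDiff_const.sub contDiff_id)
    have hsub : tsupport φ ⊆ N₂ := by
      refine closure_minimal (fun t ht => ?_) Metric.isClosed_cthickening
      refine hNN₂ y hy t ?_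
      have h1 := hfs n (subset_tsupport _ (show f n (y - t) ≠ 0 from ht))
      simpa [dist_eq_norm, norm_sub_rev] using h1
    have hφc : HasCompactSupport φ := hK.cthickening.of_isClosed_subset isClosed_closure hsub
    have h1 := huv φ hφs hφc (hsub.trans hN₂O)
    rw [multiDeriv_comp_sub_left] at h1
    have h2 : ∫ t in O, u t * ((-1) ^ (∑ i, β i) * multiDeriv β (f n) (y - t)) =
        (-1) ^ (∑ i, β i) * ∫ t, u t * multiDeriv β (f n) (y - t) := by
      rw [setIntegral_eq_integral_of_forall_compl_eq_zero fun t ht => by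
        rw [hu0 t fun h => ht (hKO h), zero_mul], ← integral_const_mul]
      exact integral_congr_ae (Filter.Eventually.of_forall fun t => by ring)
    have h3 : ∫ t in O, v t * φ t = ∫ t, v' t * f n (y - t) := by
      rw [setIntegral_eq_integral_of_forall_compl_eq_zero fun t ht => by
        rw [image_eq_zero_of_notMem_tsupport fun h => ht (hN₂O (hsub h)), mul_zero]]
      refine integral_congr_ae (Filter.Eventually.of_forall fun t => ?_)
      by_cases ht : t ∈ N₂
      · simp [hv', ht, hφ]
      · have : f n (y - t) = 0 :=
          image_eq_zero_of_notMem_tsupport (f := φ) fun h => ht (hsub h)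
        simp [hφ, this]
    rw [h2, h3] at h1
    rw [multiDeriv_conv hu (hf n) (hfc n)]
    exact mul_left_cancel₀ (pow_ne_zero _ (by norm_num)) h1
  refine tendsto_of_tendsto_of_tendsto_of_le_of_le tendsto_const_nhds (hft v' hv'i)
    (fun _ => bot_le) fun n => ?_
  calc ∫⁻ y in N, ‖multiDeriv β (conv u (f n)) y - v y‖ₑ
      = ∫⁻ y in N, ‖conv v' (f n) y - v' y‖ₑ := by
        refine setLIntegral_congr_fun hK.cthickening.measurableSet fun y hy => ?_
        have hy2 : y ∈ N₂ := hNN₂ y hy y (by simpa using hδ0.le)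
        simp only [hD n y hy, hv', indicator_of_mem hy2]
    _ ≤ _ := setLIntegral_le_lintegral _ _

/-! ### Localized functions in a chart -/

theorem diffOp_congr {m : ℕ} {f g : SO3 → ℂ} {x : SO3} (h : f =ᶠ[𝓝 x] g) :
    diffOp m f x = diffOp m g x := by
  simp only [diffOp, (shiftedProd_eventuallyEq m h).eq_of_nhds]

theorem diffOp_zero (m : ℕ) (x : SO3) : diffOp m (fun _ => 0) x = 0 := by
  have h := shiftedProd_const_mul m (fun _ => 0) x 0
  simp only [mul_zero, zero_mul] at h
  rw [diffOp, h, mul_zero]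

namespace ChartedPartition

variable (P : ChartedPartition) (j : Fin P.N)

theorem exists_eLpNorm_pullback_le {N : Set E3} (hN : IsCompact N) (hNO : N ⊆ (P.h j).target) :
    ∃ C : NNReal, ∀ w : E3 → ℂ, AEStronglyMeasurable w (volume.restrict N) →
      AEStronglyMeasurable (((P.h j).symm '' N).indicator fun x => w (P.h j x)) haar ∧
      ∀ p : ℝ≥0∞, 1 ≤ p → p ≠ ⊤ →
        eLpNorm (((P.h j).symm '' N).indicator fun x => w (P.h j x)) p haar ≤
          C * eLpNorm w p (volume.restrict N) := by
  obtain ⟨C, hC⟩ := P.exists_map_le j hN hNO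
  have hS := (P.isCompact_symm_image j hN hNO).measurableSet
  have hm := P.aemeasurable_chart j hN hNO
  have hC' : (haar.restrict ((P.h j).symm '' N)).map (P.h j) ≤
      (C : ℝ≥0∞) • volume.restrict N := hC
  -- The change of measure costs C^{1/p}, which max(1, C) bounds for all p ≥ 1 at once; the constant
  -- must not depend on p.
  refine ⟨max 1 C, fun w hw => ?_⟩
  have hw' : AEStronglyMeasurable w ((haar.restrict ((P.h j).symm '' N)).map (P.h j)) :=
    hw.mono_ac (Measure.absolutelyContinuous_of_le_smul hC')
  refine ⟨(aestronglyMeasurable_indicator_iff hS).mpr (hw'.comp_aemeasurable hm),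
    fun p hp1 hp => ?_⟩
  rw [eLpNorm_indicator_eq_eLpNorm_restrict hS]
  calc eLpNorm (w ∘ P.h j) p (haar.restrict ((P.h j).symm '' N))
      = eLpNorm w p ((haar.restrict ((P.h j).symm '' N)).map (P.h j)) :=
        (eLpNorm_map_measure hw' hm).symm
    _ ≤ eLpNorm w p ((C : ℝ≥0∞) • volume.restrict N) := eLpNorm_mono_measure w hC'
    _ = (C : ℝ≥0∞) ^ (1 / p).toReal * eLpNorm w p (volume.restrict N) := by
        rw [eLpNorm_smul_measure_of_ne_top hp, smul_eq_mul]
    _ ≤ _ := by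
        gcongr
        have h1 : (C : ℝ≥0∞) ≤ ((max 1 C : NNReal) : ℝ≥0∞) := by
          exact_mod_cast le_max_right 1 C
        have h2 : (1 : ℝ≥0∞) ≤ ((max 1 C : NNReal) : ℝ≥0∞) := by
          exact_mod_cast le_max_left 1 C
        have h3 : (1 / p).toReal ≤ 1 := by
          rw [← ENNReal.toReal_one]
          exact ENNReal.toReal_mono ENNReal.one_ne_top (by simpa using hp1)
        calc (C : ℝ≥0∞) ^ (1 / p).toReal ≤ ((max 1 C : NNReal) : ℝ≥0∞) ^ (1 / p).toReal :=
              ENNReal.rpow_le_rpow h1 ENNReal.toReal_nonneg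
          _ ≤ ((max 1 C : NNReal) : ℝ≥0∞) ^ (1 : ℝ) := ENNReal.rpow_le_rpow_of_exponent_le h2 h3
          _ = _ := ENNReal.rpow_one _

/-- The function on `SO(3)` with the coordinate representation `∑_β c_β v_β`, supported in the part
of the chart over `N`. -/
noncomputable def pullbackSum (N : Set E3) (k : ℕ) (c v : (Fin 3 → ℕ) → E3 → ℂ) : SO3 → ℂ :=
  ((P.h j).symm '' N).indicator fun x => ∑ β ∈ multiIndices k, c β (P.h j x) * v β (P.h j x)

theorem exists_norm_coeff_le {N : Set E3} (hN : IsCompact N) {c : (Fin 3 → ℕ) → E3 → ℂ}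
    (hc : ∀ β, ContinuousOn (c β) N) (k : ℕ) :
    ∃ M : NNReal, ∀ β ∈ multiIndices k, ∀ y ∈ N, ‖c β y‖₊ ≤ M := by
  have h : ∀ β, ∃ M : NNReal, ∀ y ∈ N, ‖c β y‖₊ ≤ M := fun β => by
    obtain ⟨M, hM⟩ := hN.exists_bound_of_continuousOn (hc β)
    refine ⟨M.toNNReal, fun y hy => ?_⟩
    rw [← NNReal.coe_le_coe, coe_nnnorm]
    exact (hM y hy).trans (Real.le_coe_toNNReal M)
  choose M hM using h
  exact ⟨(multiIndices k).sup M, fun β hβ y hy => (hM β y hy).trans (Finset.le_sup hβ)⟩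

/-- Coefficients are bounded on the compact set N. The estimate is used twice: with exponent p for
the norm of L_m(ψ_j f), and with exponent 1 for the convergence of the approximants. -/
theorem exists_eLpNorm_pullbackSum_le {N : Set E3} (hN : IsCompact N)
    (hNO : N ⊆ (P.h j).target) (k : ℕ) {c : (Fin 3 → ℕ) → E3 → ℂ}
    (hc : ∀ β, ContinuousOn (c β) N) :
    ∃ C : NNReal, ∀ v : (Fin 3 → ℕ) → E3 → ℂ,
      (∀ β ∈ multiIndices k, AEStronglyMeasurable (v β) (volume.restrict N)) →
      AEStronglyMeasurable (P.pullbackSum j N k c v) haar ∧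
      ∀ p : ℝ≥0∞, 1 ≤ p → p ≠ ⊤ → eLpNorm (P.pullbackSum j N k c v) p haar ≤
        C * ∑ β ∈ multiIndices k, eLpNorm (v β) p (volume.restrict N) := by
  obtain ⟨C, hC⟩ := P.exists_eLpNorm_pullback_le j hN hNO
  obtain ⟨M, hM⟩ := exists_norm_coeff_le hN hc k
  refine ⟨C * M, fun v hv => ?_⟩
  have hcm : ∀ β ∈ multiIndices k,
      AEStronglyMeasurable (fun y => c β y * v β y) (volume.restrict N) := fun β hβ =>
    ((hc β).aestronglyMeasurable hN.measurableSet).mul (hv β hβ)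
  have hsum : AEStronglyMeasurable (∑ β ∈ multiIndices k, fun y => c β y * v β y)
      (volume.restrict N) := Finset.aestronglyMeasurable_sum _ hcm
  have heq : (∑ β ∈ multiIndices k, fun y => c β y * v β y) =
      fun y => ∑ β ∈ multiIndices k, c β y * v β y := by
    ext y
    simp
  obtain ⟨h1, h2⟩ := hC _ hsum
  simp only [heq] at h1 h2
  refine ⟨h1, fun p hp1 hp => (h2 p hp1 hp).trans ?_⟩
  rw [ENNReal.coe_mul, mul_assoc, ← heq]
  gcongr
  refine (eLpNorm_sum_le hcm hp1).trans ?_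
  rw [Finset.mul_sum]
  refine Finset.sum_le_sum fun β hβ => ?_
  refine eLpNorm_le_nnreal_smul_eLpNorm_of_ae_le_mul ?_ p
  filter_upwards [ae_restrict_mem hN.measurableSet] with y hy
  rw [nnnorm_mul]
  gcongr
  exact hM β hβ y hy

/-- The compact set onto which the chart `h j` maps the support of `ψ j`. -/
def chartSupport : Set E3 := P.h j '' tsupport (P.ψ j)

theorem isCompact_chartSupport : IsCompact (P.chartSupport j) :=
  (isClosed_tsupport (P.ψ j)).isCompact.image_of_continuousOn
    ((P.h j).continuousOn.mono (P.ψ_supp j))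

theorem chartSupport_subset : P.chartSupport j ⊆ (P.h j).target := by
  rintro _ ⟨x, hx, rfl⟩
  exact (P.h j).map_source (P.ψ_supp j hx)

theorem ψ_symm_eq_zero {y : E3} (hy : y ∈ (P.h j).target) (hK : y ∉ P.chartSupport j) :
    P.ψ j ((P.h j).symm y) = 0 :=
  image_eq_zero_of_notMem_tsupport fun h => hK ⟨_, h, (P.h j).right_inv hy⟩

theorem loc_chart (f : SO3 → ℂ) {x : SO3} (hx : x ∈ (P.h j).source) :
    P.loc j f (P.h j x) = P.ψ j x * f x := by
  rw [loc, (P.h j).left_inv hx]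

/-- The localized function, extended by zero. -/
noncomputable def extendedLoc (f : SO3 → ℂ) : E3 → ℂ := (P.h j).target.indicator (P.loc j f)

theorem extendedLoc_eq_zero (f : SO3 → ℂ) {y : E3} (hy : y ∉ P.chartSupport j) :
    P.extendedLoc j f y = 0 := by
  by_cases h : y ∈ (P.h j).target
  · rw [extendedLoc, indicator_of_mem h, loc, P.ψ_symm_eq_zero j h hy]
    simp
  · exact indicator_of_notMem h _

theorem integrable_extendedLoc {f : SO3 → ℂ} {p : ℝ≥0∞} (hp : 1 ≤ p)
    (hf : MemLp (P.loc j f) p (volume.restrict (P.h j).target)) :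
    Integrable (P.extendedLoc j f) := by
  have h1 : LocallyIntegrableOn (P.loc j f) (P.h j).target :=
    locallyIntegrableOn_of_locallyIntegrable_restrict (hf.locallyIntegrable hp)
  have h2 := h1.integrableOn_compact_subset (P.chartSupport_subset j) (P.isCompact_chartSupport j)
  rw [extendedLoc, integrable_indicator_iff (P.isOpen_target j).measurableSet]
  refine h2.of_forall_sdiff_eq_zero (P.isOpen_target j).measurableSet fun y hy => ?_
  rw [loc, P.ψ_symm_eq_zero j hy.1 hy.2]
  simp

theorem isWeakDeriv_extendedLoc {f : SO3 → ℂ} {β : Fin 3 → ℕ} {v : E3 → ℂ}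
    (h : IsWeakDeriv (P.h j).target β (P.loc j f) v) :
    IsWeakDeriv (P.h j).target β (P.extendedLoc j f) v := fun φ h1 h2 h3 => by
  rw [← h φ h1 h2 h3]
  refine setIntegral_congr_fun (P.isOpen_target j).measurableSet fun y hy => ?_
  simp only [extendedLoc, indicator_of_mem hy]

/-- A smooth function supported in a compact subset of a chart, transported to `SO(3)`. -/
theorem ckAt_diffOp_pullback {N : Set E3} (hN : IsCompact N) (hNO : N ⊆ (P.h j).target) {m : ℕ}
    {c : (Fin 3 → ℕ) → E3 → ℂ}
    (hc : ∀ u, ContDiffOn ℝ (2 * m : ℕ) u (P.h j).target → ∀ x ∈ (P.h j).source,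
      CkAt (2 * m) (fun y => u (P.h j y)) x ∧ diffOp m (fun y => u (P.h j y)) x =
        ∑ β ∈ multiIndices (2 * m), c β (P.h j x) * multiDeriv β u (P.h j x))
    {w : E3 → ℂ} (hw : ContDiff ℝ ∞ w) (hw0 : ∀ y ∉ N, w y = 0) (x : SO3) :
    CkAt (2 * m) (((P.h j).symm '' N).indicator fun x => w (P.h j x)) x ∧
      diffOp m (((P.h j).symm '' N).indicator fun x => w (P.h j x)) x =
        P.pullbackSum j N (2 * m) c (fun β => multiDeriv β w) x := by
  have hS := (P.isCompact_symm_image j hN hNO).isClosed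
  have hwO : ContDiffOn ℝ (2 * m : ℕ) w (P.h j).target :=
    (contDiff_infty.mp hw (2 * m)).contDiffOn
  by_cases hx : x ∈ (P.h j).symm '' N
  · have hxs := P.symm_image_subset_source j hNO hx
    have hev : (((P.h j).symm '' N).indicator fun x => w (P.h j x)) =ᶠ[𝓝 x]
        fun y => w (P.h j y) := by
      filter_upwards [(P.h j).open_source.mem_nhds hxs] with y hy
      by_cases hyS : y ∈ (P.h j).symm '' N
      · rw [indicator_of_mem hyS]
      · rw [indicator_of_notMem hyS, hw0 _ fun h => hyS ((P.mem_symm_image_iff j hNO hy).mpr h)]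
    obtain ⟨h1, h2⟩ := hc w hwO x hxs
    refine ⟨h1.congr hev, ?_⟩
    rw [diffOp_congr hev, h2, pullbackSum, indicator_of_mem hx]
  · have hev : (((P.h j).symm '' N).indicator fun x => w (P.h j x)) =ᶠ[𝓝 x] fun _ => 0 := by
      filter_upwards [hS.isOpen_compl.mem_nhds hx] with y hy
      exact indicator_of_notMem hy _
    refine ⟨(CkAt.const _ 0 x).congr hev, ?_⟩
    rw [diffOp_congr hev, diffOp_zero, pullbackSum, indicator_of_notMem hx]

/-- `L_m (ψ_j f)` in terms of the weak derivatives of the localized function, and its norm. -/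
theorem exists_isStrongDiffOp_localized (m : ℕ) : ∃ C : NNReal,
    ∀ (p : ℝ≥0∞), 1 ≤ p → p ≠ ⊤ → ∀ f : SO3 → ℂ, MemSobolev P (2 * m) p f →
      ∃ g : SO3 → ℂ, IsStrongDiffOp m (fun x => P.ψ j x * f x) g ∧ AEStronglyMeasurable g haar ∧
        eLpNorm g p haar ≤ C * ∑ β ∈ multiIndices (2 * m),
          eLpNorm (weakDeriv (P.h j).target β (P.loc j f)) p (volume.restrict (P.h j).target) := by
  obtain ⟨c, hcs, hc⟩ := P.exists_chart_diffOp j m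
  have hO := P.isOpen_target j
  obtain ⟨N, hN, hKN, hNO, happ⟩ := exists_smooth_approximation hO (P.isCompact_chartSupport j)
    (P.chartSupport_subset j)
  have hcN : ∀ β, ContinuousOn (c β) N := fun β => (hcs β).continuousOn.mono hNO
  obtain ⟨C₁, hC₁⟩ := P.exists_eLpNorm_pullback_le j hN hNO
  obtain ⟨C, hC⟩ := P.exists_eLpNorm_pullbackSum_le j hN hNO (2 * m) hcN
  refine ⟨C, fun p hp1 hp f hf => ?_⟩
  set S := (P.h j).symm '' N with hS
  have hres : (volume : Measure E3).restrict N ≤ volume.restrict (P.h j).target :=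
    Measure.restrict_mono hNO le_rfl
  set v : (Fin 3 → ℕ) → E3 → ℂ := fun β => weakDeriv (P.h j).target β (P.loc j f) with hv
  have hvL : ∀ β ∈ multiIndices (2 * m), MemLp (v β) p (volume.restrict (P.h j).target) ∧
      IsWeakDeriv (P.h j).target β (P.loc j f) (v β) := fun β hβ =>
    memLp_weakDeriv hO hp1 ((hf.2 j).2 β hβ)
  have hvl : ∀ β ∈ multiIndices (2 * m), LocallyIntegrableOn (v β) (P.h j).target := fun β hβ =>
    locallyIntegrableOn_of_locallyIntegrable_restrict ((hvL β hβ).1.locallyIntegrable hp1)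
  have hvm : ∀ β ∈ multiIndices (2 * m), AEStronglyMeasurable (v β) (volume.restrict N) :=
    fun β hβ => (hvL β hβ).1.aestronglyMeasurable.mono_measure hres
  obtain ⟨hgm, hgn⟩ := hC v hvm
  have hu := P.integrable_extendedLoc j hp1 (hf.2 j).1
  -- Convergence of the derivatives in L_1 is enough for `IsStrongDiffOp`; the L_p bound is read off
  -- the limit itself.
  obtain ⟨w, hws, hw0, hwu, hwv⟩ := happ _ hu fun y hy => P.extendedLoc_eq_zero j f hy
  have hgle : eLpNorm (P.pullbackSum j N (2 * m) c v) p haar ≤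
      C * ∑ β ∈ multiIndices (2 * m), eLpNorm (v β) p (volume.restrict (P.h j).target) := by
    refine (hgn p hp1 hp).trans ?_
    gcongr with β hβ
  have hgL : MemLp (P.pullbackSum j N (2 * m) c v) p haar := by
    refine ⟨hgm, hgle.trans_lt (ENNReal.mul_lt_top ENNReal.coe_lt_top ?_)⟩
    exact ENNReal.sum_lt_top.mpr fun β hβ => (hvL β hβ).1.eLpNorm_lt_top
  have hψ : Continuous (P.ψ j) := by
    obtain ⟨F, hF, hF'⟩ := P.ψ_smooth j
    have h1 : P.ψ j = fun x => F (entries x) := funext hF'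
    rw [h1]
    exact hF.continuous.comp continuous_entries
  have hloc : (fun x => (P.ψ j x : ℂ) * f x) =
      S.indicator fun x => P.extendedLoc j f (P.h j x) := by
    ext x
    by_cases hx : x ∈ S
    · have hxs := P.symm_image_subset_source j hNO hx
      rw [indicator_of_mem hx, extendedLoc, indicator_of_mem ((P.h j).map_source hxs),
        P.loc_chart j f hxs]
    · rw [indicator_of_notMem hx, image_eq_zero_of_notMem_tsupport (f := P.ψ j) (x := x)]
      · simp
      · exact fun h => hx ⟨_, hKN ⟨x, h, rfl⟩, (P.h j).left_inv (P.ψ_supp j h)⟩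
  refine ⟨P.pullbackSum j N (2 * m) c v, ⟨?_, hgL.integrable hp1,
    fun n => S.indicator fun x => w n (P.h j x),
    fun n x => (P.ckAt_diffOp_pullback j hN hNO hc (hws n) (hw0 n) x).1, ?_, ?_⟩, hgm, hgle⟩
  · refine (hf.1.integrable hp1).bdd_mul (c := 1)
      (Complex.continuous_ofReal.comp hψ).aestronglyMeasurable
      (Filter.Eventually.of_forall fun x => ?_)
    rw [Complex.norm_real, Real.norm_of_nonneg (P.ψ_nonneg j x), ← P.ψ_sum x]
    exact Finset.single_le_sum (fun i _ => P.ψ_nonneg i x) (Finset.mem_univ j)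
  · have hlim := ENNReal.Tendsto.const_mul (a := (C₁ : ℝ≥0∞)) hwu (Or.inr ENNReal.coe_ne_top)
    rw [mul_zero] at hlim
    refine tendsto_of_tendsto_of_tendsto_of_le_of_le tendsto_const_nhds hlim (fun _ => bot_le)
      fun n => ?_
    have hm : AEStronglyMeasurable (fun y => w n y - P.extendedLoc j f y) (volume.restrict N) :=
      ((hws n).continuous.aestronglyMeasurable.sub hu.aestronglyMeasurable).restrict
    have h1 := (hC₁ _ hm).2 1 le_rfl ENNReal.one_ne_top
    rw [eLpNorm_one_eq_lintegral_enorm, eLpNorm_one_eq_lintegral_enorm] at h1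
    have h2 : ∀ x, (S.indicator (fun x => w n (P.h j x)) x) - P.ψ j x * f x =
        S.indicator (fun x => w n (P.h j x) - P.extendedLoc j f (P.h j x)) x := fun x => by
      rw [show (P.ψ j x : ℂ) * f x = _ from congrFun hloc x]
      by_cases hx : x ∈ S <;> simp [hx]
    simp only [h2]
    exact h1.trans (by gcongr; exact Measure.restrict_le_self)
  · have hlim : Filter.Tendsto (fun n => (C : ℝ≥0∞) * ∑ β ∈ multiIndices (2 * m),
        ∫⁻ y in N, ‖multiDeriv β (w n) y - v β y‖ₑ) Filter.atTop (𝓝 0) := by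
      have := ENNReal.Tendsto.const_mul (a := (C : ℝ≥0∞)) (tendsto_finsetSum
        (multiIndices (2 * m)) fun β hβ => hwv β (v β) (hvl β hβ)
          (P.isWeakDeriv_extendedLoc j (hvL β hβ).2)) (Or.inr ENNReal.coe_ne_top)
      simpa using this
    refine tendsto_of_tendsto_of_tendsto_of_le_of_le tendsto_const_nhds hlim (fun _ => bot_le)
      fun n => ?_
    have hm : ∀ β ∈ multiIndices (2 * m), AEStronglyMeasurable
        (fun y => multiDeriv β (w n) y - v β y) (volume.restrict N) := fun β hβ => by
      have hcd : ContDiffOn ℝ (0 : ℕ) (multiDeriv β (w n)) univ :=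
        contDiffOn_multiDeriv isOpen_univ ((hws n).of_le (by exact_mod_cast le_top)).contDiffOn
      have hcont : Continuous (multiDeriv β (w n)) :=
        continuousOn_univ.mp hcd.continuousOn
      exact hcont.aestronglyMeasurable.sub (hvm β hβ)
    -- `pullbackSum` is linear in the derivatives, so the norm estimate applied to their differences
    -- bounds the distance to the limit.
    have h1 := (hC _ hm).2 1 le_rfl ENNReal.one_ne_top
    simp only [eLpNorm_one_eq_lintegral_enorm] at h1
    refine le_trans (le_of_eq (lintegral_congr fun x => ?_)) h1
    rw [(P.ckAt_diffOp_pullback j hN hNO hc (hws n) (hw0 n) x).2]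
    congr 1
    simp only [pullbackSum]
    by_cases hx : x ∈ (P.h j).symm '' N
    · simp only [indicator_of_mem hx, mul_sub, Finset.sum_sub_distrib]
    · simp only [indicator_of_notMem hx, sub_zero]

end ChartedPartition

/-! ### `L_m` is bounded on the Sobolev spaces and on `C^{2m}` -/

namespace ChartedPartition

variable (P : ChartedPartition)

theorem sum_ψ_mul (f : SO3 → ℂ) (x : SO3) : ∑ j, (P.ψ j x : ℂ) * f x = f x := by
  rw [← Finset.sum_mul, ← Complex.ofReal_sum, P.ψ_sum x, Complex.ofReal_one, one_mul]

theorem eLpNorm_weakDeriv_le_sobolevNorm (k : ℕ) {p : ℝ≥0∞} (hp1 : 1 ≤ p) (hp : p ≠ ⊤)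
    (f : SO3 → ℂ) (j : Fin P.N) {β : Fin 3 → ℕ} (hβ : β ∈ multiIndices k) :
    eLpNorm (weakDeriv (P.h j).target β (P.loc j f)) p (volume.restrict (P.h j).target) ≤
      sobolevNorm P k p f := by
  have hq : 0 < p.toReal := ENNReal.toReal_pos (zero_lt_one.trans_le hp1).ne' hp
  rw [sobolevNorm, one_div, ENNReal.le_rpow_inv_iff hq]
  refine le_trans ?_ (Finset.single_le_sum
    (f := fun j => euclSobolevPow (P.h j).target k p (P.loc j f))
    (fun _ _ => bot_le) (Finset.mem_univ j))
  exact Finset.single_le_sum (f := fun β => eLpNorm (weakDeriv (P.h j).target β (P.loc j f)) p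
    (volume.restrict (P.h j).target) ^ p.toReal) (fun _ _ => bot_le) hβ

/-- The pieces ψ_j f are added up. The cardinality factor arises as each derivative norm is bounded
by the full Sobolev norm, which avoids constants depending on p. -/
theorem exists_isStrongDiffOp_of_memSobolev (m : ℕ) : ∃ C : NNReal,
    ∀ (p : ℝ≥0∞), 1 ≤ p → p ≠ ⊤ → ∀ f : SO3 → ℂ, MemSobolev P (2 * m) p f →
      ∃ g : SO3 → ℂ, IsStrongDiffOp m f g ∧ MemLp g p haar ∧
        eLpNorm g p haar ≤ C * sobolevNorm P (2 * m) p f := by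
  choose C hC using fun j => P.exists_isStrongDiffOp_localized j m
  refine ⟨∑ j, C j * (multiIndices (2 * m)).card, fun p hp1 hp f hf => ?_⟩
  choose g hg hgm hgn using fun j => hC j p hp1 hp f hf
  have hO := P.isOpen_target
  have hfin : ∀ j, eLpNorm (g j) p haar < ⊤ := fun j => by
    refine (hgn j).trans_lt (ENNReal.mul_lt_top ENNReal.coe_lt_top ?_)
    exact ENNReal.sum_lt_top.mpr fun β hβ =>
      (memLp_weakDeriv (hO j) hp1 ((hf.2 j).2 β hβ)).1.eLpNorm_lt_top
  refine ⟨fun x => ∑ j, g j x, ?_, memLp_finsetSum _ fun j _ => ⟨hgm j, hfin j⟩, ?_⟩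
  · have h := IsStrongDiffOp.sum Finset.univ fun j _ => hg j
    simpa only [P.sum_ψ_mul] using h
  · have h1 := eLpNorm_sum_le (μ := haar) (s := Finset.univ) (fun j _ => hgm j) hp1
    have h2 : (∑ j, g j) = fun x => ∑ j, g j x := by
      ext x
      simp
    rw [h2] at h1
    refine h1.trans ?_
    rw [ENNReal.ofNNReal_finsetSum, Finset.sum_mul]
    refine Finset.sum_le_sum fun j _ => (hgn j).trans ?_
    rw [ENNReal.coe_mul, mul_assoc]
    gcongr
    have h3 := Finset.sum_le_card_nsmul (multiIndices (2 * m)) _ _ fun β hβ =>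
      P.eLpNorm_weakDeriv_le_sobolevNorm (2 * m) hp1 hp f j hβ
    simpa using h3

theorem contDiffOn_comp_symm {V : Type*} [NormedAddCommGroup V] [NormedSpace ℝ V] (j : Fin P.N)
    {k : ℕ∞} {n : ℕ} (hn : (n : ℕ∞) ≤ k) {f : SO3 → V} (hf : IsCk k f) :
    ContDiffOn ℝ n (fun y => f ((P.h j).symm y)) (P.h j).target := by
  obtain ⟨F, hF, hF'⟩ := hf
  simp only [hF']
  exact (hF.of_le (by exact_mod_cast hn)).comp_contDiffOn
    ((P.symm_smooth j).of_le (by exact_mod_cast le_top))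

theorem contDiffOn_loc (j : Fin P.N) {n : ℕ} {f : SO3 → ℂ} (hf : IsCk (n : ℕ∞) f) :
    ContDiffOn ℝ n (P.loc j f) (P.h j).target :=
  (Complex.ofRealCLM.contDiff.comp_contDiffOn
    (P.contDiffOn_comp_symm j le_top (P.ψ_smooth j))).mul (P.contDiffOn_comp_symm j le_rfl hf)

/-- At x only those j with x in the support of ψ_j contribute, and there the coefficients of L_m are
bounded by compactness; the other pieces vanish near x. -/
theorem exists_enorm_diffOp_le_ckNorm (m : ℕ) : ∃ C : NNReal, ∀ f : SO3 → ℂ,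
    IsCk ((2 * m : ℕ) : ℕ∞) f → ∀ x, ‖diffOp m f x‖ₑ ≤ C * ckNorm P (2 * m) f := by
  choose c hcs hc using fun j => P.exists_chart_diffOp j m
  choose M hM using fun j => exists_norm_coeff_le (P.isCompact_chartSupport j)
    (fun β => (hcs j β).continuousOn.mono (P.chartSupport_subset j)) (2 * m)
  refine ⟨∑ j, M j * (multiIndices (2 * m)).card, fun f hf x => ?_⟩
  have key : ∀ j, CkAt (2 * m) (fun y => (P.ψ j y : ℂ) * f y) x ∧
      ‖diffOp m (fun y => (P.ψ j y : ℂ) * f y) x‖ₑ ≤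
        (M j * (multiIndices (2 * m)).card : NNReal) * ckNorm P (2 * m) f := by
    intro j
    by_cases hx : x ∈ tsupport (P.ψ j)
    · have hxs := P.ψ_supp j hx
      have hev : (fun y => (P.ψ j y : ℂ) * f y) =ᶠ[𝓝 x] fun y => P.loc j f (P.h j y) := by
        filter_upwards [(P.h j).open_source.mem_nhds hxs] with y hy
        exact (P.loc_chart j f hy).symm
      obtain ⟨h1, h2⟩ := hc j _ (P.contDiffOn_loc j hf) x hxs
      refine ⟨h1.congr hev, ?_⟩
      rw [diffOp_congr hev, h2]
      refine (enorm_sum_le _ _).trans ?_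
      have h3 := Finset.sum_le_card_nsmul (multiIndices (2 * m))
        (fun β => ‖c j β (P.h j x) * multiDeriv β (P.loc j f) (P.h j x)‖ₑ)
        (M j * ckNorm P (2 * m) f) fun β hβ => by
          rw [enorm_mul]
          gcongr
          · exact ENNReal.coe_le_coe.mpr (hM j β hβ _ ⟨x, hx, rfl⟩)
          · exact le_iSup_of_le j (le_iSup₂_of_le β hβ
              (le_iSup₂_of_le (P.h j x) ((P.h j).map_source hxs) le_rfl))
      refine h3.trans (le_of_eq ?_)
      rw [nsmul_eq_mul, ENNReal.coe_mul, ENNReal.coe_natCast]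
      ring
    · have hev : (fun y => (P.ψ j y : ℂ) * f y) =ᶠ[𝓝 x] fun _ => 0 := by
        filter_upwards [(isClosed_tsupport (P.ψ j)).isOpen_compl.mem_nhds hx] with y hy
        rw [image_eq_zero_of_notMem_tsupport hy, Complex.ofReal_zero, zero_mul]
      refine ⟨(CkAt.const _ 0 x).congr hev, ?_⟩
      rw [diffOp_congr hev, diffOp_zero, enorm_zero]
      exact bot_le
  have h1 : diffOp m f x = ∑ j, diffOp m (fun y => (P.ψ j y : ℂ) * f y) x := by
    rw [← diffOp_sum Finset.univ fun j _ => (key j).1]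
    simp only [P.sum_ψ_mul]
  rw [h1, ENNReal.ofNNReal_finsetSum, Finset.sum_mul]
  exact (enorm_sum_le _ _).trans (Finset.sum_le_sum fun j _ => (key j).2)

end ChartedPartition

end RotationGroup

/-! ### The theorem -/

theorem theorem5p1 (P : ChartedPartition) (m L : ℕ) (hm : 2 ≤ m) (hL : 2 * m ≤ L) (K : ℝ) :
    ∃ C : ℝ, 0 < C ∧ ∀ (Ξ : Finset SO3) (a : Ξ → SO3 → ℝ) (ρ : ℝ), IsCoeffKernel Ξ a ρ L K →
      (∀ p : ℝ≥0∞, 1 ≤ p → p ≠ ⊤ → ∀ f : SO3 → ℂ, MemSobolev P (2 * m) p f →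
        MemLp (weakDiffOp m f) p haar ∧ IsWeakDiffOp m f (weakDiffOp m f) ∧
        eLpNorm (fun x => f x - approximant m Ξ a f x) p haar ≤
          ENNReal.ofReal (C * ρ ^ (2 * m)) * sobolevNorm P (2 * m) p f) ∧
      (∀ f : SO3 → ℂ, IsCk ((2 * m : ℕ) : ℕ∞) f →
        weakDiffOp m f =ᵐ[haar] diffOp m f ∧
        ∀ x, ‖f x - approximant m Ξ a f x‖ₑ ≤
          ENNReal.ofReal (C * ρ ^ (2 * m)) * ckNorm P (2 * m) f) := by
  obtain ⟨C₀, hC₀, happ⟩ := exists_sub_approximant_le hm hL K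
  obtain ⟨C₁, hC₁⟩ := P.exists_isStrongDiffOp_of_memSobolev m
  obtain ⟨C₂, hC₂⟩ := P.exists_enorm_diffOp_le_ckNorm m
  -- One factor for both norm bounds of L_m; the 1 ensures that it is positive.
  set D : NNReal := max 1 (max C₁ C₂) with hD
  have hD₁ : (C₁ : ℝ≥0∞) ≤ D :=
    ENNReal.coe_le_coe.mpr ((le_max_left _ _).trans (le_max_right _ _))
  have hD₂ : (C₂ : ℝ≥0∞) ≤ D :=
    ENNReal.coe_le_coe.mpr ((le_max_right _ _).trans (le_max_right _ _))
  have hD0 : (0 : ℝ) < D := lt_of_lt_of_le one_pos (by exact_mod_cast le_max_left 1 (max C₁ C₂))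
  have hmul : ∀ (ρ : ℝ) (B : ℝ≥0∞), ENNReal.ofReal (C₀ * ρ ^ (2 * m)) * (D * B) =
      ENNReal.ofReal (C₀ * D * ρ ^ (2 * m)) * B := fun ρ B => by
    rw [mul_right_comm C₀, ENNReal.ofReal_mul' hD0.le, ENNReal.ofReal_coe_nnreal, mul_assoc]
  refine ⟨C₀ * D, by positivity, fun Ξ a ρ ha => ?_⟩
  obtain ⟨hLp, hsup⟩ := happ Ξ a ρ ha
  refine ⟨fun p hp1 hp f hf => ?_, fun f hf => ?_⟩
  · obtain ⟨g, hg, hgp, hgn⟩ := hC₁ p hp1 hp f hf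
    refine ⟨(memLp_congr_ae hg.weakDiffOp_ae_eq).mpr hgp, hg.weakDiffOp_spec.2, ?_⟩
    refine (hLp p hp1 hp f g hg).trans ?_
    rw [← hmul]
    gcongr
    exact hgn.trans (by gcongr)
  · have hck : ∀ x, CkAt (2 * m) f x := fun x => hf.ckAt le_rfl x
    refine ⟨(isStrongDiffOp_diffOp hck).weakDiffOp_ae_eq, fun x => ?_⟩
    rw [← hmul]
    exact hsup f hck _ (fun y => (hC₂ f hf y).trans (by gcongr)) x
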